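/- **Setting.** Let $L$ be a (non-degenerate) even lattice of signature $(b_+,b_-)$, with dual lattice $L^*$, discriminant group $D_L=L^*/L$, and write $\lambda^2=(\lambda,\lambda)$, $\mathbf e(w)=e^{2\pi i w}$. $\mathrm{Gr}(L_{\mathbb R})$ is the set of orthogonal decompositions $v$: $L_{\mathbb R}=v_+\oplus v_-$ with $v_+$ positive definite and $v_-$ negative definite. $\mathrm{Mp}_2(\mathbb Z)$ is the group of pairs $(A,\phi)$ with $A=\begin{pmatrix}a&b\\c&d\end{pmatrix}\in\mathrm{SL}_2(\mathbb Z)$ and $\phi$ holomorphic on $\mathcal H$ with $\phi(\tau)^2=c\tau+d$, and $\rho_L$ is its Weil representation on $\mathbb C[D_L]$, given on the generators $T=\left(\begin{pmatrix}1&1\\0&1\end{pmatrix},1\right)$ and $S=\left(\begin{pmatrix}0&-1\\1&0\end{pmatrix},\sqrt\tau\right)$ by $$\rho_L(T)\mathfrak e_\gamma=\mathbf e\big(\tfrac{\gamma^2}{2}\big)\mathfrak e_\gamma,\qquad \rho_L(S)\mathfrak e_\gamma=\frac{\mathbf e\big(\frac{b_--b_+}{8}\big)}{\sqrt{|D_L|}}\sum_{\delta\in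 D_L}\mathbf e\big(-(\gamma,\delta)\big)\mathfrak e_\delta .$$ $\rho_L^*$ is the dual representation, on the dual space of $\mathbb C[D_L]$ with dual basis $\mathfrak e_\gamma^*$, and $\langle\cdot,\cdot\rangle_L$ is the natural pairing. A function $F$ is *modular of weight $k\in\frac12\mathbb Z$ and representation $\rho_L^*$* if it is a smooth (not necessarily holomorphic) function on $\mathcal H$ with $F(A\tau)=\phi(\tau)^{2k}\rho_L^*\big((A,\phi)\big)F(\tau)$ for all $(A,\phi)\in\mathrm{Mp}_2(\mathbb Z)$. A complex-valued polynomial $p$ on $L_{\mathbb R}$ is homogeneous of degree $(m_+,m_-)$ with respect to $v$ if $p(c_+\lambda_{v_+}+c_-\lambda_{v_-})=c_+^{m_+}c_-^{m_-}p(\lambda)$ for all $c_\pm\in\mathbb R$, $\lambda\in L_{\mathbb R}$, where $\lambda_{v_\pm}$ are the orthogonal projections. With $\Delta_v$ the Laplacian of the positive definite form that equals $(\cdot,\cdot)$ on $v_+$ and $-(\cdot,\cdot)$ on $v_-$ (which remain orthogonal), and $\tau=x+iy$, put $$\Theta_L(\tau;v,p):=y^{\frac{b_-}{2}+m_-}\sum_{\lambda\in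 L^*}\big(e^{-\Delta_v/8\pi y}p\big)(\lambda)\,\mathbf e\Big(\tau\tfrac{\lambda_{v_+}^2}{2}+\overline\tau\tfrac{\lambda_{v_-}^2}{2}\Big)\mathfrak e_{\lambda+L}.$$ With $\mathcal F_Y=\{\tau\in\mathcal H: |x|\le\frac12,\ |\tau|\ge1,\ y\le Y\}$, the regularized theta lift is $$\Phi_L(F;v,p):=\mathrm{CT}_{s=0}\lim_{Y\to\infty}\int_{\mathcal F_Y}\big\langle\Theta_L(\tau;v,p),F(\tau)\big\rangle_L\,y^{-s}\frac{dx\,dy}{y^2};$$ it is defined if the limit exists and is a holomorphic function of $s$ in some right half-plane with a meromorphic continuation to $\mathbb C$, and $\mathrm{CT}_{s=0}$ is the constant term of the Laurent expansion of that continuation at $s=0$. Let $M\subseteq L$ be a primitive non-degenerate sublattice of signature $(c_+,c_-)$, and fix $u^\perp\in\mathrm{Gr}(M_{\mathbb R}^\perp)$. For $u\in\mathrm{Gr}(M_{\mathbb R})$ let $u\oplus u^\perp\in\mathrm{Gr}(L_{\mathbb R})$ be given by $v_\pm=u_\pm\oplus u^\perp_\pm$. Let $0\le n_\pm\le m_\pm$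 be integers, let $p_{u^\perp}$ be a polynomial on $M_{\mathbb R}^\perp$, homogeneous of degree $(m_+-n_+,m_--n_-)$ with respect to $u^\perp$, and for every $u\in\mathrm{Gr}(M_{\mathbb R})$ let $p_u$ be a polynomial on $M_{\mathbb R}$, homogeneous of degree $(n_+,n_-)$ with respect to $u$. For $v=u\oplus u^\perp$ let $p_v(\lambda)=p_u(\lambda_{M_{\mathbb R}})\,p_{u^\perp}(\lambda_{M_{\mathbb R}^\perp})$. Let $\pi_M:L^*/M\to D_M$ be induced by the orthogonal projection $L^*\to M^*$, and define, with values in $\mathbb C[D_L]\otimes\mathbb C[D_M]^*$, $$\Theta_{L,M}(\tau;u^\perp,p_{u^\perp}):=y^{\frac{b_--c_-}{2}+m_--n_-}\sum_{\lambda\in L^*/M}\big(e^{-\Delta_{u^\perp}/8\pi y}p_{u^\perp}\big)(\lambda_{M_{\mathbb R}^\perp})\,\mathbf e\Big(\tau\tfrac{(\lambda_{M_{\mathbb R}^\perp})_{u^\perp_+}^2}{2}+\overline\tau\tfrac{(\lambda_{M_{\mathbb R}^\perp})_{u^\perp_-}^2}{2}\Big)\mathfrak e_{\lambda+L}\otimes\mathfrak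 e_{\pi_M(\lambda)}^* .$$ **Theorem.** Let $F$ be modular of weight $\frac{b_--b_+}{2}+m_--m_+$ and representation $\rho_L^*$. Then the theta contraction $$\Theta_{(L,M)}(F;u^\perp,p_{u^\perp}):\ \tau\mapsto\big\langle\Theta_{L,M}(\tau;u^\perp,p_{u^\perp}),F(\tau)\big\rangle_L$$ is modular of weight $\frac{c_--c_+}{2}+n_--n_+$ and representation $\rho_M^*$. Moreover, for every $u\in\mathrm{Gr}(M_{\mathbb R})$ and $v=u\oplus u^\perp$, the lift $\Phi_L(F;v,p_v)$ is defined if and only if $\Phi_M\big(\Theta_{(L,M)}(F;u^\perp,p_{u^\perp});u,p_u\big)$ is, and then $$\Phi_L(F;v,p_v)=\Phi_M\big(\Theta_{(L,M)}(F;u^\perp,p_{u^\perp});u,p_u\big).$$ -/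

import Mathlib

open scoped ContDiff MatrixGroups Topology
open UpperHalfPlane MeasureTheory Filter

noncomputable section

/-- `e w = exp (2 π i w)`. -/
def expTwoPiI (w : ℂ) : ℂ := Complex.exp (2 * Real.pi * Complex.I * w)

theorem expTwoPiI_add (a b : ℂ) : expTwoPiI (a + b) = expTwoPiI a * expTwoPiI b := by
  simp [expTwoPiI, mul_add, Complex.exp_add]

theorem expTwoPiI_int (n : ℤ) : expTwoPiI n = 1 := by
  rw [expTwoPiI, Complex.exp_eq_one_iff]
  exact ⟨n, by ring⟩

theorem expTwoPiI_zero : expTwoPiI 0 = 1 := by simp [expTwoPiI]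

theorem expTwoPiI_ne_zero (w : ℂ) : expTwoPiI w ≠ 0 := Complex.exp_ne_zero _

theorem expTwoPiI_eq_one (r : ℝ) (h : expTwoPiI (r : ℂ) = 1) : ∃ n : ℤ, r = n := by
  rw [expTwoPiI, Complex.exp_eq_one_iff] at h
  obtain ⟨n, hn⟩ := h
  refine ⟨n, ?_⟩
  have h2 : (2 * Real.pi * Complex.I : ℂ) ≠ 0 := by simp [Real.pi_ne_zero]
  have h3 : (r : ℂ) = n := by
    apply mul_left_cancel₀ h2
    rw [hn]; ring
  exact_mod_cast h3

/-! ### The metaplectic group -/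

/-- `Mp₂(ℤ)`: pairs of `A ∈ SL₂(ℤ)` and a holomorphic square root `φ` of `τ ↦ c τ + d`. -/
@[ext]
structure Mp2Z where
  mat : SL(2, ℤ)
  root : ℍ → ℂ
  holo : DifferentiableOn ℂ (fun z : ℂ => root (ofComplex z)) {z | 0 < z.im}
  sq : ∀ τ : ℍ, root τ ^ 2 = (mat 1 0 : ℂ) * τ + (mat 1 1 : ℂ)

namespace Mp2Z

theorem denom_eq (A : SL(2, ℤ)) (τ : ℍ) :
    denom (A : GL (Fin 2) ℝ) τ = (A 1 0 : ℂ) * τ + (A 1 1 : ℂ) := by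
  simp [denom]

theorem sq_denom (g : Mp2Z) (τ : ℍ) : g.root τ ^ 2 = denom (g.mat : GL (Fin 2) ℝ) τ := by
  rw [g.sq, denom_eq]

theorem root_ne_zero (g : Mp2Z) (τ : ℍ) : g.root τ ≠ 0 := by
  intro h
  have h2 := g.sq_denom τ
  rw [h] at h2
  exact denom_ne_zero _ τ (by rw [← h2]; simp)

theorem denom_mul (A B : SL(2, ℤ)) (τ : ℍ) :
    denom ((A * B : SL(2, ℤ)) : GL (Fin 2) ℝ) τ
      = denom (A : GL (Fin 2) ℝ) (B • τ : ℍ) * denom (B : GL (Fin 2) ℝ) τ := by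
  have h2 := denom_cocycle_σ (A : GL (Fin 2) ℝ) (B : GL (Fin 2) ℝ) τ
  have hs : ∀ z : ℂ, σ (B : GL (Fin 2) ℝ) z = z := fun z => by simp [σ]
  rw [hs] at h2
  simpa using h2

theorem holo_iff (f : ℍ → ℂ) :
    DifferentiableOn ℂ (fun z : ℂ => f (ofComplex z)) {z | 0 < z.im}
      ↔ MDifferentiable (modelWithCornersSelf ℂ ℂ) (modelWithCornersSelf ℂ ℂ) f :=
  (UpperHalfPlane.mdifferentiable_iff (f := f)).symm

theorem mdiff_smul (A : SL(2, ℤ)) :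
    MDifferentiable (modelWithCornersSelf ℂ ℂ) (modelWithCornersSelf ℂ ℂ)
      (fun τ : ℍ => A • τ) :=
  UpperHalfPlane.mdifferentiable_smul (g := (A : GL (Fin 2) ℝ)) (by simp)

instance : Mul Mp2Z where
  mul g h :=
    { mat := g.mat * h.mat
      root := fun τ => g.root (h.mat • τ) * h.root τ
      holo := by
        refine (holo_iff (fun τ => g.root (h.mat • τ) * h.root τ)).2 ?_
        exact (((holo_iff _).1 g.holo).comp (mdiff_smul h.mat)).mul ((holo_iff _).1 h.holo)
      sq := fun τ => by
        rw [mul_pow, g.sq_denom, h.sq_denom, ← denom_mul, denom_eq] }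

instance : One Mp2Z where
  one :=
    { mat := 1
      root := fun _ => 1
      holo := differentiableOn_const _
      sq := fun τ => by simp }

instance : Inv Mp2Z where
  inv g :=
    { mat := g.mat⁻¹
      root := fun τ => (g.root (g.mat⁻¹ • τ))⁻¹
      holo := by
        have h : DifferentiableOn ℂ
            (fun z : ℂ => g.root (g.mat⁻¹ • ofComplex z)) {z | 0 < z.im} := by
          have := ((holo_iff _).1 g.holo).comp (mdiff_smul g.mat⁻¹)
          exact (holo_iff _).2 this
        exact h.inv (fun z _ => g.root_ne_zero _)
      sq := fun τ => by
        rw [inv_pow, g.sq_denom, ← denom_eq]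
        have h := denom_mul g.mat g.mat⁻¹ τ
        have h1 : denom ((1 : SL(2, ℤ)) : GL (Fin 2) ℝ) τ = 1 := by simp
        rw [mul_inv_cancel, h1] at h
        exact inv_eq_of_mul_eq_one_right h.symm }

@[simp] theorem mul_mat (g h : Mp2Z) : (g * h).mat = g.mat * h.mat := rfl
@[simp] theorem mul_root (g h : Mp2Z) (τ : ℍ) :
    (g * h).root τ = g.root (h.mat • τ) * h.root τ := rfl
@[simp] theorem one_mat : (1 : Mp2Z).mat = 1 := rfl
@[simp] theorem one_root (τ : ℍ) : (1 : Mp2Z).root τ = 1 := rfl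
@[simp] theorem inv_mat (g : Mp2Z) : (g⁻¹).mat = g.mat⁻¹ := rfl
@[simp] theorem inv_root (g : Mp2Z) (τ : ℍ) :
    (g⁻¹).root τ = (g.root (g.mat⁻¹ • τ))⁻¹ := rfl

instance : Group Mp2Z :=
  Group.ofLeftAxioms
    (fun a b c => by
      ext τ
      · simp [mul_assoc]
      · simp [mul_assoc, mul_smul])
    (fun a => by
      ext τ
      · simp
      · simp)
    (fun a => by
      ext τ
      · simp
      · simp [a.root_ne_zero])

/-- The generator `T = (1 1; 0 1)`, with root `1`. -/
def T : Mp2Z where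
  mat := ModularGroup.T
  root := fun _ => 1
  holo := differentiableOn_const _
  sq := fun τ => by simp [ModularGroup.T]

/-- The generator `S = (0 -1; 1 0)`, with root the principal branch of `√τ`. -/
def S : Mp2Z where
  mat := ModularGroup.S
  root := fun τ => (τ : ℂ) ^ (1 / 2 : ℂ)
  holo := by
    have h : DifferentiableOn ℂ (fun z : ℂ => z ^ (1 / 2 : ℂ)) {z | 0 < z.im} := by
      intro z hz
      refine (DifferentiableAt.cpow_const differentiableAt_id (Or.inr ?_)).differentiableWithinAt
      exact ne_of_gt hz
    refine h.congr fun z hz => ?_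
    simp only [ofComplex_apply_of_im_pos hz]
  sq := fun τ => by
    rw [← Complex.cpow_nat_mul]
    simp [ModularGroup.S]

/-- The projection to `SL₂(ℤ)`. -/
def toSL : Mp2Z →* SL(2, ℤ) where
  toFun := mat
  map_one' := rfl
  map_mul' _ _ := rfl

theorem closure_T_S : Subgroup.closure {T, S} = (⊤ : Subgroup Mp2Z) := by
  set H := Subgroup.closure {T, S} with hH
  have hT : T ∈ H := Subgroup.subset_closure (by simp)
  have hS : S ∈ H := Subgroup.subset_closure (by simp)
  have hmap : H.map toSL = ⊤ := by
    rw [hH, MonoidHom.map_closure, Set.image_pair, Set.pair_comm]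
    exact SpecialLinearGroup.SL2Z_generators
  rw [eq_top_iff]
  intro g _
  have hg : g.mat ∈ H.map toSL := by rw [hmap]; trivial
  obtain ⟨h, hh, hhg⟩ := hg
  have hmat : h.mat = g.mat := hhg
  have hkmat : (g * h⁻¹).mat = 1 := by rw [mul_mat, inv_mat, hmat, mul_inv_cancel]
  set k := g * h⁻¹ with hk
  have hk2 : ∀ τ, k.root τ ^ 2 = 1 := fun τ => by rw [k.sq, hkmat]; simp
  have hcont : Continuous k.root := ((holo_iff _).1 k.holo).continuous
  have hkH : k ∈ H := by
    have hpre : IsPreconnected (Set.univ : Set ℍ) := isPreconnected_univ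
    have hor := hpre.eq_one_or_eq_neg_one_of_sq_eq hcont.continuousOn
      (fun τ _ => by simpa using hk2 τ)
    rcases hor with h1 | h1
    · have : k = 1 := by
        ext1
        · exact hkmat
        · funext τ; exact h1 (Set.mem_univ τ)
      rw [this]; exact one_mem H
    · have : k = (S * S) * (S * S) := by
        have hSS : (S * S).mat = -1 := by
          rw [mul_mat]
          change ModularGroup.S * ModularGroup.S = -1
          decide
        ext1
        · rw [hkmat, mul_mat, hSS]; simp
        · funext τ
          have e1 : k.root τ = -1 := h1 (Set.mem_univ τ)
          have e2 := (S * S).sq τ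
          rw [hSS] at e2
          rw [e1, mul_root (S * S) (S * S) τ, hSS]
          have e3 : ((-1 : SL(2, ℤ)) • τ : ℍ) = τ := by simp
          rw [e3, ← pow_two, e2]
          simp
      rw [this]
      exact mul_mem (mul_mem hS hS) (mul_mem hS hS)
  have : g = k * h := by rw [hk]; group
  rw [this]
  exact mul_mem hkH hh

end Mp2Z

/-! ### Decompositions of a real quadratic space and polynomials -/

section Quadratic

variable {W : Type*} [AddCommGroup W] [Module ℝ W] [FiniteDimensional ℝ W]

/-- The Grassmannian of the quadratic space `(W, B)`: orthogonal decompositions of `W` into a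
positive definite and a negative definite subspace. -/
structure Grass (B : LinearMap.BilinForm ℝ W) where
  pos : Submodule ℝ W
  neg : Submodule ℝ W
  isCompl : IsCompl pos neg
  pos_def : ∀ x ∈ pos, x ≠ 0 → 0 < B x x
  neg_def : ∀ x ∈ neg, x ≠ 0 → B x x < 0
  orth : ∀ x ∈ pos, ∀ y ∈ neg, B x y = 0

/-- Complex-valued polynomial functions on `W`: the algebra generated by the real linear forms. -/
def realPolyFunctions (W : Type*) [AddCommGroup W] [Module ℝ W] : Subalgebra ℂ (W → ℂ) :=
  Algebra.adjoin ℂ (Set.range fun (l : Module.Dual ℝ W) (x : W) => ((l x : ℝ) : ℂ))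

namespace Grass

variable {B : LinearMap.BilinForm ℝ W} (v : Grass B)

/-- The projection `x ↦ x_{v₊}`. -/
def projPos : W →ₗ[ℝ] W := v.pos.projection v.neg v.isCompl

/-- The projection `x ↦ x_{v₋}`. -/
def projNeg : W →ₗ[ℝ] W := v.neg.projection v.pos v.isCompl.symm

/-- `p` is a polynomial function, homogeneous of degree `(m₊, m₋)` with respect to `v`. -/
def IsHomogeneous (p : W → ℂ) (mp mn : ℕ) : Prop :=
  p ∈ realPolyFunctions W ∧ ∀ (cp cn : ℝ) (x : W),
    p (cp • v.projPos x + cn • v.projNeg x) = (cp : ℂ) ^ mp * (cn : ℂ) ^ mn * p x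

/-- The majorant of `B` at `v`, that is `B` on `v₊` and `-B` on `v₋`. -/
def majorant (x y : W) : ℝ :=
  B (v.projPos x) (v.projPos y) - B (v.projNeg x) (v.projNeg y)

/-- The Laplacian `Δ_v` of the majorant, `∑ g^{ij} ∂_i ∂_j` with `g` the Gram matrix
of a basis. -/
def laplacian (p : W → ℂ) (x : W) : ℂ :=
  let b := Module.finBasis ℝ W
  ∑ i, ∑ j, (((Matrix.of fun k l => v.majorant (b k) (b l))⁻¹ i j : ℝ) : ℂ) *
    lineDeriv ℝ (fun y => lineDeriv ℝ p y (b j)) x (b i)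

/-- `e^{c Δ_v} p`; the series is finite on polynomials. -/
def expLaplacian (c : ℝ) (p : W → ℂ) (x : W) : ℂ :=
  ∑' j : ℕ, ((c ^ j / j.factorial : ℝ) : ℂ) * (v.laplacian^[j] p) x

/-- `e^{-Δ_v / 8πy}(p)(x) · e(τ x_{v₊}² / 2 + τ̄ x_{v₋}² / 2)`, for `τ = x + i y`. -/
def thetaTerm (p : W → ℂ) (τ : ℍ) (x : W) : ℂ :=
  v.expLaplacian (-1 / (8 * Real.pi * τ.im)) p x *
    expTwoPiI ((τ : ℂ) * ((B (v.projPos x) (v.projPos x) : ℝ) : ℂ) / 2 +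
      (starRingEnd ℂ) (τ : ℂ) * ((B (v.projNeg x) (v.projNeg x) : ℝ) : ℂ) / 2)

end Grass

end Quadratic

/-! ### Even lattices and the Weil representation -/

/-- A non-degenerate even lattice `L`, realised in `L_ℝ = V`. -/
structure EvenLattice (V : Type*) [AddCommGroup V] [Module ℝ V] where
  form : LinearMap.BilinForm ℝ V
  symm : form.IsSymm
  nondeg : form.Nondegenerate
  carrier : Submodule ℤ V
  exists_basis : ∃ (n : ℕ) (b : Module.Basis (Fin n) ℝ V),
    carrier = Submodule.span ℤ (Set.range b)
  even : ∀ x ∈ carrier, ∃ n : ℤ, form x x = 2 * n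

namespace EvenLattice

variable {V : Type*} [AddCommGroup V] [Module ℝ V] (L : EvenLattice V)

/-- The Grassmannian of `L_ℝ`. -/
abbrev Gr := Grass L.form

/-- The number `b₊`, where `(b₊, b₋)` is the signature of `L`. -/
def bPos : ℕ := sigPos (LinearMap.BilinMap.toQuadraticMap L.form)

/-- The number `b₋`, where `(b₊, b₋)` is the signature of `L`. -/
def bNeg : ℕ := sigNeg (LinearMap.BilinMap.toQuadraticMap L.form)

/-- The dual lattice `L^*`. -/
def dual : Submodule ℤ V := L.form.dualSubmodule L.carrier

theorem mem_dual {x : V} : x ∈ L.dual ↔ ∀ y ∈ L.carrier, ∃ n : ℤ, L.form x y = n := by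
  simp [dual, LinearMap.BilinForm.mem_dualSubmodule, Submodule.mem_one, eq_comm]

theorem integral {x y : V} (hx : x ∈ L.carrier) (hy : y ∈ L.carrier) :
    ∃ n : ℤ, L.form x y = n := by
  obtain ⟨a, ha⟩ := L.even _ hx
  obtain ⟨b, hb⟩ := L.even _ hy
  obtain ⟨c, hc⟩ := L.even _ (add_mem hx hy)
  refine ⟨c - a - b, ?_⟩
  have hs : L.form y x = L.form x y := L.symm.eq y x
  simp only [map_add, LinearMap.add_apply] at hc
  push_cast
  linarith

theorem carrier_le_dual : L.carrier ≤ L.dual :=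
  fun _ hx => L.mem_dual.2 fun _ hy => L.integral hx hy

/-- The discriminant group `D_L = L^*/L`. -/
abbrev Disc := L.dual ⧸ L.carrier.submoduleOf L.dual

instance finite_disc : Finite L.Disc := by
  classical
  obtain ⟨n, b, hb⟩ := L.exists_basis
  let b' := L.form.dualBasis L.nondeg b
  have hd : L.dual = Submodule.span ℤ (Set.range b') := by
    rw [dual, hb]
    exact LinearMap.BilinForm.dualSubmodule_span_of_basis L.form L.nondeg b
  have hli' : LinearIndependent ℤ b' := b'.linearIndependent.restrict_scalars' ℤ
  have hli : LinearIndependent ℤ b := b.linearIndependent.restrict_scalars' ℤ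
  have hr' : Module.finrank ℤ L.dual = n := by
    rw [hd, finrank_span_eq_card hli']; simp
  have hr : Module.finrank ℤ L.carrier = n := by
    rw [hb, finrank_span_eq_card hli]; simp
  have hfree : Module.Free ℤ L.dual := by
    rw [hd]; exact Module.Free.of_basis (Module.Basis.span hli')
  have hfin : Module.Finite ℤ L.dual := by
    rw [hd]; exact Module.Finite.of_basis (Module.Basis.span hli')
  refine Submodule.finiteQuotientOfFreeOfRankEq _ ?_
  rw [hr', ← hr]
  exact (Submodule.submoduleOfEquivOfLe L.carrier_le_dual).finrank_eq

instance : Fintype L.Disc := Fintype.ofFinite _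

instance : DecidableEq L.Disc := Classical.decEq _

/-- The class in `D_L` of a vector of `L^*`. -/
abbrev toDisc : L.dual →ₗ[ℤ] L.Disc := (L.carrier.submoduleOf L.dual).mkQ

/-- `e(γ²/2)`, for `γ ∈ D_L`. -/
def eNorm (γ : L.Disc) : ℂ :=
  expTwoPiI (((L.form (γ.out : L.dual) (γ.out : L.dual) : ℝ) : ℂ) / 2)

/-- `e((γ, δ))`, for `γ, δ ∈ D_L`. -/
def ePair (γ δ : L.Disc) : ℂ :=
  expTwoPiI ((L.form (γ.out : L.dual) (δ.out : L.dual) : ℝ) : ℂ)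

theorem out_sub_mem (x : L.dual) :
    ((L.toDisc x).out : V) - x ∈ L.carrier := by
  have h : L.toDisc (L.toDisc x).out = L.toDisc x := Quotient.out_eq _
  have h2 := (Submodule.Quotient.eq _).1 h
  exact h2

/-- The value of `e(γ²/2)` does not depend on the representative. -/
theorem eNorm_toDisc (x : L.dual) :
    L.eNorm (L.toDisc x) = expTwoPiI (((L.form x x : ℝ) : ℂ) / 2) := by
  have hm := L.out_sub_mem x
  set l : V := ((L.toDisc x).out : V) - x with hl
  have hx : ((L.toDisc x).out : V) = x + l := by rw [hl]; abel
  obtain ⟨a, ha⟩ := L.even l hm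
  obtain ⟨c, hc⟩ := L.mem_dual.1 x.2 l hm
  have hs : L.form l x = L.form x l := L.symm.eq l x
  rw [eNorm, hx]
  have : L.form ((x : V) + l) ((x : V) + l) = L.form x x + 2 * ((a + c : ℤ) : ℝ) := by
    simp only [map_add, LinearMap.add_apply, hs, hc, ha]
    push_cast; ring
  rw [this]
  have h2 : (((L.form x x + 2 * ((a + c : ℤ) : ℝ) : ℝ) : ℂ) / 2)
      = ((L.form x x : ℝ) : ℂ) / 2 + ((a + c : ℤ) : ℂ) := by
    push_cast; ring
  rw [h2, expTwoPiI_add, expTwoPiI_int, mul_one]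

/-- The value of `e((γ, δ))` does not depend on the representatives. -/
theorem ePair_toDisc (x y : L.dual) :
    L.ePair (L.toDisc x) (L.toDisc y) = expTwoPiI ((L.form x y : ℝ) : ℂ) := by
  have hm := L.out_sub_mem x
  have hm' := L.out_sub_mem y
  set l : V := ((L.toDisc x).out : V) - x with hl
  set l' : V := ((L.toDisc y).out : V) - y with hl'
  have hx : ((L.toDisc x).out : V) = x + l := by rw [hl]; abel
  have hy : ((L.toDisc y).out : V) = y + l' := by rw [hl']; abel
  obtain ⟨a, ha⟩ := L.mem_dual.1 x.2 l' hm'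
  obtain ⟨b, hb⟩ := L.mem_dual.1 y.2 l hm
  obtain ⟨c, hc⟩ := L.integral hm hm'
  have hs : L.form l y = L.form y l := L.symm.eq l y
  rw [ePair, hx, hy]
  have : L.form ((x : V) + l) ((y : V) + l') = L.form x y + ((a + b + c : ℤ) : ℝ) := by
    simp only [map_add, LinearMap.add_apply, hs, hb, ha, hc]
    push_cast; ring
  rw [this]
  have h2 : ((L.form x y + ((a + b + c : ℤ) : ℝ) : ℝ) : ℂ)
      = ((L.form x y : ℝ) : ℂ) + ((a + b + c : ℤ) : ℂ) := by
    push_cast; ring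
  rw [h2, expTwoPiI_add, expTwoPiI_int, mul_one]

/-- The scalar `e((b₋ - b₊)/8) / √|D_L|`. -/
def weilScalar : ℂ :=
  expTwoPiI (((L.bNeg : ℂ) - (L.bPos : ℂ)) / 8) / (Real.sqrt (Fintype.card L.Disc) : ℂ)

/-- The operator `ρ_L(T)` of the Weil representation: `𝔢_γ ↦ e(γ²/2) 𝔢_γ`. -/
def weilMatrixT : Matrix L.Disc L.Disc ℂ := Matrix.diagonal L.eNorm

/-- The operator `ρ_L(S)` of the Weil representation:
`𝔢_γ ↦ e((b₋ - b₊)/8) / √|D_L| · ∑_δ e(-(γ, δ)) 𝔢_δ`. -/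
def weilMatrixS : Matrix L.Disc L.Disc ℂ :=
  Matrix.of fun δ γ => L.weilScalar * (L.ePair γ δ)⁻¹

theorem ePair_add_left (a b c : L.Disc) : L.ePair (a + b) c = L.ePair a c * L.ePair b c := by
  obtain ⟨x, rfl⟩ := Submodule.mkQ_surjective _ a
  obtain ⟨y, rfl⟩ := Submodule.mkQ_surjective _ b
  obtain ⟨z, rfl⟩ := Submodule.mkQ_surjective _ c
  rw [← map_add]
  rw [L.ePair_toDisc, L.ePair_toDisc, L.ePair_toDisc, ← expTwoPiI_add]
  simp

theorem ePair_comm (a b : L.Disc) : L.ePair a b = L.ePair b a := by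
  have hs : L.form (a.out : L.dual) (b.out : L.dual) = L.form (b.out : L.dual) (a.out : L.dual) :=
    L.symm.eq _ _
  rw [ePair, ePair, hs]

theorem ePair_ne_zero (a b : L.Disc) : L.ePair a b ≠ 0 := expTwoPiI_ne_zero _

theorem ePair_zero_left (a : L.Disc) : L.ePair 0 a = 1 := by
  have h := L.ePair_add_left 0 0 a
  rw [add_zero] at h
  exact (mul_eq_left₀ (L.ePair_ne_zero 0 a)).1 h.symm

/-- The character `γ ↦ e((γ, δ))`. -/
def ePairChar (δ : L.Disc) : AddChar L.Disc ℂ where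
  toFun γ := L.ePair γ δ
  map_zero_eq_one' := L.ePair_zero_left δ
  map_add_eq_mul' a b := L.ePair_add_left a b δ

/-- The discriminant pairing is non-degenerate. -/
theorem ePair_nondegenerate (δ : L.Disc) (h : ∀ γ, L.ePair γ δ = 1) : δ = 0 := by
  obtain ⟨y, rfl⟩ := Submodule.mkQ_surjective _ δ
  obtain ⟨n, b, hb⟩ := L.exists_basis
  have hmem : (y : V) ∈ L.form.dualSubmodule (L.form.dualSubmodule L.carrier) := by
    rw [LinearMap.BilinForm.mem_dualSubmodule]
    intro x hx
    have hx' := h (L.toDisc ⟨x, hx⟩)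
    rw [L.ePair_toDisc] at hx'
    obtain ⟨m, hm⟩ := expTwoPiI_eq_one _ hx'
    rw [Submodule.mem_one]
    refine ⟨m, ?_⟩
    rw [L.symm.eq x y] at hm
    simpa using hm.symm
  rw [hb, LinearMap.BilinForm.dualSubmodule_dualSubmodule_of_basis L.form L.nondeg L.symm, ← hb] at hmem
  exact (Submodule.Quotient.mk_eq_zero _).2 hmem

theorem sum_ePair (δ : L.Disc) :
    ∑ γ, L.ePair γ δ = if δ = 0 then (Fintype.card L.Disc : ℂ) else 0 := by
  have h := AddChar.sum_eq_ite (L.ePairChar δ)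
  have h2 : L.ePairChar δ = 0 ↔ δ = 0 := by
    constructor
    · intro h0
      refine L.ePair_nondegenerate δ fun γ => ?_
      have := DFunLike.congr_fun h0 γ
      simpa [ePairChar] using this
    · rintro rfl
      ext γ
      change L.ePair γ 0 = 1
      rw [L.ePair_comm, L.ePair_zero_left]
  simp only [h2] at h
  exact h

theorem weilScalar_ne_zero : L.weilScalar ≠ 0 := by
  refine div_ne_zero (expTwoPiI_ne_zero _) ?_
  have : (0 : ℝ) < Fintype.card L.Disc := by exact_mod_cast Fintype.card_pos
  exact_mod_cast (Real.sqrt_pos.2 this).ne'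

theorem isUnit_weilMatrixT : IsUnit L.weilMatrixT.det := by
  rw [weilMatrixT, Matrix.det_diagonal, isUnit_iff_ne_zero]
  exact Finset.prod_ne_zero_iff.2 fun γ _ => expTwoPiI_ne_zero _

theorem isUnit_weilMatrixS : IsUnit L.weilMatrixS.det := by
  have hcard : (Fintype.card L.Disc : ℂ) ≠ 0 := by exact_mod_cast Fintype.card_ne_zero
  let N : Matrix L.Disc L.Disc ℂ :=
    Matrix.of fun γ ε => L.weilScalar⁻¹ * (Fintype.card L.Disc : ℂ)⁻¹ * L.ePair γ ε
  have hN : L.weilMatrixS * N = 1 := by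
    ext δ ε
    have hterm : ∀ γ, L.weilMatrixS δ γ * N γ ε
        = (Fintype.card L.Disc : ℂ)⁻¹ * L.ePair γ (ε - δ) := by
      intro γ
      have hp : L.ePair γ ε = L.ePair γ (ε - δ) * L.ePair γ δ := by
        rw [L.ePair_comm γ ε, L.ePair_comm γ (ε - δ), L.ePair_comm γ δ, ← L.ePair_add_left,
          sub_add_cancel]
      simp only [weilMatrixS, N, Matrix.of_apply, hp]
      have h1 := L.weilScalar_ne_zero
      have h2 := L.ePair_ne_zero γ δ
      field_simp
    rw [Matrix.mul_apply]
    simp only [hterm]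
    rw [← Finset.mul_sum, L.sum_ePair, Matrix.one_apply]
    by_cases h : δ = ε
    · simp [h, hcard]
    · have h' : ε - δ ≠ 0 := fun h0 => h (sub_eq_zero.1 h0).symm
      simp [h, h']
  have := congrArg Matrix.det hN
  rw [Matrix.det_mul, Matrix.det_one] at this
  exact IsUnit.of_mul_eq_one _ this

/-- `ρ_L(T)` as an invertible operator on `ℂ[D_L]`. -/
def weilT : GL L.Disc ℂ := Matrix.GeneralLinearGroup.mk'' L.weilMatrixT L.isUnit_weilMatrixT

/-- `ρ_L(S)` as an invertible operator on `ℂ[D_L]`. -/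
def weilS : GL L.Disc ℂ := Matrix.GeneralLinearGroup.mk'' L.weilMatrixS L.isUnit_weilMatrixS

/-- The graph `{(g, ρ_L(g))}` of the Weil representation `ρ_L` of `Mp₂(ℤ)` on `ℂ[D_L]`: the
representation is determined by its values on the generators `T` and `S`, so that its graph is the
subgroup generated by `(T, ρ_L(T))` and `(S, ρ_L(S))`. -/
def weilGraph : Subgroup (Mp2Z × GL L.Disc ℂ) :=
  Subgroup.closure {(Mp2Z.T, L.weilT), (Mp2Z.S, L.weilS)}

/-- Every element of `Mp₂(ℤ)` occurs in the graph of the Weil representation. -/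
theorem exists_mem_weilGraph (g : Mp2Z) : ∃ A, (g, A) ∈ L.weilGraph := by
  have h : Subgroup.map (MonoidHom.fst Mp2Z (GL L.Disc ℂ)) L.weilGraph = ⊤ := by
    rw [weilGraph, MonoidHom.map_closure, Set.image_pair]
    exact Mp2Z.closure_T_S
  have hg : g ∈ Subgroup.map (MonoidHom.fst Mp2Z (GL L.Disc ℂ)) L.weilGraph := by
    rw [h]; trivial
  obtain ⟨⟨g', A⟩, hA, rfl⟩ := hg
  exact ⟨A, hA⟩

/-- `F`, a function with values in the dual `ℂ[D_{L(-1)}]` of `ℂ[D_L]` written in the dual basis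
`𝔢_γ^*`, is a (smooth, not necessarily holomorphic) modular form of weight `κ / 2` and
representation `ρ_L^*`: it is smooth, and `F(Aτ) = φ(τ)^κ ρ_L^*((A, φ)) F(τ)` for all
`(A, φ) ∈ Mp₂(ℤ)`, where `ρ_L^*((A, φ))` is the inverse transpose of `ρ_L((A, φ))`. -/
def IsDualModularForm (κ : ℤ) (F : ℍ → L.Disc → ℂ) : Prop :=
  ContDiffOn ℝ ∞ (fun z : ℂ => F (ofComplex z)) {z | 0 < z.im} ∧
  ∀ (g : Mp2Z) (A : GL L.Disc ℂ), (g, A) ∈ L.weilGraph → ∀ τ : ℍ,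
    F (g.mat • τ) = g.root τ ^ κ •
      (Matrix.transpose (A⁻¹ : GL L.Disc ℂ).val).mulVec (F τ)

/-- The pairing `⟨U, U'⟩_L` of `ℂ[D_L]` with its dual `ℂ[D_{L(-1)}]`. -/
def pairing (U U' : L.Disc → ℂ) : ℂ := ∑ γ, U γ * U' γ

/-! ### Theta functions and theta lifts -/

section Lift

variable [FiniteDimensional ℝ V]

/-- The Siegel theta function `Θ_L(τ; v, p)`, for `p` of degree `(m₊, m₋)` with respect to `v`
(only `mn = m₋` enters). -/
def theta (v : L.Gr) (mn : ℕ) (p : V → ℂ) (τ : ℍ) : L.Disc → ℂ :=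
  ((τ.im ^ ((L.bNeg : ℝ) / 2 + mn) : ℝ) : ℂ) •
    ∑' x : L.dual, v.thetaTerm p τ x • (Pi.single (L.toDisc x) 1 : L.Disc → ℂ)

/-- `∫_{𝓕_Y} ⟨Θ_L(τ; v, p), F(τ)⟩_L y^{-s} dx dy / y²`; the measure on `ℍ` is `dx dy / y²`. -/
def truncatedLift (v : L.Gr) (mn : ℕ) (p : V → ℂ) (F : ℍ → L.Disc → ℂ) (s : ℂ) (Y : ℝ) : ℂ :=
  ∫ τ in ModularGroup.truncatedFundamentalDomain Y,
    L.pairing (L.theta v mn p τ) (F τ) * ((τ.im : ℝ) : ℂ) ^ (-s)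

end Lift

end EvenLattice

/-- `c` is the constant term at `0` of the Laurent expansion of `g`. -/
def IsConstantTerm (g : ℂ → ℂ) (c : ℂ) : Prop :=
  ∃ (N : ℕ) (a : Fin N → ℂ) (h : ℂ → ℂ), AnalyticAt ℂ h 0 ∧ h 0 = c ∧
    ∀ᶠ s in 𝓝[≠] (0 : ℂ), g s = (∑ j : Fin N, a j / s ^ ((j : ℕ) + 1)) + h s

namespace EvenLattice

variable {V : Type*} [AddCommGroup V] [Module ℝ V] [FiniteDimensional ℝ V] (L : EvenLattice V)

/-- The regularized theta lift `Φ_L(F; v, p)` is defined, with value `c`: the limit over `Y` of the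
truncated integrals is holomorphic in a right half-plane, extends to a meromorphic function
on `ℂ`, and `c` is the constant term of the latter at `s = 0`. -/
def HasThetaLift (v : L.Gr) (mn : ℕ) (p : V → ℂ) (F : ℍ → L.Disc → ℂ) (c : ℂ) : Prop :=
  ∃ (r : ℝ) (g : ℂ → ℂ), Meromorphic g ∧ DifferentiableOn ℂ g {s | r < s.re} ∧
    (∀ s : ℂ, r < s.re → Tendsto (L.truncatedLift v mn p F s) atTop (𝓝 (g s))) ∧
    IsConstantTerm g c

open Classical in
/-- The regularized theta lift `Φ_L(F; v, p)` (zero where it is not defined). -/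
def thetaLift (v : L.Gr) (mn : ℕ) (p : V → ℂ) (F : ℍ → L.Disc → ℂ) : ℂ :=
  if h : ∃ c, L.HasThetaLift v mn p F c then h.choose else 0

end EvenLattice

/-! ### Primitive sublattices -/

/-- A primitive non-degenerate sublattice `M` of `L`. -/
structure PrimitiveSublattice {V : Type*} [AddCommGroup V] [Module ℝ V]
    (L : EvenLattice V) where
  carrier : Submodule ℤ V
  le : carrier ≤ L.carrier
  primitive : ∀ x ∈ L.carrier, ∀ n : ℤ, n ≠ 0 → n • x ∈ carrier → x ∈ carrier
  nondeg : (L.form.restrict (Submodule.span ℝ (carrier : Set V))).Nondegenerate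

namespace PrimitiveSublattice

section Basic

variable {V : Type*} [AddCommGroup V] [Module ℝ V] {L : EvenLattice V}
  (M : PrimitiveSublattice L)

/-- The real space `M_ℝ`. -/
abbrev real : Submodule ℝ V := Submodule.span ℝ (M.carrier : Set V)

/-- The orthogonal complement `M_ℝ^⊥` of `M_ℝ` in `L_ℝ`. -/
abbrev perp : Submodule ℝ V := L.form.orthogonal M.real

theorem exists_real_basis : ∃ (n : ℕ) (b : Module.Basis (Fin n) ℝ M.real),
    M.carrier.comap (M.real.subtype.restrictScalars ℤ) = Submodule.span ℤ (Set.range b) := by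
  obtain ⟨n, b, hb⟩ := L.exists_basis
  have hle : M.carrier ≤ Submodule.span ℤ (Set.range b) := hb ▸ M.le
  have hb' : LinearIndependent ℤ b := b.linearIndependent.restrict_scalars' ℤ
  have hfinL : Module.Finite ℤ (Submodule.span ℤ (Set.range b)) :=
    Module.Finite.of_basis (Module.Basis.span hb')
  have hfreeL : Module.Free ℤ (Submodule.span ℤ (Set.range b)) :=
    Module.Free.of_basis (Module.Basis.span hb')
  let e := Submodule.submoduleOfEquivOfLe hle
  have hfin : Module.Finite ℤ M.carrier := Module.Finite.equiv e
  have hfree : Module.Free ℤ M.carrier := Module.Free.of_equiv e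
  let c := Module.finBasis ℤ M.carrier
  let f : M.carrier →ₗ[ℤ] (Fin n → ℤ) :=
    (b.restrictScalars ℤ).equivFun.toLinearMap.comp (Submodule.inclusion hle)
  have hf : Function.Injective f :=
    (b.restrictScalars ℤ).equivFun.injective.comp (Submodule.inclusion_injective hle)
  have h1 : LinearIndependent ℤ (fun i => f (c i)) :=
    c.linearIndependent.map' f (LinearMap.ker_eq_bot.2 hf)
  have h2 := linearIndependent_algebraMap_comp_iff (S := ℝ).2 h1
  have h3 : (fun i => algebraMap ℤ ℝ ∘ f (c i)) = fun i => b.equivFun (c i : V) := by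
    funext i j
    simp only [Function.comp_apply, f, LinearMap.comp_apply, LinearEquiv.coe_coe,
      Module.Basis.equivFun_apply]
    rw [Module.Basis.restrictScalars_repr_apply]
    rfl
  rw [h3] at h2
  have h4 : LinearIndependent ℝ (fun i => (c i : V)) :=
    LinearIndependent.of_comp b.equivFun.toLinearMap h2
  let c' : Fin (Module.finrank ℤ M.carrier) → M.real :=
    fun i => ⟨c i, Submodule.subset_span (c i).2⟩
  have h5 : LinearIndependent ℝ c' := LinearIndependent.of_comp M.real.subtype h4
  have hspanZ : M.carrier = Submodule.span ℤ (Set.range fun i => (c i : V)) := by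
    have := congrArg (Submodule.map M.carrier.subtype) c.span_eq
    rw [Submodule.map_span, Submodule.map_top, Submodule.range_subtype, ← Set.range_comp] at this
    exact this.symm
  have hcomp : (M.real.subtype.restrictScalars ℤ) ∘ c' = fun i => (c i : V) := rfl
  have hmapZ : (Submodule.span ℤ (Set.range c')).map (M.real.subtype.restrictScalars ℤ)
      = M.carrier := by
    rw [Submodule.map_span, ← Set.range_comp, hcomp, ← hspanZ]
  have hspanR : ⊤ ≤ Submodule.span ℝ (Set.range c') := by
    have hmap : (Submodule.span ℝ (Set.range c')).map M.real.subtype = M.real := by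
      rw [Submodule.map_span, ← Set.range_comp]
      apply le_antisymm
      · rw [Submodule.span_le]
        rintro _ ⟨i, rfl⟩
        exact (c' i).2
      · refine Submodule.span_le.2 ?_
        intro x hx
        rw [SetLike.mem_coe, hspanZ] at hx
        exact Submodule.span_le_restrictScalars ℤ ℝ _ hx
    intro x _
    have hx : (x : V) ∈ (Submodule.span ℝ (Set.range c')).map M.real.subtype := by
      rw [hmap]; exact x.2
    obtain ⟨y, hy, hyx⟩ := hx
    rwa [← Subtype.ext hyx]
  refine ⟨_, Module.Basis.mk h5 hspanR, ?_⟩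
  rw [Module.Basis.coe_mk]
  refine (congrArg (Submodule.comap (M.real.subtype.restrictScalars ℤ)) hmapZ.symm).trans ?_
  exact Submodule.comap_map_eq_of_injective
    (f := M.real.subtype.restrictScalars ℤ) Subtype.val_injective _

/-- The sublattice `M` as an even lattice, realised in `M_ℝ`. -/
def toLattice : EvenLattice M.real where
  form := L.form.restrict M.real
  symm := ⟨fun x y => L.symm.eq x y⟩
  nondeg := M.nondeg
  carrier := M.carrier.comap (M.real.subtype.restrictScalars ℤ)
  exists_basis := M.exists_real_basis
  even := fun _ hx => L.even _ (M.le hx)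



theorem form_real_perp (x : M.real) (y : M.perp) : L.form x y = 0 := y.2 x x.2

theorem form_perp_real (x : M.perp) (y : M.real) : L.form x y = 0 := by
  rw [← M.form_real_perp y x]; exact (L.symm.eq _ _).symm

theorem form_add_add (a : M.real) (b : M.perp) :
    L.form ((a : V) + b) ((a : V) + b) = L.form a a + L.form b b := by
  simp [M.form_real_perp a b, M.form_perp_real b a]

end Basic

variable {V : Type*} [AddCommGroup V] [Module ℝ V] [FiniteDimensional ℝ V] {L : EvenLattice V}
  (M : PrimitiveSublattice L)

theorem isCompl : IsCompl M.real M.perp :=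
  LinearMap.BilinForm.isCompl_orthogonal_of_restrict_nondegenerate L.symm.isRefl M.nondeg

/-- The orthogonal projection `x ↦ x_{M_ℝ}`. -/
def projReal : V →ₗ[ℝ] M.real := M.real.projectionOnto M.perp M.isCompl

/-- The orthogonal projection `x ↦ x_{M_ℝ^⊥}`. -/
def projPerp : V →ₗ[ℝ] M.perp := M.perp.projectionOnto M.real M.isCompl.symm

/-- The Grassmannian of `M_ℝ^⊥`. -/
abbrev PerpGr := Grass (L.form.restrict M.perp)

theorem projReal_add_projPerp (x : V) : (M.projReal x : V) + M.projPerp x = x :=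
  Submodule.projection_add_projection_eq_self M.isCompl x

theorem directSum_pos (u : M.toLattice.Gr) (w : M.PerpGr) (x : V)
    (hx : x ∈ u.pos.map M.real.subtype ⊔ w.pos.map M.perp.subtype) (h0 : x ≠ 0) :
    0 < L.form x x := by
  obtain ⟨_, ⟨a, ha, rfl⟩, _, ⟨b, hb, rfl⟩, rfl⟩ := Submodule.mem_sup.1 hx
  have h := M.form_add_add a b
  rw [Submodule.subtype_apply, Submodule.subtype_apply, h]
  have ha' : a ≠ 0 → 0 < L.form a a := u.pos_def a ha
  have hb' : b ≠ 0 → 0 < L.form b b := w.pos_def b hb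
  by_cases hz : a = 0
  · subst hz
    have hbz : b ≠ 0 := by rintro rfl; simp at h0
    simpa using hb' hbz
  · by_cases hz' : b = 0
    · subst hz'
      simpa using ha' hz
    · exact add_pos (ha' hz) (hb' hz')

theorem directSum_neg (u : M.toLattice.Gr) (w : M.PerpGr) (x : V)
    (hx : x ∈ u.neg.map M.real.subtype ⊔ w.neg.map M.perp.subtype) (h0 : x ≠ 0) :
    L.form x x < 0 := by
  obtain ⟨_, ⟨a, ha, rfl⟩, _, ⟨b, hb, rfl⟩, rfl⟩ := Submodule.mem_sup.1 hx
  have h := M.form_add_add a b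
  rw [Submodule.subtype_apply, Submodule.subtype_apply, h]
  have ha' : a ≠ 0 → L.form a a < 0 := u.neg_def a ha
  have hb' : b ≠ 0 → L.form b b < 0 := w.neg_def b hb
  by_cases hz : a = 0
  · subst hz
    have hbz : b ≠ 0 := by rintro rfl; simp at h0
    simpa using hb' hbz
  · by_cases hz' : b = 0
    · subst hz'
      simpa using ha' hz
    · exact add_neg (ha' hz) (hb' hz')

/-- The direct sum `u ⊕ u^⊥ ∈ Gr(L_ℝ)` of `u ∈ Gr(M_ℝ)` and `u^⊥ ∈ Gr(M_ℝ^⊥)`. -/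
def directSum (u : M.toLattice.Gr) (w : M.PerpGr) : L.Gr where
  pos := u.pos.map M.real.subtype ⊔ w.pos.map M.perp.subtype
  neg := u.neg.map M.real.subtype ⊔ w.neg.map M.perp.subtype
  isCompl := by
    refine IsCompl.of_eq ?_ ?_
    · refine (Submodule.eq_bot_iff _).2 fun x hx => ?_
      obtain ⟨hp, hn⟩ := Submodule.mem_inf.1 hx
      by_contra h0
      exact lt_asymm (M.directSum_pos u w x hp h0) (M.directSum_neg u w x hn h0)
    · rw [sup_sup_sup_comm, ← Submodule.map_sup, ← Submodule.map_sup, u.isCompl.sup_eq_top,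
        w.isCompl.sup_eq_top, Submodule.map_top, Submodule.map_top, Submodule.range_subtype,
        Submodule.range_subtype, M.isCompl.sup_eq_top]
  pos_def := M.directSum_pos u w
  neg_def := M.directSum_neg u w
  orth := by
    intro x hx y hy
    obtain ⟨_, ⟨a, ha, rfl⟩, _, ⟨b, hb, rfl⟩, rfl⟩ := Submodule.mem_sup.1 hx
    obtain ⟨_, ⟨a', ha', rfl⟩, _, ⟨b', hb', rfl⟩, rfl⟩ := Submodule.mem_sup.1 hy
    have h1 : L.form a a' = 0 := u.orth a ha a' ha'
    have h2 : L.form b b' = 0 := w.orth b hb b' hb'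
    have h3 := M.form_real_perp a b'
    have h4 := M.form_perp_real b a'
    simp [h1, h2, h3, h4]

/-- The sublattice `M` of `L^*`. -/
abbrev inDual : Submodule ℤ L.dual := M.carrier.submoduleOf L.dual

/-- The projection `L^* → M^*`. -/
def dualProj : L.dual →ₗ[ℤ] M.toLattice.dual :=
  ((M.projReal.restrictScalars ℤ).comp L.dual.subtype).codRestrict M.toLattice.dual (by
    intro x
    refine M.toLattice.mem_dual.2 fun y hy => ?_
    obtain ⟨n, hn⟩ := L.mem_dual.1 x.2 y (M.le hy)
    refine ⟨n, ?_⟩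
    rw [← hn]
    have h := M.projReal_add_projPerp x
    have h2 := M.form_perp_real (M.projPerp x) y
    change L.form (M.projReal (x : V)) y = L.form x y
    conv_rhs => rw [← h]
    rw [map_add, LinearMap.add_apply, h2, add_zero])

/-- The map `L^*/M → D_L`. -/
def quotToDisc : (L.dual ⧸ M.inDual) →ₗ[ℤ] L.Disc :=
  M.inDual.liftQ L.toDisc (by
    intro x hx
    exact (Submodule.Quotient.mk_eq_zero _).2 (M.le hx))

/-- The map `π_M : L^*/M → D_M`. -/
def quotToSubDisc : (L.dual ⧸ M.inDual) →ₗ[ℤ] M.toLattice.Disc :=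
  M.inDual.liftQ (M.toLattice.toDisc.comp M.dualProj) (by
    intro x hx
    have hx' : (x : V) ∈ M.carrier := hx
    refine (Submodule.Quotient.mk_eq_zero _).2 ?_
    have h := Submodule.projection_apply_left M.isCompl ⟨x, Submodule.subset_span hx'⟩
    change (M.real.projection M.perp M.isCompl (x : V)) ∈ M.carrier
    rw [h]
    exact hx')

/-- The projection `L^*/M → M_ℝ^⊥`. -/
def quotToPerp : (L.dual ⧸ M.inDual) →ₗ[ℤ] M.perp :=
  M.inDual.liftQ ((M.projPerp.restrictScalars ℤ).comp L.dual.subtype) (by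
    intro x hx
    have hx' : (x : V) ∈ M.carrier := hx
    exact (Submodule.projectionOnto_apply_eq_zero_iff M.isCompl.symm).2
      (Submodule.subset_span hx'))

/-- The theta function `Θ_{L,M}(τ; u^⊥, p)` with values in `ℂ[D_L] ⊗ ℂ[D_{M(-1)}]`, written in the
basis `𝔢_γ ⊗ 𝔢_δ^*`, for `p` of degree `(k₊, k₋)` with respect to `u^⊥` (only `kn = k₋`
enters). -/
def theta (w : M.PerpGr) (kn : ℕ) (p : M.perp → ℂ) (τ : ℍ) :
    L.Disc × M.toLattice.Disc → ℂ :=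
  ((τ.im ^ (((L.bNeg : ℝ) - (M.toLattice.bNeg : ℝ)) / 2 + kn) : ℝ) : ℂ) •
    ∑' x : L.dual ⧸ M.inDual, w.thetaTerm p τ (M.quotToPerp x) •
      (Pi.single (M.quotToDisc x, M.quotToSubDisc x) 1 : L.Disc × M.toLattice.Disc → ℂ)

/-- The theta contraction `⟨Θ_{L,M}(τ; u^⊥, p), F(τ)⟩_L` of `F`. -/
def thetaContraction (w : M.PerpGr) (kn : ℕ) (p : M.perp → ℂ) (F : ℍ → L.Disc → ℂ) (τ : ℍ) :
    M.toLattice.Disc → ℂ :=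
  fun δ => L.pairing (fun γ => M.theta w kn p τ (γ, δ)) (F τ)

end PrimitiveSublattice

end

open scoped ContDiff MatrixGroups Topology
open UpperHalfPlane MeasureTheory Filter

set_option linter.unusedSectionVars false

noncomputable section

/-! ### Poisson summation on `ℝⁿ` -/

/-! The equality of lifts is an equality of integrands. Since `u ⊕ u^⊥` respects the orthogonal
splitting L_ℝ = M_ℝ ⊕ M_ℝ^⊥, the Gaussian factors, the Laplacian is the sum of the Laplacians of the
two summands, and e^{-Δ_v/8πy} p_v is the product of the corresponding expressions for p_u and
p_{u^⊥} (`thetaTerm_directSum`). The vectors of L^* above a class x of L^*/M share their component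
in M_ℝ^⊥, while their components in M_ℝ run exactly once through the coset π_M(x) of M in M^*.
Summing over these fibres first (`cosetSum_tensor`) expresses Θ_L as the contraction of Θ_{L,M} with
Θ_M over D_M (`theta_directSum`). After pairing with F the truncated integrals agree for all s and
Y, hence so does everything derived from them.

Modularity need only be checked on the generators T and S. For T it is the identity λ² = λ_M² +
λ_{M^⊥}². For S, an orthonormal basis adapted to u^⊥ turns the summand of Θ_{L,M} into a combination
of products of one-variable Hermite functions, taken at τ in positive and at -τ̄ in negative
directions. The Fourier transform carries such a function at z to the one at -1/z, up to z^{-k} and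
a square root (`fourier_hermiteGauss`). Homogeneity makes the total factor the same for all
monomials (`hermiteConst_point`).

The sum over L^*/M is handled by Poisson summation for L alone (`fiberSum_hermiteFun`): multiply by
a self-dual Gaussian on M_ℝ twisted by the characters attached to M^*, apply Poisson summation,
invert the finite Fourier transform on D_M, and divide by the positive theta values of M. The
constant |D_L|^{-1/2} is found by applying Poisson summation twice to a Gaussian
(`EvenLattice.poisson`). In the contraction with F the sum over D_L then collapses by orthogonality
of characters (`thetaContraction_S`). Smoothness is termwise differentiation of Gaussian series
(`contDiffOn_gaussSeries`). -/

theorem summable_prod_pi {ι α : Type*} [Fintype ι] {g : ι → α → ℝ}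
    (h0 : ∀ i a, 0 ≤ g i a) (hg : ∀ i, Summable (g i)) :
    Summable fun m : ι → α => ∏ i, g i (m i) := by
  classical
  refine summable_of_sum_le (c := ∏ i, ∑' a, g i a)
    (fun m => Finset.prod_nonneg fun i _ => h0 i _) fun s => ?_
  -- A finite set lies in the box spanned by its coordinate projections, and over a box the sum of
  -- products is a product of sums.
  have hs : s ⊆ Fintype.piFinset fun i => s.image fun m => m i := by
    intro m hm
    exact Fintype.mem_piFinset.2 fun i => Finset.mem_image_of_mem _ hm
  calc ∑ m ∈ s, ∏ i, g i (m i)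
      ≤ ∑ m ∈ Fintype.piFinset fun i => s.image fun m => m i, ∏ i, g i (m i) :=
        Finset.sum_le_sum_of_subset_of_nonneg hs
          fun m _ _ => Finset.prod_nonneg fun i _ => h0 i _
    _ = ∏ i, ∑ a ∈ s.image (fun m => m i), g i a := (Finset.prod_univ_sum _ _).symm
    _ ≤ ∏ i, ∑' a, g i a :=
        Finset.prod_le_prod (fun i _ => Finset.sum_nonneg fun a _ => h0 i a)
          fun i _ => (hg i).sum_le_tsum _ fun a _ => h0 i a

theorem summable_exp_neg_sq_int {ε : ℝ} (hε : 0 < ε) :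
    Summable fun m : ℤ => Real.exp (-ε * (m : ℝ) ^ 2) := by
  have h : Summable fun n : ℕ => Real.exp (-ε * (n : ℝ) ^ 2) := by
    refine Summable.of_nonneg_of_le (fun _ => (Real.exp_pos _).le) (fun n => ?_)
      (Real.summable_exp_nat_mul_iff.2 (neg_lt_zero.2 hε))
    refine Real.exp_le_exp.2 ?_
    have h1 : (n : ℝ) ≤ (n : ℝ) ^ 2 := by exact_mod_cast Nat.le_self_pow two_ne_zero n
    nlinarith
  exact Summable.of_nat_of_neg (by simpa using h) (by simpa using h)

theorem summable_exp_neg_sum_sq_int {ι : Type*} [Fintype ι] {ε : ℝ} (hε : 0 < ε) :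
    Summable fun m : ι → ℤ => Real.exp (-ε * ∑ i, (m i : ℝ) ^ 2) := by
  refine (summable_prod_pi (g := fun (_ : ι) (m : ℤ) => Real.exp (-ε * (m : ℝ) ^ 2))
    (fun _ _ => (Real.exp_pos _).le) fun _ => summable_exp_neg_sq_int hε).congr fun m => ?_
  rw [Finset.mul_sum, Real.exp_sum]

theorem norm_expTwoPiI_ofReal (r : ℝ) : ‖expTwoPiI (r : ℂ)‖ = 1 := by
  rw [expTwoPiI, Complex.norm_exp]
  simp

theorem continuous_expTwoPiI : Continuous expTwoPiI := by
  unfold expTwoPiI; fun_prop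

theorem expTwoPiI_sum {ι : Type*} (s : Finset ι) (f : ι → ℂ) :
    expTwoPiI (∑ i ∈ s, f i) = ∏ i ∈ s, expTwoPiI (f i) := by
  simp only [expTwoPiI, Finset.mul_sum, Complex.exp_sum]

theorem integrable_of_gaussian_bound {ι : Type*} [Fintype ι] {f : (ι → ℝ) → ℂ} (hf : Continuous f)
    {C ε : ℝ} (hε : 0 < ε) (hb : ∀ x, ‖f x‖ ≤ C * Real.exp (-ε * ∑ i, x i ^ 2)) :
    Integrable f := by
  have h : Integrable fun x : ι → ℝ => C * Real.exp (-ε * ∑ i, x i ^ 2) := by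
    refine Integrable.const_mul ?_ C
    have := Integrable.fintype_prod (𝕜 := ℝ) (ι := ι) (f := fun _ (t : ℝ) => Real.exp (-ε * t ^ 2))
      (μ := fun _ => volume) fun _ => integrable_exp_neg_mul_sq hε
    refine this.congr (Filter.Eventually.of_forall fun x => ?_)
    simp only [Finset.mul_sum, Real.exp_sum]
  exact h.mono' hf.aestronglyMeasurable (Filter.Eventually.of_forall hb)

theorem exp_neg_sum_sq_add_le {ι : Type*} [Fintype ι] {ε : ℝ} (hε : 0 < ε) (x y : ι → ℝ) :
    Real.exp (-ε * ∑ i, (x i + y i) ^ 2)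
      ≤ Real.exp (ε * ∑ i, x i ^ 2) * Real.exp (-(ε / 2) * ∑ i, y i ^ 2) := by
  rw [← Real.exp_add, Real.exp_le_exp]
  simp only [Finset.mul_sum]
  rw [← Finset.sum_add_distrib]
  refine Finset.sum_le_sum fun i _ => ?_
  -- (x + y)² + x² - y²/2 = (2x + y)²/2.
  nlinarith [mul_nonneg hε.le (sq_nonneg (2 * x i + y i))]

/-- The product of half-open unit intervals with lower corner `m`. -/
def unitCube {ι : Type*} (m : ι → ℤ) : Set (ι → ℝ) := {x | ∀ i, x i ∈ Set.Ioc (m i : ℝ) (m i + 1)}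

theorem measurableSet_unitCube {ι : Type*} [Fintype ι] (m : ι → ℤ) :
    MeasurableSet (unitCube m) :=
  MeasurableSet.univ_pi' fun _ => measurableSet_Ioc

theorem iUnion_unitCube {ι : Type*} : (⋃ m : ι → ℤ, unitCube m) = Set.univ := by
  refine Set.eq_univ_of_forall fun x => Set.mem_iUnion.2 ⟨fun i => ⌈x i⌉ - 1, fun i => ?_⟩
  have h1 := Int.ceil_lt_add_one (x i)
  have h2 := Int.le_ceil (x i)
  constructor <;> push_cast <;> linarith

theorem pairwise_disjoint_unitCube {ι : Type*} :
    Pairwise (Function.onFun Disjoint (unitCube (ι := ι))) := by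
  intro m n hmn
  refine Set.disjoint_left.2 fun x hx hx' => hmn (funext fun i => ?_)
  have h1 := hx i
  have h2 := hx' i
  have h3 : (m i : ℝ) < n i + 1 := h1.1.trans_le h2.2
  have h4 : (n i : ℝ) < m i + 1 := h2.1.trans_le h1.2
  have h5 : m i < n i + 1 := by exact_mod_cast h3
  have h6 : n i < m i + 1 := by exact_mod_cast h4
  omega

/-- Unfolding: the integer translates of the half-open unit cube partition ℝⁿ, and Lebesgue measure
is translation invariant. -/
theorem hasSum_integral_unitCube {ι E : Type*} [Fintype ι] [NormedAddCommGroup E] [NormedSpace ℝ E]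
    {g : (ι → ℝ) → E} (hg : Integrable g) :
    HasSum (fun m : ι → ℤ => ∫ x in unitCube 0, g (x + fun i => (m i : ℝ))) (∫ x, g x) := by
  have h := hasSum_integral_iUnion (μ := volume) (f := g) (s := unitCube (ι := ι))
    measurableSet_unitCube pairwise_disjoint_unitCube hg.integrableOn
  rw [iUnion_unitCube, setIntegral_univ] at h
  convert h using 2 with m
  have h2 := (measurePreserving_add_right (volume : Measure (ι → ℝ))
    (fun i => (m i : ℝ))).setIntegral_preimage_emb
      (MeasurableEquiv.addRight (fun i => (m i : ℝ))).measurableEmbedding g (unitCube m)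
  rw [← h2]
  congr 2
  ext x
  simp [unitCube]
  refine forall_congr' fun i => and_congr_right fun _ => ?_
  constructor <;> intro h <;> linarith

/-- Near a given point the translates are dominated by a summable Gaussian in m with half the decay
rate, so the convergence is locally uniform. -/
theorem continuous_tsum_int_translate {ι : Type*} [Fintype ι] {f : (ι → ℝ) → ℂ}
    (hf : Continuous f) {C ε : ℝ} (hε : 0 < ε)
    (hb : ∀ x, ‖f x‖ ≤ C * Real.exp (-ε * ∑ i, x i ^ 2)) :
    Continuous fun x => ∑' m : ι → ℤ, f (x + fun i => (m i : ℝ)) := by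
  refine continuous_iff_continuousAt.2 fun x₀ => ?_
  have hU : IsOpen {x : ι → ℝ | ∑ i, x i ^ 2 < ∑ i, x₀ i ^ 2 + 1} :=
    isOpen_lt (by fun_prop) continuous_const
  refine ContinuousOn.continuousAt (s := {x | ∑ i, x i ^ 2 < ∑ i, x₀ i ^ 2 + 1}) ?_
    (hU.mem_nhds (by simp))
  have hu : Summable fun m : ι → ℤ => |C| * (Real.exp (ε * (∑ i, x₀ i ^ 2 + 1)) *
      Real.exp (-(ε / 2) * ∑ i, (m i : ℝ) ^ 2)) :=
    ((summable_exp_neg_sum_sq_int (half_pos hε)).mul_left _).mul_left _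
  refine continuousOn_tsum (f := fun m x => f (x + fun i => ((m i : ℤ) : ℝ)))
    (fun m => (hf.comp (continuous_add_const _)).continuousOn) hu fun m x hx => ?_
  refine (hb _).trans ?_
  refine mul_le_mul (le_abs_self _) ?_ (Real.exp_pos _).le (abs_nonneg _)
  refine (exp_neg_sum_sq_add_le hε x fun i => (m i : ℝ)).trans ?_
  refine mul_le_mul_of_nonneg_right (Real.exp_le_exp.2 ?_) (Real.exp_pos _).le
  exact mul_le_mul_of_nonneg_left (le_of_lt hx) hε.le

/-- The periodization is continuous and descends to the torus; its Fourier coefficients unfold to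
integrals over ℝⁿ. They are summable by `hs`, so the Fourier series converges to the function at
every point. -/
theorem tsum_int_translate_eq_tsum_fourier {ι : Type*} [Fintype ι] {f : (ι → ℝ) → ℂ}
    (hf : Continuous f) {C ε : ℝ} (hε : 0 < ε)
    (hb : ∀ x, ‖f x‖ ≤ C * Real.exp (-ε * ∑ i, x i ^ 2))
    (hs : Summable fun m : ι → ℤ => ∫ x, f x * expTwoPiI (-(∑ i, (m i : ℂ) * x i)))
    (x : ι → ℝ) :
    ∑' m : ι → ℤ, f (x + fun i => (m i : ℝ))
      = ∑' m : ι → ℤ, (∫ x, f x * expTwoPiI (-(∑ i, (m i : ℂ) * x i))) *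
          expTwoPiI (∑ i, (m i : ℂ) * x i) := by
  have hfi : Integrable f := integrable_of_gaussian_bound hf hε hb
  set P : (ι → ℝ) → ℂ := fun x => ∑' m : ι → ℤ, f (x + fun i => (m i : ℝ)) with hP
  have hPc : Continuous P := continuous_tsum_int_translate hf hε hb
  have hPper : ∀ (x : ι → ℝ) (n : ι → ℤ), P (x + fun i => (n i : ℝ)) = P x := by
    intro x n
    refine Eq.trans (tsum_congr fun m => ?_)
      ((Equiv.addLeft n).tsum_eq fun m : ι → ℤ => f (x + fun i => (m i : ℝ)))
    congr 1
    ext i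
    simp [add_assoc]
  let q : C(ι → ℝ, UnitAddTorus ι) := ⟨fun x i => (x i : UnitAddCircle), by fun_prop⟩
  have hq : Topology.IsQuotientMap q :=
    (IsOpenQuotientMap.piMap (ι := ι) (A := fun _ => ℝ) (B := fun _ => UnitAddCircle)
      (f := fun _ => QuotientAddGroup.mk)
      fun _ => QuotientAddGroup.isOpenQuotientMap_mk).isQuotientMap
  have hfac : Function.FactorsThrough (⟨P, hPc⟩ : C(ι → ℝ, ℂ)) q := by
    intro a b hab
    have h1 : ∀ i, ∃ n : ℤ, b i = a i + n := by
      intro i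
      have h2 : ((a i : ℝ) : UnitAddCircle) = (b i : ℝ) := congrFun hab i
      rw [← sub_eq_zero, ← AddCircle.coe_sub, AddCircle.coe_eq_zero_iff] at h2
      obtain ⟨n, hn⟩ := h2
      refine ⟨-n, ?_⟩
      simp at hn
      push_cast
      linarith
    choose n hn using h1
    have : b = a + fun i => (n i : ℝ) := funext hn
    rw [this]
    exact (hPper a n).symm
  let F : C(UnitAddTorus ι, ℂ) := hq.lift ⟨P, hPc⟩ hfac
  have hF : ∀ x : ι → ℝ, F (q x) = P x := fun x =>
    DFunLike.congr_fun (hq.lift_comp ⟨P, hPc⟩ hfac) x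
  have hmF : ∀ (n : ι → ℤ) (x : ι → ℝ),
      UnitAddTorus.mFourier n (q x) = expTwoPiI (∑ i, (n i : ℂ) * x i) := by
    intro n x
    rw [expTwoPiI_sum]
    refine Finset.prod_congr rfl fun i _ => ?_
    change fourier (n i) ((x i : ℝ) : UnitAddCircle) = _
    rw [fourier_coe_apply, expTwoPiI]
    congr 1
    push_cast
    ring
  have hcoef : ∀ n : ι → ℤ, UnitAddTorus.mFourierCoeff F n
      = ∫ x, f x * expTwoPiI (-(∑ i, (n i : ℂ) * x i)) := by
    intro n
    set g : (ι → ℝ) → ℂ := fun x => f x * expTwoPiI (-(∑ i, (n i : ℂ) * x i)) with hg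
    have hgn : ∀ x, ‖g x‖ = ‖f x‖ := by
      intro x
      have : -(∑ i, (n i : ℂ) * x i) = ((-(∑ i, (n i : ℝ) * x i) : ℝ) : ℂ) := by push_cast; rfl
      rw [hg, norm_mul, this, norm_expTwoPiI_ofReal, mul_one]
    have hgc : Continuous g := hf.mul (continuous_expTwoPiI.comp (by fun_prop))
    have hgi : Integrable g := integrable_of_gaussian_bound hgc hε fun x => by
      rw [hgn]; exact hb x
    have hgs : ∀ (x : ι → ℝ) (m : ι → ℤ), g (x + fun i => (m i : ℝ))
        = expTwoPiI (-(∑ i, (n i : ℂ) * x i)) * f (x + fun i => (m i : ℝ)) := by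
      intro x m
      have : -(∑ i, (n i : ℂ) * ((x i + m i : ℝ) : ℂ))
          = -(∑ i, (n i : ℂ) * x i) + ((-∑ i, n i * m i : ℤ) : ℂ) := by
        push_cast
        simp only [mul_add, Finset.sum_add_distrib]
        ring
      rw [hg]
      simp only [Pi.add_apply]
      rw [this, expTwoPiI_add, expTwoPiI_int, mul_one, mul_comm]
    rw [UnitAddTorus.mFourierCoeff_eq_integral F n 0]
    have hset : {x : ι → ℝ | ∀ i, x i ∈ Set.Ioc ((0 : ι → ℝ) i) ((0 : ι → ℝ) i + 1)}
        = unitCube 0 := by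
      ext x; simp [unitCube]
    rw [hset]
    have h1 : ∀ x : ι → ℝ, UnitAddTorus.mFourier (-n) (fun i => (x i : UnitAddCircle)) •
        F (fun i => (x i : UnitAddCircle)) = ∑' m : ι → ℤ, g (x + fun i => (m i : ℝ)) := by
      intro x
      have e1 := hmF (-n) x
      have e2 := hF x
      change UnitAddTorus.mFourier (-n) (q x) • F (q x) = _
      rw [e1, e2, smul_eq_mul]
      simp only [hgs, tsum_mul_left, hP]
      congr 2
      simp
    simp only [h1]
    -- Exchanging sum and integral is legitimate because ‖g‖ is integrable and unfolds in the same
    -- way.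
    rw [← integral_tsum_of_summable_integral_norm]
    · exact (hasSum_integral_unitCube hgi).tsum_eq
    · intro m
      exact (hgi.comp_add_right _).integrableOn
    · exact (hasSum_integral_unitCube hgi.norm).summable
  have hsum : Summable (UnitAddTorus.mFourierCoeff F) := by
    refine hs.congr fun m => (hcoef m).symm
  have := (UnitAddTorus.hasSum_mFourier_series_apply_of_summable hsum (q x)).tsum_eq
  rw [hF x] at this
  refine this.symm.trans (tsum_congr fun m => ?_)
  rw [hcoef, hmF, smul_eq_mul]

/-! ### Growth -/

/-- `P` grows slower than `exp (η w)` for every `η > 0`. -/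
def SubexpGrowth {X : Type*} (w : X → ℝ) (P : X → ℂ) : Prop :=
  ∀ η : ℝ, 0 < η → ∃ C : ℝ, ∀ x, ‖P x‖ ≤ C * Real.exp (η * w x)

namespace SubexpGrowth

variable {X : Type*} {w : X → ℝ} {P Q : X → ℂ}

theorem exists_nonneg (hP : SubexpGrowth w P) {η : ℝ} (hη : 0 < η) :
    ∃ C : ℝ, 0 ≤ C ∧ ∀ x, ‖P x‖ ≤ C * Real.exp (η * w x) := by
  obtain ⟨C, hC⟩ := hP η hη
  exact ⟨|C|, abs_nonneg _, fun x => (hC x).trans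
    (mul_le_mul_of_nonneg_right (le_abs_self _) (Real.exp_pos _).le)⟩

theorem const (hw : ∀ x, 0 ≤ w x) (c : ℂ) : SubexpGrowth w fun _ => c := fun _ hη =>
  ⟨‖c‖, fun x => le_mul_of_one_le_right (norm_nonneg _)
    (Real.one_le_exp (mul_nonneg hη.le (hw x)))⟩

theorem add (hP : SubexpGrowth w P) (hQ : SubexpGrowth w Q) :
    SubexpGrowth w fun x => P x + Q x := by
  intro η hη
  obtain ⟨C, hC⟩ := hP η hη
  obtain ⟨D, hD⟩ := hQ η hη
  refine ⟨C + D, fun x => (norm_add_le _ _).trans ?_⟩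
  rw [add_mul]
  exact add_le_add (hC x) (hD x)

theorem mul (hP : SubexpGrowth w P) (hQ : SubexpGrowth w Q) :
    SubexpGrowth w fun x => P x * Q x := by
  intro η hη
  obtain ⟨C, hC0, hC⟩ := hP.exists_nonneg (half_pos hη)
  obtain ⟨D, hD0, hD⟩ := hQ.exists_nonneg (half_pos hη)
  refine ⟨C * D, fun x => ?_⟩
  have h : C * D * Real.exp (η * w x)
      = (C * Real.exp (η / 2 * w x)) * (D * Real.exp (η / 2 * w x)) := by
    rw [show η * w x = η / 2 * w x + η / 2 * w x by ring, Real.exp_add]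
    ring
  rw [h, norm_mul]
  exact mul_le_mul (hC x) (hD x) (norm_nonneg _) (by positivity)

/-- Both 1 and η w are at most exp(η w). -/
theorem of_norm_le_mul (hw : ∀ x, 0 ≤ w x) {K : ℝ} (h : ∀ x, ‖P x‖ ≤ K * (1 + w x)) :
    SubexpGrowth w P := by
  intro η hη
  refine ⟨|K| * (1 + 1 / η), fun x => (h x).trans ?_⟩
  have h1 : 1 ≤ Real.exp (η * w x) := Real.one_le_exp (mul_nonneg hη.le (hw x))
  have h2 : η * w x ≤ Real.exp (η * w x) := by linarith [Real.add_one_le_exp (η * w x)]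
  have h3 : w x ≤ 1 / η * Real.exp (η * w x) := by
    rw [div_mul_eq_mul_div, one_mul, le_div_iff₀ hη]; linarith
  calc K * (1 + w x) ≤ |K| * (1 + w x) :=
        mul_le_mul_of_nonneg_right (le_abs_self _) (by linarith [hw x])
    _ ≤ |K| * (Real.exp (η * w x) + 1 / η * Real.exp (η * w x)) := by gcongr
    _ = _ := by ring

theorem polynomial_eval (p : Polynomial ℂ) :
    SubexpGrowth (fun t : ℝ => t ^ 2) fun t => p.eval (t : ℂ) := by
  have h0 : ∀ t : ℝ, 0 ≤ t ^ 2 := fun t => sq_nonneg t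
  induction p using Polynomial.induction_on' with
  | add p q hp hq => simpa using hp.add hq
  | monomial n a =>
    have hX : SubexpGrowth (fun t : ℝ => t ^ 2) fun t => (t : ℂ) := by
      refine of_norm_le_mul h0 (K := 1) fun t => ?_
      rw [Complex.norm_real, Real.norm_eq_abs, one_mul]
      nlinarith [sq_abs t, sq_nonneg (|t| - 1)]
    induction n with
    | zero => simpa using const h0 a
    | succ n ih =>
      intro η hη
      obtain ⟨C, hC⟩ := (ih.mul hX) η hη
      refine ⟨C, fun t => (hC t).trans' (le_of_eq ?_)⟩
      simp [pow_succ, mul_assoc]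

end SubexpGrowth

/-! ### Hermite functions -/

/-- The polynomial `exp (c ∂²) X ^ k`. -/
def hermitePoly (c : ℝ) : ℕ → Polynomial ℂ
  | 0 => 1
  | k + 1 => Polynomial.X * hermitePoly c k
      + Polynomial.C (2 * (c : ℂ)) * Polynomial.derivative (hermitePoly c k)

/-- The function `t ↦ (exp (-∂² / 8πy) X ^ k)(t) e(z t² / 2)`, for `z = x + i y`. -/
def hermiteGauss (k : ℕ) (z : ℍ) (t : ℝ) : ℂ :=
  (hermitePoly (-1 / (8 * Real.pi * z.im)) k).eval (t : ℂ) * expTwoPiI ((z : ℂ) * (t : ℂ) ^ 2 / 2)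

theorem norm_expTwoPiI (w : ℂ) : ‖expTwoPiI w‖ = Real.exp (-(2 * Real.pi * w.im)) := by
  rw [expTwoPiI, Complex.norm_exp]
  congr 1
  simp [Complex.mul_re]

theorem norm_expTwoPiI_sq (z : ℍ) (t : ℝ) :
    ‖expTwoPiI ((z : ℂ) * (t : ℂ) ^ 2 / 2)‖ = Real.exp (-(Real.pi * z.im) * t ^ 2) := by
  rw [norm_expTwoPiI]
  congr 1
  have : ((z : ℂ) * (t : ℂ) ^ 2 / 2).im = z.im * t ^ 2 / 2 := by
    have h : ((t : ℂ) ^ 2 / 2) = ((t ^ 2 / 2 : ℝ) : ℂ) := by push_cast; rfl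
    rw [mul_div_assoc, h, Complex.im_mul_ofReal]
    simp; ring
  rw [this]; ring

/-- The Gaussian decays like exp(-π y t²); half of the exponent is spent on absorbing the
polynomial. -/
theorem polyGauss_bound (p : Polynomial ℂ) (z : ℍ) :
    ∃ C : ℝ, 0 ≤ C ∧ ∀ t : ℝ, ‖p.eval (t : ℂ) * expTwoPiI ((z : ℂ) * (t : ℂ) ^ 2 / 2)‖
      ≤ C * Real.exp (-(Real.pi * z.im / 2) * t ^ 2) := by
  have hpos : 0 < Real.pi * z.im / 2 := by have := z.im_pos; positivity
  obtain ⟨C, hC0, hC⟩ := (SubexpGrowth.polynomial_eval p).exists_nonneg hpos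
  refine ⟨C, hC0, fun t => ?_⟩
  rw [norm_mul, norm_expTwoPiI_sq]
  refine (mul_le_mul_of_nonneg_right (hC t) (Real.exp_pos _).le).trans (le_of_eq ?_)
  rw [mul_assoc, ← Real.exp_add]
  congr 2
  ring

theorem continuous_polyGauss (p : Polynomial ℂ) (z : ℍ) :
    Continuous fun t : ℝ => p.eval (t : ℂ) * expTwoPiI ((z : ℂ) * (t : ℂ) ^ 2 / 2) :=
  (p.continuous.comp Complex.continuous_ofReal).mul (continuous_expTwoPiI.comp (by fun_prop))

theorem integrable_polyGauss (p : Polynomial ℂ) (z : ℍ) :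
    Integrable fun t : ℝ => p.eval (t : ℂ) * expTwoPiI ((z : ℂ) * (t : ℂ) ^ 2 / 2) := by
  obtain ⟨C, -, hC⟩ := polyGauss_bound p z
  have hpos : 0 < Real.pi * z.im / 2 := by have := z.im_pos; positivity
  exact ((integrable_exp_neg_mul_sq hpos).const_mul C).mono'
    (continuous_polyGauss p z).aestronglyMeasurable (Filter.Eventually.of_forall hC)

theorem hasDerivAt_expTwoPiI_sq (z : ℂ) (t : ℝ) :
    HasDerivAt (fun t : ℝ => expTwoPiI (z * (t : ℂ) ^ 2 / 2))
      (2 * Real.pi * Complex.I * z * t * expTwoPiI (z * (t : ℂ) ^ 2 / 2)) t := by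
  have h : HasDerivAt (fun w : ℂ => 2 * Real.pi * Complex.I * (z * w ^ 2 / 2))
      (2 * Real.pi * Complex.I * z * t) (t : ℂ) := by
    have := (((hasDerivAt_pow 2 (t : ℂ)).const_mul z).div_const 2).const_mul
      (2 * Real.pi * Complex.I)
    refine this.congr_deriv ?_
    simp; ring
  refine h.cexp.comp_ofReal.congr_deriv ?_
  rw [expTwoPiI]; ring

theorem hasDerivAt_polyGauss (p : Polynomial ℂ) (z : ℂ) (t : ℝ) :
    HasDerivAt (fun t : ℝ => p.eval (t : ℂ) * expTwoPiI (z * (t : ℂ) ^ 2 / 2))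
      ((p.derivative + Polynomial.C (2 * Real.pi * Complex.I * z) * Polynomial.X * p).eval (t : ℂ)
        * expTwoPiI (z * (t : ℂ) ^ 2 / 2)) t := by
  refine ((p.hasDerivAt (t : ℂ)).comp_ofReal.mul (hasDerivAt_expTwoPiI_sq z t)).congr_deriv ?_
  simp
  ring

theorem hermiteGauss_zero (z : ℍ) :
    hermiteGauss 0 z = fun t : ℝ => expTwoPiI ((z : ℂ) * (t : ℂ) ^ 2 / 2) := by
  ext t; simp [hermiteGauss, hermitePoly]

theorem continuous_hermiteGauss (k : ℕ) (z : ℍ) : Continuous (hermiteGauss k z) :=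
  continuous_polyGauss _ z

theorem integrable_hermiteGauss (k : ℕ) (z : ℍ) : Integrable (hermiteGauss k z) :=
  integrable_polyGauss _ z

theorem hermiteGauss_bound (k : ℕ) (z : ℍ) :
    ∃ C : ℝ, 0 ≤ C ∧ ∀ t : ℝ, ‖hermiteGauss k z t‖
      ≤ C * Real.exp (-(Real.pi * z.im / 2) * t ^ 2) := polyGauss_bound _ z

theorem differentiable_hermiteGauss (k : ℕ) (z : ℍ) : Differentiable ℝ (hermiteGauss k z) :=
  fun t => (hasDerivAt_polyGauss _ (z : ℂ) t).differentiableAt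

theorem deriv_hermiteGauss (k : ℕ) (z : ℍ) : deriv (hermiteGauss k z) = fun t : ℝ =>
    ((hermitePoly (-1 / (8 * Real.pi * z.im)) k).derivative
      + Polynomial.C (2 * Real.pi * Complex.I * z) * Polynomial.X *
        hermitePoly (-1 / (8 * Real.pi * z.im)) k).eval (t : ℂ)
        * expTwoPiI ((z : ℂ) * (t : ℂ) ^ 2 / 2) :=
  funext fun t => (hasDerivAt_polyGauss _ (z : ℂ) t).deriv

theorem integrable_deriv_hermiteGauss (k : ℕ) (z : ℍ) : Integrable (deriv (hermiteGauss k z)) := by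
  rw [deriv_hermiteGauss]; exact integrable_polyGauss _ z

theorem integrable_smul_hermiteGauss (k : ℕ) (z : ℍ) :
    Integrable fun t : ℝ => t • hermiteGauss k z t := by
  refine (integrable_polyGauss
    (Polynomial.X * hermitePoly (-1 / (8 * Real.pi * z.im)) k) z).congr (ae_of_all _ fun t => ?_)
  simp [hermiteGauss, mul_assoc]

/-- The recursion of `hermitePoly` becomes a raising operator, a combination of multiplication by t
and d/dt, because differentiating the Gaussian gives the factor 2πi z t and 1 + iz/2y = i z̄/2y. The
Fourier transform exchanges the two ingredients, which makes induction on k possible. -/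
theorem hermiteGauss_succ (k : ℕ) (z : ℍ) (t : ℝ) :
    hermiteGauss (k + 1) z t
      = (Complex.I * (starRingEnd ℂ) (z : ℂ) / (2 * z.im)) * ((t : ℂ) * hermiteGauss k z t)
        - (1 / (4 * Real.pi * z.im)) * deriv (hermiteGauss k z) t := by
  have hy : (z.im : ℂ) ≠ 0 := by exact_mod_cast z.im_pos.ne'
  have hpi : (Real.pi : ℂ) ≠ 0 := by exact_mod_cast Real.pi_ne_zero
  have hz : (z : ℂ) = (starRingEnd ℂ) (z : ℂ) + 2 * z.im * Complex.I := by
    apply Complex.ext <;> simp; ring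
  rw [deriv_hermiteGauss]
  simp only [hermiteGauss, hermitePoly, Polynomial.eval_add, Polynomial.eval_mul,
    Polynomial.eval_X, Polynomial.eval_C]
  set e := expTwoPiI ((z : ℂ) * (t : ℂ) ^ 2 / 2)
  generalize (starRingEnd ℂ) (z : ℂ) = zb at hz ⊢
  rw [hz]
  push_cast
  field_simp
  ring_nf
  simp only [Complex.I_sq]
  ring

/-- Parity is what absorbs the signs of the form in negative directions, in
`integral_prod_hermiteGauss`. -/
theorem hermiteGauss_neg (k : ℕ) (z : ℍ) (t : ℝ) :
    hermiteGauss k z (-t) = (-1) ^ k * hermiteGauss k z t := by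
  have h : ∀ (c : ℝ) (w : ℂ), (hermitePoly c k).eval (-w) = (-1) ^ k * (hermitePoly c k).eval w := by
    intro c
    suffices h : (hermitePoly c k).comp (-Polynomial.X) = (-1) ^ k * hermitePoly c k by
      intro w
      have := congrArg (Polynomial.eval w) h
      simpa using this
    induction k with
    | zero => simp [hermitePoly]
    | succ k ih =>
      have h2 := congrArg Polynomial.derivative ih
      rw [Polynomial.derivative_comp] at h2
      have h3 : Polynomial.derivative ((-1 : Polynomial ℂ) ^ k * hermitePoly c k)
          = (-1) ^ k * Polynomial.derivative (hermitePoly c k) := by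
        have : ((-1 : Polynomial ℂ) ^ k) = Polynomial.C ((-1) ^ k) := by simp
        rw [this, Polynomial.derivative_C_mul]
      rw [h3] at h2
      simp only [hermitePoly, Polynomial.add_comp, Polynomial.mul_comp, Polynomial.X_comp,
        Polynomial.C_comp, ih]
      simp only [Polynomial.derivative_neg, Polynomial.derivative_X] at h2
      have h4 : (Polynomial.derivative (hermitePoly c k)).comp (-Polynomial.X)
          = -((-1) ^ k * Polynomial.derivative (hermitePoly c k)) := by
        rw [← h2]; ring
      rw [h4]; ring
  simp [hermiteGauss, h, mul_assoc]

open FourierTransform in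
-- Induction on k from the Gaussian. The Fourier transform carries the raising operator at z to z⁻¹
-- times the raising operator at -1/z, since Im(-1/z) = y/(z z̄); hence one factor z⁻¹ for each
-- degree.
theorem fourier_hermiteGauss (k : ℕ) (z : ℍ) :
    𝓕 (hermiteGauss k z) = fun ξ : ℝ =>
      ((-Complex.I * z) ^ (1 / 2 : ℂ))⁻¹ * ((z : ℂ) ^ k)⁻¹
        * hermiteGauss k (ModularGroup.S • z) ξ := by
  have hz : (z : ℂ) ≠ 0 := z.ne_zero
  have hS : ((ModularGroup.S • z : ℍ) : ℂ) = -1 / z := by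
    rw [UpperHalfPlane.modular_S_smul]; simp [neg_div, inv_neg]
  have hSim : (((ModularGroup.S • z : ℍ)).im : ℂ)
      = z.im / ((z : ℂ) * (starRingEnd ℂ) (z : ℂ)) := by
    have h := ModularGroup.im_smul_eq_div_normSq ModularGroup.S z
    have h2 : denom (ModularGroup.S : GL (Fin 2) ℝ) z = z := by
      rw [Mp2Z.denom_eq]; simp [ModularGroup.S]
    rw [h, Complex.mul_conj, h2]
    push_cast; rfl
  induction k with
  | zero =>
    have h := fourier_gaussian_pi (b := -Complex.I * z) (by simpa using z.im_pos)
    rw [hermiteGauss_zero, hermiteGauss_zero, hS]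
    have e1 : (fun t : ℝ => expTwoPiI ((z : ℂ) * (t : ℂ) ^ 2 / 2))
        = fun t : ℝ => Complex.exp (-Real.pi * (-Complex.I * z) * (t : ℂ) ^ 2) := by
      ext t; rw [expTwoPiI]; congr 1; ring
    rw [e1, h]
    ext ξ
    simp only [expTwoPiI]
    have e2 : -(Real.pi : ℂ) / (-Complex.I * z) * (ξ : ℂ) ^ 2
        = 2 * Real.pi * Complex.I * (-1 / z * (ξ : ℂ) ^ 2 / 2) := by
      field_simp
      rw [Complex.I_sq]; ring
    rw [e2]
    simp
  | succ k ih =>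
    have hy : (z.im : ℂ) ≠ 0 := by exact_mod_cast z.im_pos.ne'
    have hpi : (Real.pi : ℂ) ≠ 0 := by exact_mod_cast Real.pi_ne_zero
    have hzc : (starRingEnd ℂ) (z : ℂ) ≠ 0 := by simpa using hz
    have hi := integrable_hermiteGauss k z
    have h1 := Real.deriv_fourier hi (integrable_smul_hermiteGauss k z)
    have h2 := Real.fourier_deriv hi (differentiable_hermiteGauss k z)
      (integrable_deriv_hermiteGauss k z)
    set s := ((-Complex.I * z) ^ (1 / 2 : ℂ))⁻¹ with hs
    -- The coefficient is rescaled so that t appears as -2πi t, the multiplier corresponding to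
    -- differentiation of the Fourier transform.
    have hrec : hermiteGauss (k + 1) z
        = (-(starRingEnd ℂ) (z : ℂ) / (4 * Real.pi * z.im)) •
            (fun t : ℝ => (-2 * Real.pi * Complex.I * (t : ℂ)) • hermiteGauss k z t)
          + (-(1 / (4 * Real.pi * z.im)) : ℂ) • deriv (hermiteGauss k z) := by
      ext t
      rw [hermiteGauss_succ]
      simp only [Pi.add_apply, Pi.smul_apply, smul_eq_mul]
      field_simp
      ring
    have hi2 : Integrable fun t : ℝ => (-2 * Real.pi * Complex.I * (t : ℂ)) • hermiteGauss k z t := by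
      refine ((integrable_smul_hermiteGauss k z).const_mul (-2 * Real.pi * Complex.I)).congr
        (ae_of_all _ fun t => ?_)
      simp; ring
    have hlin : 𝓕 (hermiteGauss (k + 1) z)
        = (-(starRingEnd ℂ) (z : ℂ) / (4 * Real.pi * z.im)) •
            𝓕 (fun t : ℝ => (-2 * Real.pi * Complex.I * (t : ℂ)) • hermiteGauss k z t)
          + (-(1 / (4 * Real.pi * z.im)) : ℂ) • 𝓕 (deriv (hermiteGauss k z)) := by
      rw [hrec]
      have hc : Continuous fun p : ℝ × ℝ => innerₗ ℝ p.1 p.2 := by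
        simp only [innerₗ_apply_apply]; fun_prop
      refine (VectorFourier.fourierIntegral_add Real.continuous_fourierChar hc (hi2.smul _)
        ((integrable_deriv_hermiteGauss k z).smul _)).trans ?_
      exact congrArg₂ _ (VectorFourier.fourierIntegral_const_smul _ _ _ _ _)
        (VectorFourier.fourierIntegral_const_smul _ _ _ _ _)
    rw [hlin, ← h1, h2, ih]
    ext ξ
    simp only [Pi.add_apply, Pi.smul_apply, smul_eq_mul]
    rw [deriv_const_mul _ (differentiable_hermiteGauss k _ ξ), hermiteGauss_succ, hS]
    simp only [hSim]
    set d := deriv (hermiteGauss k (ModularGroup.S • z)) ξ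
    set e := hermiteGauss k (ModularGroup.S • z) ξ
    simp only [map_div₀, map_neg, map_one]
    field_simp
    ring

theorem integral_hermiteGauss (k : ℕ) (z : ℍ) (ξ : ℝ) :
    ∫ t : ℝ, hermiteGauss k z t * expTwoPiI (-((t : ℂ) * ξ))
      = ((-Complex.I * z) ^ (1 / 2 : ℂ))⁻¹ * ((z : ℂ) ^ k)⁻¹
        * hermiteGauss k (ModularGroup.S • z) ξ := by
  rw [← congrFun (fourier_hermiteGauss k z) ξ, Real.fourier_real_eq_integral_exp_smul]
  refine integral_congr_ae (ae_of_all _ fun t => ?_)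
  simp only [smul_eq_mul, expTwoPiI]
  rw [mul_comm]
  congr 2
  push_cast; ring

/-- The Fourier transform of a product of Hermite functions, relative to a diagonal form with
entries `σ i = ±1`. -/
theorem integral_prod_hermiteGauss {ι : Type*} [Fintype ι] (k : ι → ℕ) (z : ι → ℍ) {σ : ι → ℝ}
    (hσ : ∀ i, σ i = 1 ∨ σ i = -1) (ξ : ι → ℝ) :
    ∫ t : ι → ℝ, (∏ i, hermiteGauss (k i) (z i) (t i)) *
        expTwoPiI (-((∑ i, σ i * (t i * ξ i) : ℝ) : ℂ))
      = (∏ i, ((-Complex.I * z i) ^ (1 / 2 : ℂ))⁻¹ * ((σ i * z i : ℂ) ^ k i)⁻¹) *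
        ∏ i, hermiteGauss (k i) (ModularGroup.S • z i) (ξ i) := by
  have h : ∀ t : ι → ℝ, (∏ i, hermiteGauss (k i) (z i) (t i)) *
        expTwoPiI (-((∑ i, σ i * (t i * ξ i) : ℝ) : ℂ))
      = ∏ i, (hermiteGauss (k i) (z i) (t i) * expTwoPiI (-((t i : ℂ) * (σ i * ξ i : ℝ)))) := by
    intro t
    rw [Finset.prod_mul_distrib, ← expTwoPiI_sum]
    congr 2
    push_cast
    rw [← Finset.sum_neg_distrib]
    exact Finset.sum_congr rfl fun i _ => by ring
  simp only [h]
  rw [integral_fintype_prod_volume_eq_prod (fun i (t : ℝ) =>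
    hermiteGauss (k i) (z i) t * expTwoPiI (-((t : ℂ) * (σ i * ξ i : ℝ)))),
    ← Finset.prod_mul_distrib]
  refine Finset.prod_congr rfl fun i _ => ?_
  rw [integral_hermiteGauss]
  rcases hσ i with h | h
  · simp [h]
  -- A sign -1 evaluates the transform at -ξ; the resulting (-1)^k is absorbed into (σ z)^k.
  · rw [h, neg_one_mul, hermiteGauss_neg]
    push_cast
    rw [neg_one_mul, neg_pow (z i : ℂ), mul_inv, ← inv_pow (-1 : ℂ), inv_neg, inv_one]
    ring

theorem continuous_prod_hermiteGauss {ι : Type*} [Fintype ι] (k : ι → ℕ) (z : ι → ℍ) :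
    Continuous fun t : ι → ℝ => ∏ i, hermiteGauss (k i) (z i) (t i) :=
  continuous_finsetProd _ fun i _ =>
    (continuous_hermiteGauss (k i) (z i)).comp (continuous_apply i)

theorem prod_hermiteGauss_bound {ι : Type*} [Fintype ι] (k : ι → ℕ) (z : ι → ℍ) :
    ∃ C ε : ℝ, 0 < ε ∧ ∀ t : ι → ℝ, ‖∏ i, hermiteGauss (k i) (z i) (t i)‖
      ≤ C * Real.exp (-ε * ∑ i, t i ^ 2) := by
  choose C hC0 hC using fun i => hermiteGauss_bound (k i) (z i)
  obtain ⟨ε, hε, hεi⟩ : ∃ ε : ℝ, 0 < ε ∧ ∀ i, ε ≤ Real.pi * (z i).im / 2 := by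
    rcases isEmpty_or_nonempty ι with h | h
    · exact ⟨1, one_pos, fun i => h.elim i⟩
    · obtain ⟨i, -, hi⟩ := Finset.univ.exists_min_image (fun i => Real.pi * (z i).im / 2)
        Finset.univ_nonempty
      exact ⟨_, by have := (z i).im_pos; positivity, fun j => hi j (Finset.mem_univ j)⟩
  refine ⟨∏ i, C i, ε, hε, fun t => ?_⟩
  rw [norm_prod, Finset.mul_sum, Real.exp_sum, ← Finset.prod_mul_distrib]
  refine Finset.prod_le_prod (fun i _ => norm_nonneg _) fun i _ => (hC i (t i)).trans ?_
  refine mul_le_mul_of_nonneg_left (Real.exp_le_exp.2 ?_) (hC0 i)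
  exact mul_le_mul_of_nonneg_right (neg_le_neg (hεi i)) (sq_nonneg _)

/-! ### Orthonormal frames -/

section Frames

variable {W : Type*} [AddCommGroup W] [Module ℝ W] [FiniteDimensional ℝ W]
  {B : LinearMap.BilinForm ℝ W}

/-- A basis of `W`, orthonormal up to signs for `B` and adapted to the decomposition `v`. -/
structure Grass.Frame (v : Grass B) (ι : Type) where
  basis : Module.Basis ι ℝ W
  sgn : ι → Bool
  orth : ∀ i j, i ≠ j → B (basis i) (basis j) = 0
  norm : ∀ i, B (basis i) (basis i) = if sgn i then 1 else -1
  mem_pos : ∀ i, sgn i = true → basis i ∈ v.pos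
  mem_neg : ∀ i, sgn i = false → basis i ∈ v.neg

theorem LinearMap.BilinForm.exists_orthonormal_basis (hB : B.IsSymm)
    (hpos : ∀ x, x ≠ 0 → 0 < B x x) :
    ∃ (n : ℕ) (e : Module.Basis (Fin n) ℝ W),
      (∀ i j, i ≠ j → B (e i) (e j) = 0) ∧ ∀ i, B (e i) (e i) = 1 := by
  obtain ⟨e, he⟩ := LinearMap.BilinForm.exists_orthogonal_basis
    (B := B) ⟨fun x y => by simpa using hB.eq x y⟩
  have h0 : ∀ i, 0 < B (e i) (e i) := fun i => hpos _ (e.ne_zero i)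
  let c : Fin (Module.finrank ℝ W) → ℝ := fun i => (Real.sqrt (B (e i) (e i)))⁻¹
  have hc : ∀ i, IsUnit (c i) := fun i =>
    (inv_ne_zero (Real.sqrt_pos.2 (h0 i)).ne').isUnit
  refine ⟨_, e.isUnitSMul hc, fun i j hij => ?_, fun i => ?_⟩
  · have : B (e i) (e j) = 0 := he hij
    simp [Module.Basis.isUnitSMul_apply, this]
  · simp only [Module.Basis.isUnitSMul_apply, map_smul, LinearMap.smul_apply, smul_eq_mul, c]
    have h1 := Real.mul_self_sqrt (h0 i).le
    have h2 := (Real.sqrt_pos.2 (h0 i)).ne'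
    field_simp
    rw [pow_two, h1]

namespace Grass

variable (v : Grass B)

/-- Orthonormal bases of `v.pos` for B and of `v.neg` for -B together form a basis, and the two
blocks are orthogonal by `v.orth`. -/
theorem exists_frame (hB : B.IsSymm) : ∃ n m : ℕ, Nonempty (v.Frame (Fin n ⊕ Fin m)) := by
  obtain ⟨n, e, he, he1⟩ := LinearMap.BilinForm.exists_orthonormal_basis (B := B.restrict v.pos)
    ⟨fun x y => hB.eq x y⟩ fun x hx => v.pos_def x x.2 (by simpa using hx)
  obtain ⟨m, f, hf, hf1⟩ := LinearMap.BilinForm.exists_orthonormal_basis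
    (B := (-B).restrict v.neg) ⟨fun x y => by
      change (-B) (x : W) y = (-B) y x
      simpa using hB.eq x y⟩ fun x hx => by
      have := v.neg_def x x.2 (by simpa using hx)
      change 0 < (-B) (x : W) x
      simpa using this
  let b := (e.prod f).map (Submodule.prodEquivOfIsCompl v.pos v.neg v.isCompl)
  have hbl : ∀ i, b (Sum.inl i) = e i := fun i => by simp [b]
  have hbr : ∀ i, b (Sum.inr i) = f i := fun i => by simp [b]
  refine ⟨n, m, ⟨⟨b, Sum.elim (fun _ => true) fun _ => false, ?_, ?_, ?_, ?_⟩⟩⟩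
  · rintro (i | i) (j | j) hij
    · rw [hbl, hbl]; exact he i j (by simpa using hij)
    · rw [hbl, hbr]; exact v.orth _ (e i).2 _ (f j).2
    · rw [hbl, hbr, hB.eq]; exact v.orth _ (e j).2 _ (f i).2
    · rw [hbr, hbr]
      have : -(B (f i : W) (f j)) = 0 := hf i j (by simpa using hij)
      linarith
  · rintro (i | i)
    · rw [hbl]; simpa using he1 i
    · rw [hbr]
      have : -(B (f i : W) (f i)) = 1 := hf1 i
      simp; linarith
  · rintro (i | i) hi
    · rw [hbl]; exact (e i).2
    · simp at hi
  · rintro (i | i) hi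
    · simp at hi
    · rw [hbr]; exact (f i).2

/-- An orthogonal basis has no isotropic vector, by nondegeneracy, so its positive and negative
vectors span the two summands. This supplies an auxiliary point of the Grassmannian of M_ℝ for
statements that involve M_ℝ^⊥ only. -/
theorem nonempty_of_nondegenerate (hB : B.IsSymm) (hn : B.Nondegenerate) : Nonempty (Grass B) := by
  obtain ⟨e, he⟩ := LinearMap.BilinForm.exists_orthogonal_basis
    (B := B) ⟨fun x y => by simpa using hB.eq x y⟩
  have hform : ∀ x y, B x y = ∑ i, B (e i) (e i) * (e.repr x i * e.repr y i) := by
    intro x y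
    conv_lhs => rw [← e.sum_repr x, ← e.sum_repr y]
    simp only [map_sum, LinearMap.sum_apply, map_smul, LinearMap.smul_apply, smul_eq_mul]
    refine Finset.sum_congr rfl fun i _ => ?_
    rw [Finset.sum_eq_single i]
    · ring
    · intro j _ hj
      have : B (e j) (e i) = 0 := he hj
      simp [this]
    · simp
  have h0 : ∀ i, B (e i) (e i) ≠ 0 := by
    intro i h
    refine e.ne_zero i (hn.1 (e i) fun y => ?_)
    rw [hform]
    refine Finset.sum_eq_zero fun j _ => ?_
    by_cases hij : i = j
    · subst hij; simp [h]
    · simp [hij]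
  have hmem : ∀ (s : Set (Fin (Module.finrank ℝ W))) (x : W),
      x ∈ Submodule.span ℝ (e '' s) ↔ ∀ i, i ∉ s → e.repr x i = 0 := by
    intro s x
    rw [e.mem_span_image]
    constructor
    · intro h i hi
      by_contra h2
      exact hi (h (by simpa using h2))
    · intro h i hi
      by_contra h2
      exact (by simpa using hi : e.repr x i ≠ 0) (h i h2)
  have hne : ∀ x, x ≠ 0 → ∃ i, e.repr x i ≠ 0 := by
    intro x hx
    by_contra! h
    exact hx (e.repr.map_eq_zero_iff.1 (Finsupp.ext h))
  refine ⟨⟨Submodule.span ℝ (e '' {i | 0 < B (e i) (e i)}),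
    Submodule.span ℝ (e '' {i | B (e i) (e i) < 0}), ?_, ?_, ?_, ?_⟩⟩
  · refine ⟨?_, ?_⟩
    · refine e.linearIndependent.disjoint_span_image ?_
      exact Set.disjoint_left.2 fun i (hi : 0 < B (e i) (e i)) (hi' : B (e i) (e i) < 0) =>
        lt_asymm hi hi'
    · rw [codisjoint_iff, ← Submodule.span_union, ← Set.image_union]
      have : {i | 0 < B (e i) (e i)} ∪ {i | B (e i) (e i) < 0} = Set.univ :=
        Set.eq_univ_of_forall fun i => (h0 i).symm.lt_or_gt
      rw [this, Set.image_univ, e.span_eq]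
  · intro x hx hx0
    rw [hmem] at hx
    obtain ⟨i, hi⟩ := hne x hx0
    rw [hform]
    refine Finset.sum_pos' (fun j _ => ?_) ⟨i, Finset.mem_univ i, ?_⟩
    · by_cases hj : 0 < B (e j) (e j)
      · exact mul_nonneg hj.le (mul_self_nonneg _)
      · simp [hx j hj]
    · have : 0 < B (e i) (e i) := by
        by_contra h; exact hi (hx i h)
      exact mul_pos this (mul_self_pos.2 hi)
  · intro x hx hx0
    rw [hmem] at hx
    obtain ⟨i, hi⟩ := hne x hx0
    rw [hform]
    refine Finset.sum_neg' (fun j _ => ?_) ⟨i, Finset.mem_univ i, ?_⟩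
    · by_cases hj : B (e j) (e j) < 0
      · exact mul_nonpos_of_nonpos_of_nonneg hj.le (mul_self_nonneg _)
      · simp [hx j hj]
    · have : B (e i) (e i) < 0 := by
        by_contra h; exact hi (hx i h)
      exact mul_neg_of_neg_of_pos this (mul_self_pos.2 hi)
  · intro x hx y hy
    rw [hmem] at hx hy
    rw [hform]
    refine Finset.sum_eq_zero fun i _ => ?_
    by_cases hi : 0 < B (e i) (e i)
    · simp [hy i (not_lt.2 hi.le)]
    · simp [hx i hi]

namespace Frame

variable {v} {ι : Type} [Fintype ι] (E : v.Frame ι)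

/-- The sign of a frame vector. -/
def sign (i : ι) : ℝ := if E.sgn i then 1 else -1

theorem sign_eq (i : ι) : E.sign i = 1 ∨ E.sign i = -1 := by
  unfold sign; split_ifs <;> simp

theorem form_eq (x y : W) :
    B x y = ∑ i, E.sign i * (E.basis.repr x i * E.basis.repr y i) := by
  conv_lhs => rw [← E.basis.sum_repr x, ← E.basis.sum_repr y]
  simp only [map_sum, LinearMap.sum_apply, map_smul, LinearMap.smul_apply, smul_eq_mul]
  refine Finset.sum_congr rfl fun i _ => ?_
  rw [Finset.sum_eq_single i]
  · rw [E.norm, sign]; ring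
  · intro j _ hj
    simp [E.orth j i hj]
  · simp

theorem repr_projPos (x : W) (i : ι) :
    E.basis.repr (v.projPos x) i = if E.sgn i then E.basis.repr x i else 0 := by
  classical
  have h : ∀ j, E.basis.repr (v.projPos (E.basis j)) i
      = if E.sgn i then E.basis.repr (E.basis j) i else 0 := by
    intro j
    cases hj : E.sgn j with
    | true =>
      have : v.projPos (E.basis j) = E.basis j :=
        Submodule.projection_apply_left v.isCompl ⟨_, E.mem_pos j hj⟩
      rw [this]
      split_ifs with hi
      · rfl
      · have hij : j ≠ i := by rintro rfl; exact hi hj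
        simp [hij]
    | false =>
      have : v.projPos (E.basis j) = 0 :=
        (Submodule.projection_apply_eq_zero_iff v.isCompl).2 (E.mem_neg j hj)
      rw [this]
      split_ifs with hi
      · have hij : j ≠ i := by rintro rfl; simp [hi] at hj
        simp [hij]
      · simp
  conv_lhs => rw [← E.basis.sum_repr x]
  simp only [map_sum, map_smul, Finsupp.coe_finsetSum, Finset.sum_apply, Finsupp.smul_apply, h,
    smul_eq_mul]
  rw [Finset.sum_eq_single i]
  · split_ifs <;> simp
  · intro j _ hj
    simp [hj]
  · simp

theorem projPos_add_projNeg (v : Grass B) (x : W) : v.projPos x + v.projNeg x = x :=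
  Submodule.projection_add_projection_eq_self v.isCompl x

theorem repr_projNeg (x : W) (i : ι) :
    E.basis.repr (v.projNeg x) i = if E.sgn i then 0 else E.basis.repr x i := by
  have h : v.projNeg x = x - v.projPos x := by
    rw [eq_sub_iff_add_eq, add_comm]; exact projPos_add_projNeg v x
  rw [h, map_sub, Finsupp.sub_apply, E.repr_projPos]
  split_ifs <;> simp

theorem form_projPos (x : W) : B (v.projPos x) (v.projPos x)
    = ∑ i, if E.sgn i then E.basis.repr x i ^ 2 else 0 := by
  rw [E.form_eq]
  refine Finset.sum_congr rfl fun i _ => ?_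
  rw [E.repr_projPos, sign]
  split_ifs <;> ring

theorem form_projNeg (x : W) : B (v.projNeg x) (v.projNeg x)
    = ∑ i, if E.sgn i then 0 else -E.basis.repr x i ^ 2 := by
  rw [E.form_eq]
  refine Finset.sum_congr rfl fun i _ => ?_
  rw [E.repr_projNeg, sign]
  split_ifs <;> ring

theorem majorant_eq (x y : W) : v.majorant x y = ∑ i, E.basis.repr x i * E.basis.repr y i := by
  rw [Grass.majorant, E.form_eq, E.form_eq, ← Finset.sum_sub_distrib]
  refine Finset.sum_congr rfl fun i _ => ?_
  rw [E.repr_projPos, E.repr_projPos, E.repr_projNeg, E.repr_projNeg, sign]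
  split_ifs <;> ring

theorem equivalent : QuadraticMap.Equivalent (LinearMap.BilinMap.toQuadraticMap B)
    (QuadraticMap.weightedSumSquares ℝ E.sign) := by
  refine ⟨⟨E.basis.equivFun, fun x => ?_⟩⟩
  rw [LinearMap.BilinMap.toQuadraticMap_apply, E.form_eq]
  simp [QuadraticMap.weightedSumSquares_apply]

/-- Sylvester's law of inertia. With `sigNeg_eq` it identifies the numbers of square-root factors
produced by the Fourier transform with the signature. -/
theorem sigPos_eq : sigPos (LinearMap.BilinMap.toQuadraticMap B)
    = (Finset.univ.filter fun i => E.sgn i = true).card := by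
  rw [QuadraticForm.sigPos_of_equiv_weightedSumSquares E.equivalent, ← Set.ncard_coe_finset]
  congr 1
  ext i
  simp only [sign, Set.mem_ofPred_eq, Finset.coe_filter, Finset.mem_univ, true_and]
  cases E.sgn i <;> simp

theorem sigNeg_eq : sigNeg (LinearMap.BilinMap.toQuadraticMap B)
    = (Finset.univ.filter fun i => E.sgn i = false).card := by
  rw [QuadraticForm.sigNeg_of_equiv_weightedSumSquares E.equivalent, ← Set.ncard_coe_finset]
  congr 1
  ext i
  simp only [sign, Set.mem_ofPred_eq, Finset.coe_filter, Finset.mem_univ, true_and]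
  cases E.sgn i <;> simp

end Frame

end Grass

end Frames

namespace PrimitiveSublattice

variable {V : Type*} [AddCommGroup V] [Module ℝ V] [FiniteDimensional ℝ V] {L : EvenLattice V}
  (M : PrimitiveSublattice L)

/-- The union of frames of `M_ℝ` and `M_ℝ^⊥`. -/
def directSumFrame {u : M.toLattice.Gr} {w : M.PerpGr} {ι κ : Type} (E : u.Frame ι)
    (E' : w.Frame κ) : (M.directSum u w).Frame (ι ⊕ κ) where
  basis := (E.basis.prod E'.basis).map (Submodule.prodEquivOfIsCompl M.real M.perp M.isCompl)
  sgn := Sum.elim E.sgn E'.sgn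
  orth := by
    rintro (i | i) (j | j) hij
    · simpa using! E.orth i j (by simpa using hij)
    · simpa using M.form_real_perp (E.basis i) (E'.basis j)
    · simpa using M.form_perp_real (E'.basis i) (E.basis j)
    · simpa using! E'.orth i j (by simpa using hij)
  norm := by
    rintro (i | i)
    · simpa using! E.norm i
    · simpa using! E'.norm i
  mem_pos := by
    rintro (i | i) hi
    · simpa using! Submodule.mem_sup_left (Submodule.mem_map_of_mem (f := M.real.subtype)
        (E.mem_pos i hi))
    · simpa using! Submodule.mem_sup_right (Submodule.mem_map_of_mem (f := M.perp.subtype)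
        (E'.mem_pos i hi))
  mem_neg := by
    rintro (i | i) hi
    · simpa using! Submodule.mem_sup_left (Submodule.mem_map_of_mem (f := M.real.subtype)
        (E.mem_neg i hi))
    · simpa using! Submodule.mem_sup_right (Submodule.mem_map_of_mem (f := M.perp.subtype)
        (E'.mem_neg i hi))

variable {u : M.toLattice.Gr} {w : M.PerpGr} {ι κ : Type} (E : u.Frame ι) (E' : w.Frame κ)

theorem directSumFrame_repr_inl (x : V) (i : ι) :
    (M.directSumFrame E E').basis.repr x (Sum.inl i) = E.basis.repr (M.projReal x) i := by
  simp [directSumFrame]; rfl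

theorem directSumFrame_repr_inr (x : V) (i : κ) :
    (M.directSumFrame E E').basis.repr x (Sum.inr i) = E'.basis.repr (M.projPerp x) i := by
  simp [directSumFrame]; rfl

end PrimitiveSublattice

/-! ### The heat operator on polynomials -/

namespace MvPolynomial

variable {ι : Type} [Fintype ι]

/-- The commutator of two derivations is a derivation, hence determined by its values on the
variables, where it vanishes. -/
theorem pderiv_comm (i j : ι) (P : MvPolynomial ι ℂ) :
    pderiv i (pderiv j P) = pderiv j (pderiv i P) := by
  classical
  have h : ⁅(pderiv i : Derivation ℂ (MvPolynomial ι ℂ) (MvPolynomial ι ℂ)),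
      (pderiv j : Derivation ℂ (MvPolynomial ι ℂ) (MvPolynomial ι ℂ))⁆ = 0 := by
    refine MvPolynomial.derivation_ext fun k => ?_
    simp only [Derivation.commutator_apply, pderiv_X, Derivation.zero_apply]
    rcases eq_or_ne j k with rfl | hj <;> rcases eq_or_ne i j with rfl | hi <;>
      simp [Pi.single_apply, *] <;> split_ifs <;> simp
  have := DFunLike.congr_fun h P
  rw [Derivation.commutator_apply, Derivation.zero_apply, sub_eq_zero] at this
  exact this

/-- The Laplacian `∑ ∂_i²`. -/
def lap : MvPolynomial ι ℂ →ₗ[ℂ] MvPolynomial ι ℂ :=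
  ∑ i, (pderiv i).toLinearMap ∘ₗ (pderiv i).toLinearMap

theorem lap_apply (P : MvPolynomial ι ℂ) : lap P = ∑ i, pderiv i (pderiv i P) := by
  simp [lap]

theorem lap_pderiv (i : ι) (P : MvPolynomial ι ℂ) : lap (pderiv i P) = pderiv i (lap P) := by
  rw [lap_apply, lap_apply, map_sum]
  refine Finset.sum_congr rfl fun j _ => ?_
  rw [pderiv_comm j i, pderiv_comm j i]

theorem lap_X_mul (i : ι) (P : MvPolynomial ι ℂ) :
    lap (X i * P) = X i * lap P + 2 * pderiv i P := by
  classical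
  have h : ∀ j, pderiv j (pderiv j (X i * P))
      = X i * pderiv j (pderiv j P) + if j = i then 2 * pderiv i P else 0 := by
    intro j
    rcases eq_or_ne j i with rfl | h
    · simp only [pderiv_mul, pderiv_X_self, map_add, pderiv_one, if_true]; ring
    · simp only [pderiv_mul, pderiv_X_of_ne h.symm, map_add, map_zero, if_neg h]; ring
  rw [lap_apply, lap_apply, Finset.mul_sum]
  simp only [h, Finset.sum_add_distrib, Finset.sum_ite_eq', Finset.mem_univ, if_true]

/-- The commutator of Δ with X_i is 2 ∂_i, and ∂_i commutes with Δ, so each further power of Δ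
contributes one more such term. -/
theorem lap_iterate_succ_X_mul (i : ι) (n : ℕ) (P : MvPolynomial ι ℂ) :
    lap^[n + 1] (X i * P)
      = X i * lap^[n + 1] P + C (2 * ((n : ℂ) + 1)) * pderiv i (lap^[n] P) := by
  induction n with
  | zero => simp [lap_X_mul, map_ofNat]
  | succ n ih =>
    rw [Function.iterate_succ_apply', ih, map_add, lap_X_mul,
      ← Function.iterate_succ_apply' lap (n + 1) P, ← smul_eq_C_mul, map_smul, lap_pderiv,
      ← Function.iterate_succ_apply' lap n P, smul_eq_C_mul]
    simp only [map_add, map_mul, map_natCast, map_one, map_ofNat, Nat.cast_add, Nat.cast_one]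
    ring

/-- The partial sums of `exp (c Δ)`. -/
def expLap (c : ℝ) (N : ℕ) (P : MvPolynomial ι ℂ) : MvPolynomial ι ℂ :=
  ∑ j ∈ Finset.range N, C ((c ^ j / j.factorial : ℝ) : ℂ) * lap^[j] P

/-- A truncated form of e^{cΔ} X_i = (X_i + 2c ∂_i) e^{cΔ}; the derivative term comes from a
commutator with Δ and is therefore truncated one order earlier. This is the recursion that defines
`hermitePoly`. -/
theorem expLap_succ_X_mul (c : ℝ) (N : ℕ) (i : ι) (P : MvPolynomial ι ℂ) :
    expLap c (N + 1) (X i * P)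
      = X i * expLap c (N + 1) P + C (2 * (c : ℂ)) * pderiv i (expLap c N P) := by
  rw [expLap, Finset.sum_range_succ', expLap, Finset.sum_range_succ', expLap, map_sum, mul_add,
    Finset.mul_sum, Finset.mul_sum, add_right_comm, ← Finset.sum_add_distrib]
  refine congrArg₂ _ (Finset.sum_congr rfl fun j _ => ?_) ?_
  · rw [lap_iterate_succ_X_mul, pderiv_C_mul]
    have h : ((c ^ (j + 1) / (j + 1).factorial : ℝ) : ℂ) * (2 * ((j : ℂ) + 1))
        = 2 * c * ((c ^ j / j.factorial : ℝ) : ℂ) := by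
      rw [Nat.factorial_succ]
      push_cast
      have h1 : (j.factorial : ℂ) ≠ 0 := by exact_mod_cast j.factorial_ne_zero
      have h2 : (j + 1 : ℂ) ≠ 0 := by exact_mod_cast j.succ_ne_zero
      field_simp
      ring
    have h3 : C ((c ^ (j + 1) / (j + 1).factorial : ℝ) : ℂ) * C (σ := ι) (2 * ((j : ℂ) + 1))
        = C (2 * (c : ℂ)) * C ((c ^ j / j.factorial : ℝ) : ℂ) := by
      rw [← C_mul, ← C_mul, h]
    linear_combination (pderiv i (lap^[j] P)) * h3
  · simp

/-- The product of Hermite polynomials with the degrees `d`. -/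
def hermite (c : ℝ) (d : ι →₀ ℕ) : MvPolynomial ι ℂ :=
  ∏ i, Polynomial.aeval (X i) (hermitePoly c (d i))

theorem pderiv_aeval_X_self (i : ι) (q : Polynomial ℂ) :
    pderiv i (Polynomial.aeval (X i : MvPolynomial ι ℂ) q)
      = Polynomial.aeval (X i) (Polynomial.derivative q) := by
  rw [Derivation.map_aeval, pderiv_X_self, smul_eq_mul, mul_one]

theorem pderiv_prod_aeval_X (i : ι) (s : Finset ι) (hi : i ∉ s) (q : ι → Polynomial ℂ) :
    pderiv i (∏ j ∈ s, Polynomial.aeval (X j : MvPolynomial ι ℂ) (q j)) = 0 := by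
  classical
  induction s using Finset.induction_on with
  | empty => simp
  | insert a s ha ih =>
    rw [Finset.prod_insert ha, pderiv_mul, ih fun h => hi (Finset.mem_insert_of_mem h),
      Derivation.map_aeval, pderiv_X_of_ne fun h => hi (by rw [← h]; exact Finset.mem_insert_self _ _)]
    simp

/-- Raising d_i changes only the i-th factor of the product, and ∂_i acts on that factor alone. -/
theorem hermite_single_add (c : ℝ) (i : ι) (d : ι →₀ ℕ) :
    hermite c (Finsupp.single i 1 + d)
      = X i * hermite c d + C (2 * (c : ℂ)) * pderiv i (hermite c d) := by
  classical
  have h1 : ∏ j ∈ Finset.univ.erase i, Polynomial.aeval (X j : MvPolynomial ι ℂ)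
      (hermitePoly c ((Finsupp.single i 1 + d : ι →₀ ℕ) j))
      = ∏ j ∈ Finset.univ.erase i, Polynomial.aeval (X j) (hermitePoly c (d j)) := by
    refine Finset.prod_congr rfl fun j hj => ?_
    simp [(Finset.ne_of_mem_erase hj).symm]
  have h2 := pderiv_prod_aeval_X i (Finset.univ.erase i) (Finset.notMem_erase _ _)
    fun j => hermitePoly c (d j)
  rw [hermite, hermite, ← Finset.mul_prod_erase _ _ (Finset.mem_univ i),
    ← Finset.mul_prod_erase _ (fun i => Polynomial.aeval (X i) (hermitePoly c (d i)))
      (Finset.mem_univ i), h1, pderiv_mul, h2, pderiv_aeval_X_self]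
  have h3 : (Finsupp.single i 1 + d : ι →₀ ℕ) i = d i + 1 := by simp [add_comm]
  rw [h3, hermitePoly]
  simp only [map_add, map_mul, Polynomial.aeval_X, Polynomial.aeval_C, algebraMap_eq]
  ring

/-- Induction on the degree: e^{cΔ} and the product of Hermite polynomials obey the same recursion
under multiplication by a variable. -/
theorem exists_expLap_monomial (c : ℝ) (d : ι →₀ ℕ) :
    ∃ N₀, ∀ N, N₀ ≤ N → lap^[N] (monomial d (1 : ℂ)) = 0 ∧
      expLap c N (monomial d (1 : ℂ)) = hermite c d := by
  induction hn : d.degree generalizing d with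
  | zero =>
    have hd : d = 0 := (Finsupp.degree_eq_zero_iff d).1 hn
    subst hd
    refine ⟨1, fun N hN => ?_⟩
    obtain ⟨N, rfl⟩ := Nat.exists_eq_add_of_le' hN
    have h0 : ∀ N, lap^[N + 1] (monomial (0 : ι →₀ ℕ) (1 : ℂ)) = 0 := by
      intro N
      have : lap (monomial (0 : ι →₀ ℕ) (1 : ℂ)) = 0 := by
        rw [lap_apply]; simp
      rw [Function.iterate_succ_apply, this]
      exact Function.iterate_fixed (map_zero lap) N
    refine ⟨h0 N, ?_⟩
    rw [expLap, Finset.sum_range_succ']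
    simp only [h0]
    simp [hermite, hermitePoly]
  | succ n ih =>
    have hd : d ≠ 0 := by rintro rfl; simp at hn
    obtain ⟨i, hi⟩ := Finsupp.ne_iff.1 hd
    obtain ⟨e, rfl⟩ : ∃ e, d = Finsupp.single i 1 + e :=
      exists_add_of_le (by simpa [Nat.one_le_iff_ne_zero] using hi)
    have he : e.degree = n := by
      rw [map_add, Finsupp.degree_single] at hn; omega
    obtain ⟨N₀, hN₀⟩ := ih e he
    have hm : monomial (Finsupp.single i 1 + e) (1 : ℂ) = X i * monomial e 1 := by
      rw [X, monomial_mul, mul_one]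
    -- The recursion relates the truncations at N and N + 1, so the bound grows by one with each
    -- variable.
    refine ⟨N₀ + 1, fun N hN => ?_⟩
    obtain ⟨N, rfl⟩ := Nat.exists_eq_add_of_le' (Nat.le_of_add_left_le hN)
    have hN' : N₀ ≤ N := by omega
    rw [hm, lap_iterate_succ_X_mul, expLap_succ_X_mul, (hN₀ N hN').1, (hN₀ N hN').2,
      (hN₀ (N + 1) (by omega)).1, (hN₀ (N + 1) (by omega)).2, hermite_single_add]
    simp

theorem exists_expLap (c : ℝ) (P : MvPolynomial ι ℂ) :
    ∃ N₀, ∀ N, N₀ ≤ N → lap^[N] P = 0 ∧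
      expLap c N P = ∑ d ∈ P.support, C (P.coeff d) * hermite c d := by
  choose N₀ hN₀ using exists_expLap_monomial (ι := ι) c
  refine ⟨P.support.sup N₀, fun N hN => ?_⟩
  have hlin : ∀ j, lap^[j] P = ∑ d ∈ P.support, C (P.coeff d) * lap^[j] (monomial d 1) := by
    intro j
    have h : ∀ Q : MvPolynomial ι ℂ, lap^[j] Q = (lap ^ j) Q := fun Q => by
      rw [Module.End.coe_pow]
    conv_lhs => rw [P.as_sum]
    rw [h, map_sum]
    refine Finset.sum_congr rfl fun d _ => ?_
    rw [h, ← smul_eq_C_mul, ← map_smul, smul_monomial, smul_eq_mul, mul_one]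
  have hle : ∀ d ∈ P.support, N₀ d ≤ N := fun d hd => (Finset.le_sup hd).trans hN
  refine ⟨?_, ?_⟩
  · rw [hlin]
    exact Finset.sum_eq_zero fun d hd => by rw [(hN₀ d N (hle d hd)).1, mul_zero]
  · rw [expLap]
    simp only [hlin, Finset.mul_sum]
    rw [Finset.sum_comm]
    refine Finset.sum_congr rfl fun d hd => ?_
    rw [← (hN₀ d N (hle d hd)).2, expLap, Finset.mul_sum]
    exact Finset.sum_congr rfl fun j _ => by ring

end MvPolynomial

/-! ### Theta terms in a frame -/

/-- The point `-τ̄` of the upper half plane. -/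
def UpperHalfPlane.negConj (τ : ℍ) : ℍ :=
  ⟨-(starRingEnd ℂ) (τ : ℂ), by simpa using τ.im_pos⟩

namespace Grass.Frame

variable {W : Type*} [AddCommGroup W] [Module ℝ W] [FiniteDimensional ℝ W]
  {B : LinearMap.BilinForm ℝ W} {v : Grass B} {ι : Type} [Fintype ι] (E : v.Frame ι)

/-- A polynomial in the coordinates of the frame, as a function. -/
def evalPoly (P : MvPolynomial ι ℂ) (x : W) : ℂ :=
  MvPolynomial.eval (fun i => ((E.basis.repr x i : ℝ) : ℂ)) P

theorem exists_evalPoly {p : W → ℂ} (hp : p ∈ realPolyFunctions W) :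
    ∃ P : MvPolynomial ι ℂ, p = E.evalPoly P := by
  induction hp using Algebra.adjoin_induction with
  | mem p hp =>
    obtain ⟨l, rfl⟩ := hp
    refine ⟨∑ i, MvPolynomial.C ((l (E.basis i) : ℝ) : ℂ) * MvPolynomial.X i, ?_⟩
    ext x
    have h : l x = ∑ i, l (E.basis i) * E.basis.repr x i := by
      conv_lhs => rw [← E.basis.sum_repr x, map_sum]
      exact Finset.sum_congr rfl fun i _ => by rw [map_smul, smul_eq_mul, mul_comm]
    simp [evalPoly, h]
  | algebraMap c => exact ⟨MvPolynomial.C c, by ext x; simp [evalPoly]⟩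
  | add p q _ _ hp hq =>
    obtain ⟨P, rfl⟩ := hp
    obtain ⟨Q, rfl⟩ := hq
    exact ⟨P + Q, by ext x; simp [evalPoly]⟩
  | mul p q _ _ hp hq =>
    obtain ⟨P, rfl⟩ := hp
    obtain ⟨Q, rfl⟩ := hq
    exact ⟨P * Q, by ext x; simp [evalPoly]⟩

theorem lineDeriv_evalPoly (P : MvPolynomial ι ℂ) (x w : W) :
    lineDeriv ℝ (E.evalPoly P) x w
      = E.evalPoly (∑ i, MvPolynomial.C ((E.basis.repr w i : ℝ) : ℂ) * MvPolynomial.pderiv i P) x := by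
  classical
  refine HasLineDerivAt.lineDeriv ?_
  unfold HasLineDerivAt
  induction P using MvPolynomial.induction_on with
  | C a => simpa [evalPoly] using hasDerivAt_const (0 : ℝ) a
  | add P Q hP hQ =>
    refine (hP.add hQ).congr_deriv ?_ |>.congr_of_eventuallyEq (Eventually.of_forall fun t => ?_)
    · simp [evalPoly, mul_add, Finset.sum_add_distrib]
    · simp [evalPoly]
  | mul_X P i hP =>
    have hX : HasDerivAt (fun t : ℝ => ((E.basis.repr (x + t • w) i : ℝ) : ℂ))
        ((E.basis.repr w i : ℝ) : ℂ) 0 := by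
      have : HasDerivAt (fun t : ℝ => E.basis.repr x i + t * E.basis.repr w i)
          (E.basis.repr w i) 0 := by
        simpa using ((hasDerivAt_id (0 : ℝ)).mul_const (E.basis.repr w i)).const_add
          (E.basis.repr x i)
      simpa using this.ofReal_comp
    refine (hP.mul hX).congr_deriv ?_ |>.congr_of_eventuallyEq (Eventually.of_forall fun t => ?_)
    · simp only [evalPoly, map_sum, map_mul, MvPolynomial.eval_C, MvPolynomial.pderiv_mul,
        map_add, MvPolynomial.eval_X, zero_smul, add_zero, MvPolynomial.pderiv_X, mul_add,
        Finset.sum_add_distrib, Finset.sum_mul]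
      refine congrArg₂ _ (Finset.sum_congr rfl fun j _ => by ring) ?_
      rw [Finset.sum_eq_single i]
      · simp; ring
      · intro j _ hj
        simp [hj.symm]
      · simp
    · simp [evalPoly]

/-- A frame is orthonormal for the majorant, so the Gram matrix of any basis is G = Sᵀ S with S the
change of basis. Then S G⁻¹ Sᵀ = 1, and the Laplacian is ∑ ∂_i² in frame coordinates. -/
theorem laplacian_evalPoly (P : MvPolynomial ι ℂ) :
    v.laplacian (E.evalPoly P) = E.evalPoly (MvPolynomial.lap P) := by
  classical
  ext x
  unfold Grass.laplacian
  set b := Module.finBasis ℝ W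
  set G : Matrix (Fin (Module.finrank ℝ W)) (Fin (Module.finrank ℝ W)) ℝ :=
    Matrix.of fun k l => v.majorant (b k) (b l) with hG
  set S := E.basis.toMatrix b with hS
  set N := b.toMatrix E.basis with hN
  have hGS : G = S.transpose * S := by
    ext k l
    rw [hG, Matrix.of_apply, E.majorant_eq, Matrix.mul_apply]
    rfl
  have hNS : N * S = 1 := Module.Basis.toMatrix_mul_toMatrix_flip _ _
  have hSN : S * N = 1 := Module.Basis.toMatrix_mul_toMatrix_flip _ _
  have hGinv : G⁻¹ = N * N.transpose := by
    refine Matrix.inv_eq_right_inv ?_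
    rw [hGS, Matrix.mul_assoc, ← Matrix.mul_assoc S, hSN, Matrix.one_mul, ← Matrix.transpose_mul,
      hNS, Matrix.transpose_one]
  have hone : S * G⁻¹ * S.transpose = 1 := by
    rw [hGinv, ← Matrix.mul_assoc S, hSN, Matrix.one_mul, ← Matrix.transpose_mul, hSN,
      Matrix.transpose_one]
  have hfun : ∀ w, (fun y => lineDeriv ℝ (E.evalPoly P) y w)
      = E.evalPoly (∑ i, MvPolynomial.C ((E.basis.repr w i : ℝ) : ℂ) * MvPolynomial.pderiv i P) :=
    fun w => funext fun y => E.lineDeriv_evalPoly P y w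
  have hterm : ∀ i j, lineDeriv ℝ (fun y => lineDeriv ℝ (E.evalPoly P) y (b j)) x (b i)
      = ∑ k, ∑ l, ((S k i : ℝ) : ℂ) * ((S l j : ℝ) : ℂ) *
          E.evalPoly (MvPolynomial.pderiv k (MvPolynomial.pderiv l P)) x := by
    intro i j
    rw [hfun, E.lineDeriv_evalPoly]
    simp only [evalPoly, map_sum, map_mul, MvPolynomial.eval_C, MvPolynomial.pderiv_C_mul,
      Finset.mul_sum]
    refine Finset.sum_congr rfl fun k _ => Finset.sum_congr rfl fun l _ => ?_
    rw [← mul_assoc]; rfl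
  change ∑ i, ∑ j, ((G⁻¹ i j : ℝ) : ℂ) *
    lineDeriv ℝ (fun y => lineDeriv ℝ (E.evalPoly P) y (b j)) x (b i) = _
  simp only [hterm]
  have hswap : ∑ i, ∑ j, ((G⁻¹ i j : ℝ) : ℂ) * ∑ k, ∑ l, ((S k i : ℝ) : ℂ) * ((S l j : ℝ) : ℂ) *
          E.evalPoly (MvPolynomial.pderiv k (MvPolynomial.pderiv l P)) x
      = ∑ k, ∑ l, (((S * G⁻¹ * S.transpose) k l : ℝ) : ℂ) *
          E.evalPoly (MvPolynomial.pderiv k (MvPolynomial.pderiv l P)) x := by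
    simp only [Matrix.mul_apply, Matrix.transpose_apply, Complex.ofReal_sum, Complex.ofReal_mul,
      Finset.sum_mul, Finset.mul_sum]
    refine (Finset.sum_congr rfl fun i _ => Finset.sum_comm).trans (Finset.sum_comm.trans ?_)
    refine Finset.sum_congr rfl fun k _ => ?_
    refine (Finset.sum_congr rfl fun i _ => Finset.sum_comm).trans (Finset.sum_comm.trans ?_)
    refine Finset.sum_congr rfl fun l _ => Finset.sum_comm.trans ?_
    exact Finset.sum_congr rfl fun j _ => Finset.sum_congr rfl fun i _ => by ring
  rw [hswap, hone, MvPolynomial.lap_apply]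
  simp only [Matrix.one_apply]
  rw [evalPoly, map_sum]
  refine Finset.sum_congr rfl fun k _ => ?_
  rw [Finset.sum_eq_single k]
  · simp [evalPoly]
  · intro l _ hl
    simp [hl.symm]
  · simp

theorem iterate_laplacian_evalPoly (P : MvPolynomial ι ℂ) (j : ℕ) :
    v.laplacian^[j] (E.evalPoly P) = E.evalPoly (MvPolynomial.lap^[j] P) := by
  induction j with
  | zero => rfl
  | succ j ih => rw [Function.iterate_succ_apply', ih, laplacian_evalPoly,
      Function.iterate_succ_apply']

/-- The length of the sum is uniform in c, so as a function of τ the heat operator contributes a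
polynomial in 1/y; smoothness rests on this. -/
theorem exists_expLaplacian_eq_sum (P : MvPolynomial ι ℂ) : ∃ N : ℕ, ∀ (c : ℝ) (x : W),
    v.expLaplacian c (E.evalPoly P) x
      = ∑ j ∈ Finset.range N, ((c ^ j / j.factorial : ℝ) : ℂ) *
          E.evalPoly (MvPolynomial.lap^[j] P) x := by
  -- Only the vanishing of high powers of Δ is used; it does not involve c, so the value 0 serves.
  obtain ⟨N, hN⟩ := MvPolynomial.exists_expLap 0 P
  refine ⟨N, fun c x => ?_⟩
  rw [Grass.expLaplacian]
  simp only [iterate_laplacian_evalPoly]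
  refine tsum_eq_sum fun j hj => ?_
  rw [(hN j (by simpa using hj)).1]
  simp [evalPoly]

theorem expLaplacian_evalPoly (c : ℝ) (P : MvPolynomial ι ℂ) (x : W) :
    v.expLaplacian c (E.evalPoly P) x
      = ∑ d ∈ P.support, P.coeff d *
          ∏ i, (hermitePoly c (d i)).eval ((E.basis.repr x i : ℝ) : ℂ) := by
  obtain ⟨N, hN⟩ := MvPolynomial.exists_expLap c P
  rw [Grass.expLaplacian]
  simp only [iterate_laplacian_evalPoly]
  rw [tsum_eq_sum (s := Finset.range N) fun j hj => by
    rw [(hN j (by simpa using hj)).1]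
    simp [evalPoly]]
  have h := congrArg (fun Q => E.evalPoly Q x) (hN N le_rfl).2
  simp only [MvPolynomial.expLap, evalPoly, map_sum, map_mul, MvPolynomial.eval_C,
    MvPolynomial.hermite, map_prod] at h
  simp only [evalPoly]
  rw [h]
  refine Finset.sum_congr rfl fun d _ => congrArg _ (Finset.prod_congr rfl fun i _ => ?_)
  have h2 : (MvPolynomial.eval fun i => ((E.basis.repr x i : ℝ) : ℂ)).comp
      (algebraMap ℂ (MvPolynomial ι ℂ)) = RingHom.id ℂ := by ext; simp
  rw [Polynomial.aeval_def, Polynomial.hom_eval₂, h2, MvPolynomial.eval_X, Polynomial.eval₂_id]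

/-- The variable attached to a coordinate: `τ` on `v₊`, `-τ̄` on `v₋`. -/
def point (τ : ℍ) (i : ι) : ℍ := if E.sgn i then τ else τ.negConj

/-- In a negative direction the form is -t², so τ̄ is replaced by -τ̄, again a point of ℍ with the
same imaginary part. All coordinates therefore carry Hermite functions of the same kind. -/
theorem thetaTerm_evalPoly (P : MvPolynomial ι ℂ) (τ : ℍ) (x : W) :
    v.thetaTerm (E.evalPoly P) τ x
      = ∑ d ∈ P.support, P.coeff d *
          ∏ i, hermiteGauss (d i) (E.point τ i) (E.basis.repr x i) := by
  have him : ∀ i, (E.point τ i).im = τ.im := by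
    intro i
    unfold Frame.point
    split_ifs
    · rfl
    · change (-(starRingEnd ℂ) (τ : ℂ)).im = (τ : ℂ).im
      simp
  have hexp : expTwoPiI ((τ : ℂ) * ((B (v.projPos x) (v.projPos x) : ℝ) : ℂ) / 2 +
      (starRingEnd ℂ) (τ : ℂ) * ((B (v.projNeg x) (v.projNeg x) : ℝ) : ℂ) / 2)
      = ∏ i, expTwoPiI ((E.point τ i : ℂ) * ((E.basis.repr x i : ℝ) : ℂ) ^ 2 / 2) := by
    rw [← expTwoPiI_sum, E.form_projPos, E.form_projNeg]
    congr 1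
    push_cast
    rw [Finset.mul_sum, Finset.mul_sum, Finset.sum_div, Finset.sum_div, ← Finset.sum_add_distrib]
    refine Finset.sum_congr rfl fun i _ => ?_
    unfold Frame.point
    split_ifs <;> simp [negConj]
  rw [Grass.thetaTerm, E.expLaplacian_evalPoly, hexp, Finset.sum_mul]
  refine Finset.sum_congr rfl fun d _ => ?_
  rw [mul_assoc, ← Finset.prod_mul_distrib]
  simp only [hermiteGauss, him]

theorem _root_.MvPolynomial.coeff_bind₁_C_mul_X (a : ι → ℂ) (P : MvPolynomial ι ℂ) (d : ι →₀ ℕ) :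
    MvPolynomial.coeff d (MvPolynomial.bind₁ (fun i => MvPolynomial.C (a i) * MvPolynomial.X i) P)
      = (∏ i, a i ^ d i) * MvPolynomial.coeff d P := by
  classical
  induction P using MvPolynomial.induction_on' with
  | monomial e r =>
    have h : MvPolynomial.bind₁ (fun i => MvPolynomial.C (a i) * MvPolynomial.X i)
        (MvPolynomial.monomial e r) = MvPolynomial.monomial e ((∏ i, a i ^ e i) * r) := by
      have h2 : ∀ r : ℂ, MvPolynomial.monomial e r
          = MvPolynomial.C r * ∏ i, (MvPolynomial.X i : MvPolynomial ι ℂ) ^ e i := by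
        intro r
        rw [MvPolynomial.monomial_eq, Finsupp.prod_fintype _ _ fun i => pow_zero _]
      rw [h2, h2]
      simp only [map_mul, map_prod, map_pow, MvPolynomial.bind₁_X_right, mul_pow,
        Finset.prod_mul_distrib, MvPolynomial.bind₁_C_right]
      ring
    rw [h, MvPolynomial.coeff_monomial, MvPolynomial.coeff_monomial]
    split_ifs with hd
    · rw [hd]
    · simp
  | add P Q hP hQ => simp [hP, hQ, mul_add]

/-- Scaling the coordinates by c₊ and c₋ multiplies the coefficient of d by the corresponding
powers, and homogeneity prescribes this factor. Comparison at a nonzero coefficient gives the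
degrees. -/
theorem degree_of_isHomogeneous {mp mn : ℕ} {P : MvPolynomial ι ℂ}
    (hP : v.IsHomogeneous (E.evalPoly P) mp mn) {d : ι →₀ ℕ} (hd : d ∈ P.support) :
    (∑ i, if E.sgn i then d i else 0) = mp ∧ (∑ i, if E.sgn i then 0 else d i) = mn := by
  classical
  have key : ∀ cp cn : ℝ, ((cp : ℂ) ^ (∑ i, if E.sgn i then d i else 0) *
      (cn : ℂ) ^ (∑ i, if E.sgn i then 0 else d i)) = (cp : ℂ) ^ mp * (cn : ℂ) ^ mn := by
    intro cp cn
    have hQ : MvPolynomial.bind₁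
        (fun i => MvPolynomial.C (if E.sgn i then (cp : ℂ) else cn) * MvPolynomial.X i) P
        = MvPolynomial.C ((cp : ℂ) ^ mp * (cn : ℂ) ^ mn) * P := by
      -- Homogeneity is known at real points only; ℝ is infinite, so these suffice to identify
      -- complex polynomials.
      refine MvPolynomial.funext_set (fun _ => Set.range fun r : ℝ => (r : ℂ))
        (fun _ => Set.infinite_range_of_injective Complex.ofReal_injective) fun y hy => ?_
      choose r hr using fun i => hy i (Set.mem_univ i)
      have hx := hP.2 cp cn (E.basis.equivFun.symm r)
      have hrepr : ∀ i, E.basis.repr (E.basis.equivFun.symm r) i = r i := fun i => by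
        rw [← Module.Basis.equivFun_apply, LinearEquiv.apply_symm_apply]
      simp only [evalPoly, map_add, map_smul, Finsupp.add_apply, Finsupp.smul_apply, smul_eq_mul,
        E.repr_projPos, E.repr_projNeg, hrepr] at hx
      have hy' : (fun i => ((r i : ℝ) : ℂ)) = y := funext hr
      rw [hy'] at hx
      rw [map_mul, MvPolynomial.eval_C, ← hx, ← MvPolynomial.coe_aeval_eq_eval,
        ← MvPolynomial.coe_aeval_eq_eval]
      simp only [RingHom.coe_coe, MvPolynomial.aeval_bind₁]
      congr 2
      ext i
      simp only [map_mul, MvPolynomial.aeval_X, MvPolynomial.aeval_C, ← hr]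
      split_ifs <;> simp
    have hcoef := congrArg (MvPolynomial.coeff d) hQ
    rw [MvPolynomial.coeff_bind₁_C_mul_X, MvPolynomial.coeff_C_mul] at hcoef
    have h2 := mul_right_cancel₀ (MvPolynomial.mem_support_iff.1 hd) hcoef
    rw [← h2, ← Finset.prod_pow_eq_pow_sum, ← Finset.prod_pow_eq_pow_sum,
      ← Finset.prod_mul_distrib]
    refine Finset.prod_congr rfl fun i _ => ?_
    split_ifs <;> simp
  constructor
  -- The scalars 2 and 1 isolate one degree at a time, powers of 2 being distinct.
  · have h := key 2 1
    simp only [Complex.ofReal_one, one_pow, mul_one, Complex.ofReal_ofNat] at h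
    exact Nat.pow_right_injective le_rfl (by exact_mod_cast h)
  · have h := key 1 2
    simp only [Complex.ofReal_one, one_pow, one_mul, Complex.ofReal_ofNat] at h
    exact Nat.pow_right_injective le_rfl (by exact_mod_cast h)

end Grass.Frame

/-! ### Gaussian bounds -/

namespace Module.Basis

variable {W : Type*} [AddCommGroup W] [Module ℝ W] {ι κ : Type} [Fintype ι] [Fintype κ]

/-- The sum of the squares of the coordinates. -/
def sqNorm (b : Basis ι ℝ W) (x : W) : ℝ := ∑ i, b.repr x i ^ 2

theorem sqNorm_nonneg (b : Basis ι ℝ W) (x : W) : 0 ≤ b.sqNorm x :=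
  Finset.sum_nonneg fun _ _ => sq_nonneg _

theorem exists_sqNorm_le_mul (b : Basis ι ℝ W) (e : Basis κ ℝ W) :
    ∃ K : ℝ, 0 < K ∧ ∀ x, b.sqNorm x ≤ K * e.sqNorm x := by
  -- Cauchy–Schwarz bounds each coordinate; the added 1 keeps the constant positive even when W = 0.
  refine ⟨1 + ∑ i, ∑ j, b.repr (e j) i ^ 2, by positivity, fun x => ?_⟩
  have h : ∀ i, b.repr x i ^ 2 ≤ (∑ j, b.repr (e j) i ^ 2) * e.sqNorm x := by
    intro i
    have h1 : b.repr x i = ∑ j, b.repr (e j) i * e.repr x j := by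
      conv_lhs => rw [← e.sum_repr x, map_sum, Finsupp.finsetSum_apply]
      exact Finset.sum_congr rfl fun j _ => by simp [mul_comm]
    rw [h1]
    exact Finset.sum_mul_sq_le_sq_mul_sq _ _ _
  calc b.sqNorm x ≤ ∑ i, (∑ j, b.repr (e j) i ^ 2) * e.sqNorm x :=
        Finset.sum_le_sum fun i _ => h i
    _ = (∑ i, ∑ j, b.repr (e j) i ^ 2) * e.sqNorm x := by rw [Finset.sum_mul]
    _ ≤ _ := by nlinarith [e.sqNorm_nonneg x]

/-- `f` is bounded by a Gaussian function of the coordinates. -/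
def GaussBound (b : Basis ι ℝ W) (f : W → ℂ) : Prop :=
  ∃ C ε : ℝ, 0 < ε ∧ ∀ x, ‖f x‖ ≤ C * Real.exp (-ε * b.sqNorm x)

variable {b : Basis ι ℝ W} {f g : W → ℂ}

/-- Decay is independent of the basis, so a bound in frame coordinates, where functions are
products, yields one in lattice coordinates, where sums are taken. -/
theorem GaussBound.of_basis (hf : b.GaussBound f) (e : Basis κ ℝ W) : e.GaussBound f := by
  obtain ⟨C, ε, hε, h⟩ := hf
  obtain ⟨K, hK, hle⟩ := e.exists_sqNorm_le_mul b
  refine ⟨|C|, ε / K, by positivity, fun x => (h x).trans ?_⟩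
  refine mul_le_mul (le_abs_self C) (Real.exp_le_exp.2 ?_) (Real.exp_pos _).le (abs_nonneg _)
  rw [neg_mul, neg_mul, neg_le_neg_iff]
  calc ε / K * e.sqNorm x ≤ ε / K * (K * b.sqNorm x) := by gcongr; exact hle x
    _ = ε * b.sqNorm x := by field_simp

theorem GaussBound.comp_add_right (hf : b.GaussBound f) (a : W) :
    b.GaussBound fun x => f (x + a) := by
  obtain ⟨C, ε, hε, h⟩ := hf
  refine ⟨|C| * Real.exp (ε * b.sqNorm a), ε / 2, by positivity, fun x => (h _).trans ?_⟩
  have h1 := exp_neg_sum_sq_add_le hε (fun i => b.repr a i) fun i => b.repr x i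
  have h2 : b.sqNorm (x + a) = ∑ i, (b.repr a i + b.repr x i) ^ 2 := by
    simp [sqNorm, add_comm]
  rw [h2, mul_assoc]
  exact mul_le_mul (le_abs_self C) h1 (Real.exp_pos _).le (abs_nonneg _)

theorem GaussBound.mul_of_norm_le_one (hf : b.GaussBound f) (hg : ∀ x, ‖g x‖ ≤ 1) :
    b.GaussBound fun x => f x * g x := by
  obtain ⟨C, ε, hε, h⟩ := hf
  refine ⟨C, ε, hε, fun x => ?_⟩
  rw [norm_mul]
  exact (mul_le_of_le_one_right (norm_nonneg _) (hg x)).trans (h x)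

theorem GaussBound.const_mul (hf : b.GaussBound f) (c : ℂ) : b.GaussBound fun x => c * f x := by
  obtain ⟨C, ε, hε, h⟩ := hf
  refine ⟨‖c‖ * C, ε, hε, fun x => ?_⟩
  rw [norm_mul, mul_assoc]
  exact mul_le_mul_of_nonneg_left (h x) (norm_nonneg _)

end Module.Basis

/-! ### Fourier pairs -/

namespace Grass.Frame

variable {W : Type*} [AddCommGroup W] [Module ℝ W] [FiniteDimensional ℝ W]
  {B : LinearMap.BilinForm ℝ W} {v : Grass B} {ι : Type} [Fintype ι] (E : v.Frame ι)

/-- `g` is the Fourier transform of `f` with respect to `B`, and both decay rapidly. -/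
structure FourierPair (f g : W → ℂ) : Prop where
  cont : Continuous fun t : ι → ℝ => f (E.basis.equivFun.symm t)
  bound : E.basis.GaussBound f
  bound' : E.basis.GaussBound g
  eq : ∀ w, ∫ t : ι → ℝ, f (E.basis.equivFun.symm t) *
    expTwoPiI (-((B (E.basis.equivFun.symm t) w : ℝ) : ℂ)) = g w

theorem continuous_form_left (w : W) :
    Continuous fun t : ι → ℝ => B (E.basis.equivFun.symm t) w :=
  (((B.flip w).comp E.basis.equivFun.symm.toLinearMap).continuous_of_finiteDimensional)

/-- Multiplication by a character translates the Fourier transform. With a in M^* these twists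
separate the classes of D_M in `fiberSum_hermiteFun`. -/
theorem FourierPair.twist (hB : B.IsSymm) {f g : W → ℂ} (h : E.FourierPair f g) (a : W) :
    E.FourierPair (fun x => f x * expTwoPiI ((B a x : ℝ) : ℂ)) fun x => g (x - a) where
  cont := by
    refine h.cont.mul (continuous_expTwoPiI.comp (Complex.continuous_ofReal.comp ?_))
    simpa only [hB.eq a] using! E.continuous_form_left a
  bound := h.bound.mul_of_norm_le_one fun x => (norm_expTwoPiI_ofReal _).le
  bound' := by simpa only [sub_eq_add_neg] using h.bound'.comp_add_right (-a)
  eq w := by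
    rw [← h.eq]
    refine integral_congr_ae (ae_of_all _ fun t => ?_)
    simp only
    rw [mul_assoc, ← expTwoPiI_add, map_sub, hB.eq a]
    congr 2
    push_cast
    ring

/-- The product of Hermite functions of the coordinates. -/
def hermiteFun (k : ι → ℕ) (z : ι → ℍ) (x : W) : ℂ :=
  ∏ i, hermiteGauss (k i) (z i) (E.basis.repr x i)

/-- The constant in the Fourier transform of `hermiteFun k z`. -/
def hermiteConst (k : ι → ℕ) (z : ι → ℍ) : ℂ :=
  ∏ i, ((-Complex.I * z i) ^ (1 / 2 : ℂ))⁻¹ * ((E.sign i * z i : ℂ) ^ k i)⁻¹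

theorem gaussBound_hermiteFun (k : ι → ℕ) (z : ι → ℍ) : E.basis.GaussBound (E.hermiteFun k z) := by
  obtain ⟨C, ε, hε, h⟩ := prod_hermiteGauss_bound k z
  exact ⟨C, ε, hε, fun x => h fun i => E.basis.repr x i⟩

theorem repr_equivFun_symm (t : ι → ℝ) (i : ι) :
    E.basis.repr (E.basis.equivFun.symm t) i = t i := by
  rw [← Module.Basis.equivFun_apply, LinearEquiv.apply_symm_apply]

theorem fourierPair_hermiteFun (k : ι → ℕ) (z : ι → ℍ) :
    E.FourierPair (E.hermiteFun k z) fun x =>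
      E.hermiteConst k z * E.hermiteFun k (fun i => ModularGroup.S • z i) x where
  cont := by
    simpa only [hermiteFun, repr_equivFun_symm] using continuous_prod_hermiteGauss k z
  bound := E.gaussBound_hermiteFun k z
  bound' := (E.gaussBound_hermiteFun k _).const_mul _
  eq w := by
    simp only [hermiteFun, repr_equivFun_symm, E.form_eq]
    exact integral_prod_hermiteGauss k z E.sign_eq fun i => E.basis.repr w i

end Grass.Frame

/-! ### Poisson summation for even lattices -/

namespace EvenLattice

theorem exists_equiv_int {V : Type*} [AddCommGroup V] [Module ℝ V] {ι : Type} [Fintype ι]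
    (b : Module.Basis ι ℝ V) (N : Submodule ℤ V) (hN : N = Submodule.span ℤ (Set.range b)) :
    ∃ e : (ι → ℤ) ≃ N, ∀ m, (e m : V) = b.equivFun.symm fun i => (m i : ℝ) := by
  refine ⟨((b.restrictScalars ℤ).equivFun.symm.trans (LinearEquiv.ofEq _ _ hN.symm)).toEquiv,
    fun m => ?_⟩
  simp [Module.Basis.equivFun_symm_apply, Int.cast_smul_eq_zsmul]

variable {V : Type*} [AddCommGroup V] [Module ℝ V] [FiniteDimensional ℝ V] (L : EvenLattice V)

theorem exists_lattice_bases {ι : Type} [Fintype ι] (e : Module.Basis ι ℝ V) :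
    ∃ (b b' : Module.Basis ι ℝ V) (f : (ι → ℤ) ≃ L.carrier) (f' : (ι → ℤ) ≃ L.dual),
      (∀ m, (f m : V) = b.equivFun.symm fun i => (m i : ℝ)) ∧
      (∀ m, (f' m : V) = b'.equivFun.symm fun i => (m i : ℝ)) ∧
      ∀ (m : ι → ℤ) (t : ι → ℝ), L.form (f' m) (b.equivFun.symm t) = ∑ i, m i * t i := by
  classical
  obtain ⟨n, b₀, hb₀⟩ := L.exists_basis
  -- Indexing the lattice basis like the given basis makes the change of coordinates an automorphism
  -- of ι → ℝ, which has a determinant.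
  let b := b₀.reindex (b₀.indexEquiv e)
  have hb : L.carrier = Submodule.span ℤ (Set.range b) := by
    rw [hb₀]; simp [b]
  let b' := L.form.dualBasis L.nondeg b
  have hd : L.dual = Submodule.span ℤ (Set.range b') := by
    rw [dual, hb]
    exact LinearMap.BilinForm.dualSubmodule_span_of_basis L.form L.nondeg b
  obtain ⟨f, hf⟩ := exists_equiv_int b L.carrier hb
  obtain ⟨f', hf'⟩ := exists_equiv_int b' L.dual hd
  refine ⟨b, b', f, f', hf, hf', fun m t => ?_⟩
  rw [hf', Module.Basis.equivFun_symm_apply, Module.Basis.equivFun_symm_apply]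
  simp only [map_sum, LinearMap.sum_apply, map_smul, LinearMap.smul_apply, smul_eq_mul, b',
    LinearMap.BilinForm.apply_dualBasis_left]
  simp [mul_comm]

theorem summable_of_gaussBound {ι : Type} [Fintype ι] {e : Module.Basis ι ℝ V} {f : V → ℂ}
    (hf : e.GaussBound f) : Summable fun x : L.dual => ‖f x‖ := by
  obtain ⟨b, b', g, g', hg, hg', -⟩ := L.exists_lattice_bases e
  obtain ⟨C, ε, hε, h⟩ := hf.of_basis b'
  rw [← g'.summable_iff]
  refine Summable.of_nonneg_of_le (fun _ => norm_nonneg _) (fun m => h _)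
    (((summable_exp_neg_sum_sq_int hε).mul_left C).congr fun m => ?_)
  rw [Module.Basis.sqNorm, hg']
  simp only [← Module.Basis.equivFun_apply, LinearEquiv.apply_symm_apply]

/-- Poisson summation on ℝⁿ in lattice coordinates, where the frequencies are the coordinates of
dual vectors. The constant is the Jacobian between lattice and frame coordinates; it is not computed
here, since `poisson` determines it indirectly. -/
theorem exists_poisson_const {v : L.Gr} {ι : Type} [Fintype ι] (E : v.Frame ι) :
    ∃ c : ℝ, 0 < c ∧ ∀ f g : V → ℂ, E.FourierPair f g → ∀ x : V,
      ∑' l : L.carrier, f (x + l) = c * ∑' l : L.dual, g l * expTwoPiI ((L.form l x : ℝ) : ℂ) := by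
  classical
  obtain ⟨b, b', e, e', he, he', hform⟩ := L.exists_lattice_bases E.basis
  let A : (ι → ℝ) ≃ₗ[ℝ] (ι → ℝ) := b.equivFun.symm.trans E.basis.equivFun
  have hdet : LinearMap.det (A : (ι → ℝ) →ₗ[ℝ] (ι → ℝ)) ≠ 0 := (LinearEquiv.isUnit_det' A).ne_zero
  have hA : ∀ t, E.basis.equivFun.symm (A t) = b.equivFun.symm t := fun t => by simp [A]
  refine ⟨|(LinearMap.det (A : (ι → ℝ) →ₗ[ℝ] (ι → ℝ)))⁻¹|, by positivity, fun f g h x => ?_⟩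
  have hAc : Continuous A := A.toLinearMap.continuous_of_finiteDimensional
  have hint : ∀ H : (ι → ℝ) → ℂ, ∫ t, H (A t)
      = |(LinearMap.det (A : (ι → ℝ) →ₗ[ℝ] (ι → ℝ)))⁻¹| * ∫ t, H t := by
    intro H
    have h1 := Measure.map_linearMap_addHaar_pi_eq_smul_addHaar hdet
      (volume : Measure (ι → ℝ))
    have h2 := (A.toContinuousLinearEquiv.toHomeomorph.measurableEmbedding).integral_map
      (μ := volume) H
    have h3 : (⇑A.toContinuousLinearEquiv.toHomeomorph : (ι → ℝ) → ι → ℝ)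
      = ⇑(A : (ι → ℝ) →ₗ[ℝ] (ι → ℝ)) := rfl
    rw [h3, h1, integral_smul_measure, ENNReal.toReal_ofReal (abs_nonneg _)] at h2
    rw [← Complex.real_smul]
    exact h2.symm
  have hcont : Continuous fun t : ι → ℝ => f (b.equivFun.symm t) := by
    simpa only [Function.comp_def, hA] using h.cont.comp hAc
  obtain ⟨C, ε, hε, hb⟩ := h.bound.of_basis b
  have hb2 : ∀ t : ι → ℝ, ‖f (b.equivFun.symm t)‖ ≤ C * Real.exp (-ε * ∑ i, t i ^ 2) := by
    intro t
    refine (hb _).trans (le_of_eq ?_)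
    rw [Module.Basis.sqNorm]
    simp only [← Module.Basis.equivFun_apply, LinearEquiv.apply_symm_apply]
  have hcoef : ∀ m : ι → ℤ, ∫ t : ι → ℝ, f (b.equivFun.symm t) *
      expTwoPiI (-(∑ i, (m i : ℂ) * t i))
      = |(LinearMap.det (A : (ι → ℝ) →ₗ[ℝ] (ι → ℝ)))⁻¹| * g (e' m) := by
    intro m
    rw [← h.eq, ← hint]
    refine integral_congr_ae (ae_of_all _ fun t => ?_)
    simp only [hA]
    have hs : L.form (b.equivFun.symm t) (e' m) = ∑ i, m i * t i := by
      rw [← hform]; exact L.symm.eq _ _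
    rw [hs]
    push_cast
    rfl
  have hsum : Summable fun m : ι → ℤ => g (e' m) :=
    (e'.summable_iff (f := fun l : L.dual => g l)).2
      (L.summable_of_gaussBound h.bound').of_norm
  have hP := tsum_int_translate_eq_tsum_fourier hcont hε hb2
    (by simpa only [hcoef] using hsum.mul_left _) (b.equivFun x)
  simp only [hcoef] at hP
  rw [← e.tsum_eq, ← e'.tsum_eq, ← tsum_mul_left]
  refine Eq.trans (tsum_congr fun m => ?_) (hP.trans (tsum_congr fun m => ?_))
  · rw [he, map_add, LinearEquiv.symm_apply_apply]
  · have := hform m (b.equivFun x)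
    rw [LinearEquiv.symm_apply_apply] at this
    rw [this, mul_assoc]
    push_cast
    rfl

/-- The sum of `f` over the coset `γ` of `L` in `L^*`. -/
def cosetSum (f : V → ℂ) (γ : L.Disc) : ℂ := ∑' x : L.dual, if L.toDisc x = γ then f x else 0

theorem indicator_toDisc (f : L.dual → ℂ) (γ : L.Disc) (x : L.dual) :
    {x | L.toDisc x = γ}.indicator f x = if L.toDisc x = γ then f x else 0 := by
  rw [Set.indicator_apply]
  exact if_congr Iff.rfl rfl rfl

theorem tsum_mul_toDisc {f : V → ℂ} (hf : Summable fun x : L.dual => f x) (φ : L.Disc → ℂ) :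
    ∑' x : L.dual, φ (L.toDisc x) * f x = ∑ γ, φ γ * L.cosetSum f γ := by
  have h : ∀ x : L.dual, φ (L.toDisc x) * f x
      = ∑ γ, φ γ * if L.toDisc x = γ then f x else 0 := by
    intro x
    rw [Finset.sum_eq_single (L.toDisc x)]
    · rw [if_pos rfl]
    · intro γ _ hγ
      rw [if_neg hγ.symm, mul_zero]
    · simp
  have hs : ∀ γ, Summable fun x : L.dual => if L.toDisc x = γ then f x else 0 := fun γ =>
    (hf.indicator {x | L.toDisc x = γ}).congr fun x => L.indicator_toDisc _ γ x
  simp only [h]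
  rw [Summable.tsum_finsetSum fun γ _ => (hs γ).mul_left _]
  simp only [tsum_mul_left, cosetSum]

/-- The coset of `x` is the translate of `L` by `x`. -/
def equivCoset (x : L.dual) : L.carrier ≃ {y : L.dual // L.toDisc y = L.toDisc x} where
  toFun l := ⟨x + ⟨l, L.carrier_le_dual l.2⟩, by
    rw [map_add, add_eq_left]
    exact (Submodule.Quotient.mk_eq_zero _).2 l.2⟩
  invFun y := ⟨(y.1 : V) - x, (Submodule.Quotient.eq (L.carrier.submoduleOf L.dual)).1 y.2⟩
  left_inv l := by ext; simp
  right_inv y := by ext; simp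

theorem cosetSum_toDisc (f : V → ℂ) (x : L.dual) :
    L.cosetSum f (L.toDisc x) = ∑' l : L.carrier, f (x + l) := by
  have h := tsum_subtype {y : L.dual | L.toDisc y = L.toDisc x} fun y : L.dual => f y
  have h2 := (L.equivCoset x).tsum_eq fun y => f (y.1 : L.dual)
  rw [cosetSum]
  refine Eq.trans (tsum_congr fun y => ?_) (h.symm.trans h2.symm)
  exact (L.indicator_toDisc (fun y => f y) (L.toDisc x) y).symm

theorem exists_poisson {v : L.Gr} {ι : Type} [Fintype ι] (E : v.Frame ι) :
    ∃ c : ℝ, 0 < c ∧ ∀ f g : V → ℂ, E.FourierPair f g → ∀ γ : L.Disc,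
      L.cosetSum f γ = c * ∑ δ, L.ePair γ δ * L.cosetSum g δ := by
  obtain ⟨c, hc, h⟩ := L.exists_poisson_const E
  refine ⟨c, hc, fun f g hfg γ => ?_⟩
  obtain ⟨x, rfl⟩ := Submodule.mkQ_surjective _ γ
  rw [L.cosetSum_toDisc, h f g hfg, ← L.tsum_mul_toDisc
    (L.summable_of_gaussBound hfg.bound').of_norm]
  congr 1
  refine tsum_congr fun l => ?_
  rw [L.ePair_comm, L.ePair_toDisc, mul_comm]

end EvenLattice

/-! ### The Gaussian of a frame and the Poisson constant -/

namespace Grass.Frame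

variable {W : Type*} [AddCommGroup W] [Module ℝ W] [FiniteDimensional ℝ W]
  {B : LinearMap.BilinForm ℝ W} {v : Grass B} {ι : Type} [Fintype ι] (E : v.Frame ι)

/-- The self-dual Gaussian `exp (-π |x|²)`. -/
def gaussian : W → ℂ := E.hermiteFun 0 fun _ => UpperHalfPlane.I

theorem gaussian_eq (x : W) : E.gaussian x = (Real.exp (-Real.pi * E.basis.sqNorm x) : ℝ) := by
  rw [gaussian, hermiteFun, Module.Basis.sqNorm, Finset.mul_sum, Real.exp_sum]
  push_cast
  refine Finset.prod_congr rfl fun i _ => ?_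
  rw [Pi.zero_apply, hermiteGauss_zero]
  simp only [expTwoPiI]
  congr 1
  rw [UpperHalfPlane.coe_I]
  linear_combination (Real.pi : ℂ) * ((E.basis.repr x i : ℝ) : ℂ) ^ 2 * Complex.I_sq

theorem gaussian_neg (x : W) : E.gaussian (-x) = E.gaussian x := by
  simp [gaussian_eq, Module.Basis.sqNorm]

theorem S_smul_I : ModularGroup.S • UpperHalfPlane.I = UpperHalfPlane.I := by
  ext
  rw [UpperHalfPlane.modular_S_smul]
  simp [inv_neg]

theorem hermiteConst_zero_I : E.hermiteConst 0 (fun _ => UpperHalfPlane.I) = 1 := by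
  simp [hermiteConst]

theorem fourierPair_gaussian : E.FourierPair E.gaussian E.gaussian := by
  have h := E.fourierPair_hermiteFun 0 fun _ => UpperHalfPlane.I
  simpa only [hermiteConst_zero_I, one_mul, S_smul_I] using! h

end Grass.Frame

namespace EvenLattice

variable {V : Type*} [AddCommGroup V] [Module ℝ V] [FiniteDimensional ℝ V] (L : EvenLattice V)

theorem cosetSum_neg (f : V → ℂ) (γ : L.Disc) :
    L.cosetSum f (-γ) = L.cosetSum (fun x => f (-x)) γ := by
  rw [cosetSum, cosetSum, ← (Equiv.neg L.dual).tsum_eq]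
  refine tsum_congr fun x => ?_
  rw [Equiv.neg_apply, map_neg]
  simp only [neg_inj, Submodule.coe_neg]

theorem cosetSum_sub (f : V → ℂ) (γ : L.Disc) (a : L.dual) :
    L.cosetSum (fun x => f (x - a)) γ = L.cosetSum f (γ - L.toDisc a) := by
  obtain ⟨x, rfl⟩ := Submodule.mkQ_surjective _ γ
  rw [L.cosetSum_toDisc, ← map_sub, L.cosetSum_toDisc]
  refine tsum_congr fun l => ?_
  congr 1
  push_cast
  abel

theorem cosetSum_mul_expTwoPiI (f : V → ℂ) (γ : L.Disc) (a : L.dual) :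
    L.cosetSum (fun x => f x * expTwoPiI ((L.form a x : ℝ) : ℂ)) γ
      = L.ePair (L.toDisc a) γ * L.cosetSum f γ := by
  rw [cosetSum, cosetSum, ← tsum_mul_left]
  refine tsum_congr fun x => ?_
  split_ifs with h
  · rw [← h, L.ePair_toDisc, mul_comm]
  · rw [mul_zero]

theorem cosetSum_const_mul (c : ℂ) (f : V → ℂ) (γ : L.Disc) :
    L.cosetSum (fun x => c * f x) γ = c * L.cosetSum f γ := by
  rw [cosetSum, cosetSum, ← tsum_mul_left]
  exact tsum_congr fun x => by split_ifs <;> simp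

/-- All terms are positive reals. This permits division by theta values of a single coset. -/
theorem cosetSum_gaussian_ne_zero {v : L.Gr} {ι : Type} [Fintype ι] (E : v.Frame ι) (γ : L.Disc) :
    L.cosetSum E.gaussian γ ≠ 0 := by
  obtain ⟨x, rfl⟩ := Submodule.mkQ_surjective _ γ
  have hs := (L.summable_of_gaussBound E.fourierPair_gaussian.bound)
  have hs' : Summable fun l : L.carrier => Real.exp (-Real.pi * E.basis.sqNorm (x + l)) := by
    have := (hs.comp_injective (i := fun l : L.carrier => ((L.equivCoset x l).1 : L.dual))
      (Subtype.val_injective.comp (L.equivCoset x).injective))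
    refine this.congr fun l => ?_
    simp only [Function.comp_apply, E.gaussian_eq, Complex.norm_real, Real.norm_eq_abs,
      Real.abs_exp]
    rfl
  rw [L.cosetSum_toDisc]
  simp only [E.gaussian_eq]
  rw [← Complex.ofReal_tsum]
  exact_mod_cast (hs'.tsum_pos (fun _ => (Real.exp_pos _).le) 0 (Real.exp_pos _)).ne'

theorem sum_ePair_mul_ePair (γ ε : L.Disc) :
    ∑ δ, L.ePair γ δ * L.ePair δ ε = if γ + ε = 0 then (Fintype.card L.Disc : ℂ) else 0 := by
  rw [← L.sum_ePair]
  refine Finset.sum_congr rfl fun δ _ => ?_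
  rw [L.ePair_comm δ (γ + ε), L.ePair_add_left, L.ePair_comm δ ε]

theorem ePair_neg_left (a b : L.Disc) : L.ePair (-a) b = (L.ePair a b)⁻¹ := by
  have h := L.ePair_add_left (-a) a b
  rw [neg_add_cancel, L.ePair_zero_left] at h
  exact eq_inv_of_mul_eq_one_left h.symm

/-- Inversion of the Fourier transform on D_L: orthogonality of characters recovers |D_L| A(δ₀) from
the transform of A. -/
theorem eq_of_sum_ePair_eq {A A' : L.Disc → ℂ}
    (h : ∀ α, ∑ δ, L.ePair α δ * A δ = ∑ δ, L.ePair α δ * A' δ) : A = A' := by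
  have hcard : (Fintype.card L.Disc : ℂ) ≠ 0 := by exact_mod_cast Fintype.card_ne_zero
  have key : ∀ (A : L.Disc → ℂ) (δ₀ : L.Disc),
      ∑ α, L.ePair (-δ₀) α * ∑ δ, L.ePair α δ * A δ = Fintype.card L.Disc * A δ₀ := by
    intro A δ₀
    simp only [Finset.mul_sum, ← mul_assoc]
    rw [Finset.sum_comm]
    simp only [← Finset.sum_mul, L.sum_ePair_mul_ePair]
    rw [Finset.sum_eq_single δ₀]
    · simp
    · intro δ _ hδ
      rw [if_neg, zero_mul]
      intro h0
      exact hδ (neg_add_eq_zero.1 h0).symm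
    · simp
  funext δ₀
  apply mul_left_cancel₀ hcard
  rw [← key, ← key]
  simp only [h]

/-- Applying `exists_poisson` twice to the self-dual Gaussian at the zero class gives c² |D_L| = 1,
because the sum there is nonzero; positivity of c fixes the root. -/
theorem poisson {v : L.Gr} {ι : Type} [Fintype ι] (E : v.Frame ι) {f g : V → ℂ}
    (hfg : E.FourierPair f g) (γ : L.Disc) :
    L.cosetSum f γ
      = ((Real.sqrt (Fintype.card L.Disc))⁻¹ : ℝ) * ∑ δ, L.ePair γ δ * L.cosetSum g δ := by
  obtain ⟨c, hc, h⟩ := L.exists_poisson E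
  have h1 := h _ _ E.fourierPair_gaussian
  have h4 : L.cosetSum E.gaussian 0
      = (c : ℂ) ^ 2 * Fintype.card L.Disc * L.cosetSum E.gaussian 0 := by
    have h2 : L.cosetSum E.gaussian 0 = c * ∑ γ, L.ePair 0 γ *
        (c * ∑ δ, L.ePair γ δ * L.cosetSum E.gaussian δ) := by
      rw [h1 0]
      exact congrArg _ (Finset.sum_congr rfl fun γ _ => by rw [h1 γ])
    have h3 : ∀ δ : L.Disc, ∑ γ, (c : ℂ) * (L.ePair 0 γ *
        (c * (L.ePair γ δ * L.cosetSum E.gaussian δ)))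
        = (c : ℂ) ^ 2 * (if δ = 0 then (Fintype.card L.Disc : ℂ) else 0) *
            L.cosetSum E.gaussian δ := by
      intro δ
      have := L.sum_ePair_mul_ePair 0 δ
      rw [zero_add] at this
      rw [← this, Finset.mul_sum, Finset.sum_mul]
      exact Finset.sum_congr rfl fun γ _ => by ring
    refine h2.trans ?_
    simp only [Finset.mul_sum]
    rw [Finset.sum_comm, Finset.sum_congr rfl fun δ _ => h3 δ]
    simp
  have h5 : (c : ℂ) ^ 2 * Fintype.card L.Disc = 1 :=
    mul_right_cancel₀ (L.cosetSum_gaussian_ne_zero E 0) (by rw [one_mul]; exact h4.symm)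
  have h6 : c ^ 2 * Fintype.card L.Disc = 1 := by exact_mod_cast h5
  have h7 : c = (Real.sqrt (Fintype.card L.Disc))⁻¹ := by
    have hpos : (0 : ℝ) < Fintype.card L.Disc := by exact_mod_cast Fintype.card_pos
    rw [← Real.sqrt_inv, ← eq_inv_of_mul_eq_one_left h6, Real.sqrt_sq hc.le]
  rw [h _ _ hfg, h7]

end EvenLattice

/-! ### Sums over `L^*/M` -/

namespace PrimitiveSublattice

variable {V : Type*} [AddCommGroup V] [Module ℝ V] [FiniteDimensional ℝ V] {L : EvenLattice V}
  (M : PrimitiveSublattice L)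

/-- The sum of `G (x_{M^⊥})` over the `x ∈ L^*/M` with classes `γ` and `δ`. -/
def fiberSum (G : M.perp → ℂ) (γ : L.Disc) (δ : M.toLattice.Disc) : ℂ :=
  ∑' x : L.dual ⧸ M.inDual,
    if (M.quotToDisc x, M.quotToSubDisc x) = (γ, δ) then G (M.quotToPerp x) else 0

theorem mk_eq_mk_iff {x y : L.dual} :
    M.inDual.mkQ x = M.inDual.mkQ y ↔ (x - y : V) ∈ M.carrier :=
  Submodule.Quotient.eq M.inDual

theorem quotToDisc_mk (x : L.dual) : M.quotToDisc (M.inDual.mkQ x) = L.toDisc x := rfl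

theorem quotToSubDisc_mk (x : L.dual) :
    M.quotToSubDisc (M.inDual.mkQ x) = M.toLattice.toDisc (M.dualProj x) := rfl

theorem quotToPerp_mk (x : L.dual) : M.quotToPerp (M.inDual.mkQ x) = M.projPerp x := rfl

theorem dualProj_coe (x : L.dual) : (M.dualProj x : M.real) = M.projReal x := rfl

theorem projReal_coe (x : M.real) : M.projReal x = x :=
  Submodule.projectionOnto_apply_left M.isCompl x

theorem projPerp_coe_real (x : M.real) : M.projPerp (x : V) = 0 :=
  (Submodule.projectionOnto_apply_eq_zero_iff M.isCompl.symm).2 x.2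

/-- The vectors of `L^*` in a class of `L^*/M` are parametrised by their projections to `M^*`. -/
theorem fiber_bijective (x : L.dual ⧸ M.inDual) : Function.Bijective
    fun l : {l : L.dual // M.inDual.mkQ l = x} =>
      (⟨M.dualProj l, by rw [← M.quotToSubDisc_mk, l.2]⟩ :
        {m : M.toLattice.dual // M.toLattice.toDisc m = M.quotToSubDisc x}) := by
  constructor
  · rintro ⟨l, hl⟩ ⟨l', hl'⟩ h
    have h1 : M.dualProj l = M.dualProj l' := congrArg Subtype.val h
    have h2 : M.projReal (l : V) = M.projReal l' := congrArg Subtype.val h1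
    have h3 := (M.mk_eq_mk_iff).1 (hl.trans hl'.symm)
    have h4 := M.projReal_coe ⟨_, Submodule.subset_span h3⟩
    simp only [map_sub, h2, sub_self] at h4
    have h5 : (0 : V) = l - l' := congrArg Subtype.val h4
    exact Subtype.ext (Subtype.ext (sub_eq_zero.1 h5.symm))
  · rintro ⟨m, hm⟩
    obtain ⟨l, rfl⟩ := Submodule.mkQ_surjective _ x
    rw [M.quotToSubDisc_mk] at hm
    have h1 : ((m - M.dualProj l : M.real) : V) ∈ M.carrier :=
      (Submodule.Quotient.eq (M.toLattice.carrier.submoduleOf M.toLattice.dual)).1 hm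
    let l' : L.dual := l + ⟨_, L.carrier_le_dual (M.le h1)⟩
    refine ⟨⟨l', ?_⟩, ?_⟩
    · rw [M.mk_eq_mk_iff]
      simpa [l'] using h1
    · apply Subtype.ext
      apply Subtype.ext
      change M.projReal (l' : V) = m
      have h2 : (l' : V) = l + ((m - M.dualProj l : M.real) : V) := rfl
      rw [h2, map_add, M.projReal_coe, M.dualProj_coe]
      abel

variable {u : M.toLattice.Gr} {w : M.PerpGr} {ι κ : Type} [Fintype ι] [Fintype κ]
  (E : u.Frame ι) (E' : w.Frame κ)

theorem sqNorm_directSumFrame (x : V) : (M.directSumFrame E E').basis.sqNorm x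
    = E.basis.sqNorm (M.projReal x) + E'.basis.sqNorm (M.projPerp x) := by
  simp only [Module.Basis.sqNorm, Fintype.sum_sum_type, directSumFrame_repr_inl,
    directSumFrame_repr_inr]

theorem gaussBound_tensor {H : M.real → ℂ} {G : M.perp → ℂ} (hH : E.basis.GaussBound H)
    (hG : E'.basis.GaussBound G) : (M.directSumFrame E E').basis.GaussBound
      fun x => H (M.projReal x) * G (M.projPerp x) := by
  obtain ⟨C, ε, hε, hC⟩ := hH
  obtain ⟨D, η, hη, hD⟩ := hG
  refine ⟨|C| * |D|, min ε η, lt_min hε hη, fun x => ?_⟩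
  rw [norm_mul, M.sqNorm_directSumFrame, mul_add, Real.exp_add, mul_mul_mul_comm]
  refine mul_le_mul ((hC _).trans ?_) ((hD _).trans ?_) (norm_nonneg _) (by positivity)
  · refine mul_le_mul (le_abs_self C) (Real.exp_le_exp.2 ?_) (Real.exp_pos _).le (abs_nonneg _)
    exact mul_le_mul_of_nonneg_right (neg_le_neg (min_le_left _ _)) (E.basis.sqNorm_nonneg _)
  · refine mul_le_mul (le_abs_self D) (Real.exp_le_exp.2 ?_) (Real.exp_pos _).le (abs_nonneg _)
    exact mul_le_mul_of_nonneg_right (neg_le_neg (min_le_right _ _)) (E'.basis.sqNorm_nonneg _)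

theorem nonempty_gr : Nonempty M.toLattice.Gr :=
  Grass.nonempty_of_nondegenerate M.toLattice.symm M.toLattice.nondeg

/-- Lift each class of L^*/M to a vector of L^* whose M_ℝ-component is one of the finitely many
chosen representatives of D_M. A Gaussian on M_ℝ is bounded below by some r > 0 on these, so the sum
is dominated by r⁻¹ times a convergent sum over L^*. -/
theorem summable_quotToPerp {G : M.perp → ℂ} (hG : E'.basis.GaussBound G) :
    Summable fun x : L.dual ⧸ M.inDual => ‖G (M.quotToPerp x)‖ := by
  obtain ⟨u⟩ := M.nonempty_gr
  obtain ⟨n, m, ⟨E⟩⟩ := u.exists_frame M.toLattice.symm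
  have hs := L.summable_of_gaussBound
    (M.gaussBound_tensor E E' E.fourierPair_gaussian.bound hG)
  have hsec : ∀ x : L.dual ⧸ M.inDual, ∃ l : L.dual, M.inDual.mkQ l = x ∧
      M.dualProj l = (M.quotToSubDisc x).out := by
    intro x
    obtain ⟨⟨l, hl⟩, h⟩ := (M.fiber_bijective x).2 ⟨(M.quotToSubDisc x).out, Quotient.out_eq _⟩
    exact ⟨l, hl, congrArg Subtype.val h⟩
  choose s hs1 hs2 using hsec
  have hinj : Function.Injective s := fun x y h => by rw [← hs1 x, ← hs1 y, h]
  have hs3 := hs.comp_injective hinj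
  obtain ⟨δ₀, -, hδ₀⟩ := Finset.univ.exists_min_image
    (fun δ : M.toLattice.Disc => Real.exp (-Real.pi * E.basis.sqNorm (δ.out : M.toLattice.dual)))
    Finset.univ_nonempty
  set r := Real.exp (-Real.pi * E.basis.sqNorm (δ₀.out : M.toLattice.dual)) with hr
  have hr0 : 0 < r := Real.exp_pos _
  refine Summable.of_nonneg_of_le (fun _ => norm_nonneg _) (fun x => ?_) (hs3.mul_left r⁻¹)
  have h1 : M.projReal (s x : V) = ((M.quotToSubDisc x).out : M.toLattice.dual) :=
    congrArg Subtype.val (hs2 x)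
  have h2 : M.projPerp (s x : V) = M.quotToPerp x := by
    rw [← M.quotToPerp_mk, hs1]
  simp only [Function.comp_apply, norm_mul, h1, h2, E.gaussian_eq, Complex.norm_real,
    Real.norm_eq_abs, Real.abs_exp]
  rw [← mul_assoc]
  refine le_mul_of_one_le_left (norm_nonneg _) ?_
  rw [inv_mul_eq_div, one_le_div hr0]
  exact hδ₀ _ (Finset.mem_univ _)

/-- Sum along the fibres of L^* → L^*/M. On a fibre the factor G is constant, and by
`fiber_bijective` the factor H runs over one coset of M in M^*. The splitting of Θ_L and the
S-transformation of Θ_{L,M} both rest on this. -/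
theorem cosetSum_tensor {H : M.real → ℂ} {G : M.perp → ℂ} (hH : E.basis.GaussBound H)
    (hG : E'.basis.GaussBound G) (γ : L.Disc) :
    L.cosetSum (fun x => H (M.projReal x) * G (M.projPerp x)) γ
      = ∑ δ, M.fiberSum G γ δ * M.toLattice.cosetSum H δ := by
  have hs := (L.summable_of_gaussBound (M.gaussBound_tensor E E' hH hG)).of_norm
  have hs1 : Summable fun l : L.dual =>
      if L.toDisc l = γ then H (M.projReal l) * G (M.projPerp l) else 0 :=
    (hs.indicator {l | L.toDisc l = γ}).congr fun l => L.indicator_toDisc _ γ l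
  let e := Equiv.sigmaFiberEquiv (fun l : L.dual => M.inDual.mkQ l)
  have hinner : ∀ x : L.dual ⧸ M.inDual, ∑' l : {l : L.dual // M.inDual.mkQ l = x},
      (if L.toDisc l.1 = γ then H (M.projReal (l.1 : V)) * G (M.projPerp (l.1 : V)) else 0)
      = (if M.quotToDisc x = γ then G (M.quotToPerp x) else 0) *
          M.toLattice.cosetSum H (M.quotToSubDisc x) := by
    intro x
    have h1 : M.toLattice.cosetSum H (M.quotToSubDisc x)
        = ∑' l : {l : L.dual // M.inDual.mkQ l = x}, H (M.projReal (l.1 : V)) := by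
      have h2 := tsum_subtype {m : M.toLattice.dual | M.toLattice.toDisc m = M.quotToSubDisc x}
        fun m : M.toLattice.dual => H m
      have h3 := (Equiv.ofBijective _ (M.fiber_bijective x)).tsum_eq
        fun m : {m : M.toLattice.dual // M.toLattice.toDisc m = M.quotToSubDisc x} =>
          H (m.1 : M.toLattice.dual)
      rw [EvenLattice.cosetSum]
      refine Eq.trans (tsum_congr fun m => ?_) (h2.symm.trans h3.symm)
      exact (M.toLattice.indicator_toDisc (fun m => H m) _ m).symm
    rw [h1, ← tsum_mul_left]
    refine tsum_congr fun l => ?_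
    obtain ⟨l, rfl⟩ := l
    rw [M.quotToDisc_mk, M.quotToPerp_mk]
    split_ifs <;> ring
  refine (e.tsum_eq _).symm.trans ((Summable.tsum_sigma (e.summable_iff.2 hs1)).trans
    ((tsum_congr fun x => hinner x).trans ?_))
  have hsd : ∀ δ, Summable fun x : L.dual ⧸ M.inDual =>
      if (M.quotToDisc x, M.quotToSubDisc x) = (γ, δ) then G (M.quotToPerp x) else 0 := by
    intro δ
    refine Summable.of_norm_bounded (M.summable_quotToPerp E' hG) fun x => ?_
    split_ifs
    · exact le_rfl
    · simp
  simp only [fiberSum, ← tsum_mul_right]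
  rw [← Summable.tsum_finsetSum fun δ _ => (hsd δ).mul_right _]
  refine tsum_congr fun x => ?_
  rw [Finset.sum_eq_single (M.quotToSubDisc x)]
  · simp only [Prod.mk.injEq, and_true]
  · intro δ _ hδ
    rw [if_neg fun h => hδ (congrArg Prod.snd h).symm, zero_mul]
  · simp

theorem form_coe_left (a : M.real) (x : V) : L.form a x = L.form a (M.projReal x) := by
  conv_lhs => rw [← M.projReal_add_projPerp x]
  rw [map_add, M.form_real_perp, add_zero]

theorem hermiteFun_directSumFrame (k : ι → ℕ) (k' : κ → ℕ) (z : ι → ℍ) (z' : κ → ℍ) (x : V) :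
    (M.directSumFrame E E').hermiteFun (Sum.elim k k') (Sum.elim z z') x
      = E.hermiteFun k z (M.projReal x) * E'.hermiteFun k' z' (M.projPerp x) := by
  simp only [Grass.Frame.hermiteFun, Fintype.prod_sum_type, directSumFrame_repr_inl,
    directSumFrame_repr_inr, Sum.elim_inl, Sum.elim_inr]

theorem hermiteConst_directSumFrame (k : ι → ℕ) (k' : κ → ℕ) (z : ι → ℍ) (z' : κ → ℍ) :
    (M.directSumFrame E E').hermiteConst (Sum.elim k k') (Sum.elim z z')
      = E.hermiteConst k z * E'.hermiteConst k' z' := by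
  simp only [Grass.Frame.hermiteConst, Fintype.prod_sum_type, Sum.elim_inl, Sum.elim_inr]
  rfl

/-- The transformation of Θ_{L,M} under S, monomial by monomial. The function is multiplied by a
self-dual Gaussian on M_ℝ twisted by a ∈ M^*, and Poisson summation for L is split along M on both
sides. This yields one identity for each class of a; together they determine every component. -/
theorem fiberSum_hermiteFun (k : κ → ℕ) (z : κ → ℍ) (γ : L.Disc) (δ : M.toLattice.Disc) :
    M.fiberSum (E'.hermiteFun k z) γ δ
      = (((Real.sqrt (Fintype.card L.Disc))⁻¹ : ℝ) : ℂ) *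
          (((Real.sqrt (Fintype.card M.toLattice.Disc))⁻¹ : ℝ) : ℂ) * E'.hermiteConst k z *
        ∑ γ', ∑ δ', L.ePair γ γ' * (M.toLattice.ePair δ δ')⁻¹ *
          M.fiberSum (E'.hermiteFun k fun i => ModularGroup.S • z i) γ' δ' := by
  obtain ⟨u⟩ := M.nonempty_gr
  obtain ⟨n, m, ⟨E⟩⟩ := u.exists_frame M.toLattice.symm
  set cL : ℂ := (((Real.sqrt (Fintype.card L.Disc))⁻¹ : ℝ) : ℂ)
  set cM : ℂ := (((Real.sqrt (Fintype.card M.toLattice.Disc))⁻¹ : ℝ) : ℂ)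
  set C := E'.hermiteConst k z
  set G := E'.hermiteFun k z
  set G' := E'.hermiteFun k fun i => ModularGroup.S • z i
  have hG : E'.basis.GaussBound G := E'.gaussBound_hermiteFun k z
  have hG' : E'.basis.GaussBound G' := E'.gaussBound_hermiteFun k _
  let θ := M.toLattice.cosetSum E.gaussian
  have hθ : ∀ δ, θ δ ≠ 0 := fun δ => M.toLattice.cosetSum_gaussian_ne_zero E δ
  have hθneg : ∀ δ, θ (-δ) = θ δ := fun δ => by
    simp only [θ, EvenLattice.cosetSum_neg, E.gaussian_neg]
  have hpair : (M.directSumFrame E E').FourierPair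
      (fun x => E.gaussian (M.projReal x) * G (M.projPerp x))
      (fun x => C * (E.gaussian (M.projReal x) * G' (M.projPerp x))) := by
    have h := (M.directSumFrame E E').fourierPair_hermiteFun (Sum.elim 0 k)
      (Sum.elim (fun _ => UpperHalfPlane.I) z)
    have h1 : (fun i => ModularGroup.S •
        (Sum.elim (fun _ => UpperHalfPlane.I) z : (Fin n ⊕ Fin m) ⊕ κ → ℍ) i)
        = Sum.elim (fun _ => UpperHalfPlane.I) fun i => ModularGroup.S • z i := by
      ext1 i
      rcases i with i | i
      · exact Grass.Frame.S_smul_I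
      · rfl
    rw [h1, hermiteConst_directSumFrame, Grass.Frame.hermiteConst_zero_I, one_mul] at h
    convert h using 1
    · funext x
      exact (M.hermiteFun_directSumFrame E E' 0 k _ z x).symm
    · funext x
      rw [M.hermiteFun_directSumFrame E E']
      rfl
  -- With θ the theta values of the Gaussian over the cosets of M, both sides are Fourier transforms
  -- on D_M in the twisting class α.
  have key : ∀ α, ∑ δ, M.toLattice.ePair α δ * (M.fiberSum G γ δ * θ δ)
      = ∑ δ, M.toLattice.ePair α δ * (cL * cM * C * (∑ γ', ∑ δ', L.ePair γ γ' *
          (M.toLattice.ePair δ δ')⁻¹ * M.fiberSum G' γ' δ') * θ δ) := by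
    intro α
    obtain ⟨a, rfl⟩ := Submodule.mkQ_surjective _ α
    have h1 := L.poisson _ (Grass.Frame.FourierPair.twist _ L.symm hpair ((a : M.real) : V)) γ
    have h2 : ∀ x : V, E.gaussian (M.projReal x) * G (M.projPerp x) *
        expTwoPiI ((L.form ((a : M.real) : V) x : ℝ) : ℂ)
        = (E.gaussian (M.projReal x) *
            expTwoPiI ((M.toLattice.form a (M.projReal x) : ℝ) : ℂ)) * G (M.projPerp x) := by
      intro x
      rw [M.form_coe_left]
      change _ = (_ * expTwoPiI ((L.form ((a : M.real) : V) (M.projReal x) : ℝ) : ℂ)) * _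
      ring
    have h3 : ∀ x : V, C * (E.gaussian (M.projReal (x - ((a : M.real) : V))) *
        G' (M.projPerp (x - ((a : M.real) : V))))
        = C * (E.gaussian (M.projReal x - a) * G' (M.projPerp x)) := by
      intro x
      rw [map_sub, map_sub, M.projReal_coe, M.projPerp_coe_real, sub_zero]
    simp only [h2, h3] at h1
    have hb1 : E.basis.GaussBound fun x =>
        E.gaussian x * expTwoPiI ((M.toLattice.form a x : ℝ) : ℂ) :=
      E.fourierPair_gaussian.bound.mul_of_norm_le_one fun x => (norm_expTwoPiI_ofReal _).le
    have hb2 : E.basis.GaussBound fun x => E.gaussian (x - a) := by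
      simpa only [sub_eq_add_neg] using E.fourierPair_gaussian.bound.comp_add_right (-(a : M.real))
    rw [M.cosetSum_tensor E E' hb1 hG] at h1
    simp only [L.cosetSum_const_mul, M.cosetSum_tensor E E' hb2 hG',
      M.toLattice.cosetSum_mul_expTwoPiI, M.toLattice.cosetSum_sub] at h1
    refine Eq.trans (Finset.sum_congr rfl fun δ _ => ?_) (h1.trans ?_)
    · change _ = _ * (_ * θ δ)
      ring
    -- The twist has translated the Gaussian by -a. Poisson summation for M, with the evenness of θ,
    -- turns the translation back into the character of a.
    have h4 : ∀ δ', M.toLattice.cosetSum E.gaussian (δ' - M.toLattice.toDisc a)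
        = cM * ∑ δ, M.toLattice.ePair (M.toLattice.toDisc a) δ *
            (M.toLattice.ePair δ δ')⁻¹ * θ δ := by
      intro δ'
      rw [M.toLattice.poisson E E.fourierPair_gaussian, ← Equiv.sum_comp (Equiv.neg M.toLattice.Disc)]
      congr 1
      refine Finset.sum_congr rfl fun δ _ => ?_
      change _ * θ (-δ) = _
      rw [hθneg, Equiv.neg_apply, sub_eq_add_neg, M.toLattice.ePair_add_left,
        M.toLattice.ePair_comm _ (-δ), M.toLattice.ePair_comm _ (-δ),
        M.toLattice.ePair_neg_left, M.toLattice.ePair_neg_left,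
        M.toLattice.ePair_comm δ (-_), M.toLattice.ePair_neg_left, inv_inv]
      ring
    simp only [h4, Finset.mul_sum, Finset.sum_mul]
    rw [Finset.sum_comm (s := Finset.univ (α := M.toLattice.Disc))
      (t := Finset.univ (α := L.Disc))]
    refine Finset.sum_congr rfl fun γ' _ => ?_
    rw [Finset.sum_comm]
    refine Finset.sum_congr rfl fun δ _ => Finset.sum_congr rfl fun δ' _ => ?_
    ring
  -- Fourier inversion removes α, and θ δ ≠ 0 removes the auxiliary Gaussian.
  have h := congrFun (M.toLattice.eq_of_sum_ePair_eq key) δ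
  exact mul_right_cancel₀ (hθ δ) h

end PrimitiveSublattice

/-! ### The components of theta functions -/

theorem tsum_smul_single_apply {X D : Type*} [Finite D] [DecidableEq D] {f : X → ℂ}
    (hf : Summable fun x => ‖f x‖) (φ : X → D) (d : D) :
    (∑' x, f x • (Pi.single (φ x) 1 : D → ℂ)) d = ∑' x, if φ x = d then f x else 0 := by
  have := Fintype.ofFinite D
  have h : ∀ d x, (f x • (Pi.single (φ x) 1 : D → ℂ)) d = if φ x = d then f x else 0 := by
    intro d x
    rw [Pi.smul_apply, Pi.single_apply, smul_eq_mul, mul_ite, mul_one, mul_zero]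
    exact if_congr eq_comm rfl rfl
  rw [tsum_apply]
  · exact tsum_congr (h d)
  · refine Pi.summable.2 fun d => Summable.of_norm_bounded hf fun x => ?_
    rw [h]
    split_ifs
    · exact le_rfl
    · simp

namespace Module.Basis

variable {W : Type*} [AddCommGroup W] [Module ℝ W] {ι : Type} [Fintype ι]
  {b : Basis ι ℝ W}

theorem GaussBound.add {f g : W → ℂ} (hf : b.GaussBound f) (hg : b.GaussBound g) :
    b.GaussBound fun x => f x + g x := by
  obtain ⟨C, ε, hε, hC⟩ := hf
  obtain ⟨D, η, hη, hD⟩ := hg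
  refine ⟨|C| + |D|, min ε η, lt_min hε hη, fun x => (norm_add_le _ _).trans ?_⟩
  rw [add_mul]
  refine add_le_add ((hC x).trans ?_) ((hD x).trans ?_)
  · refine mul_le_mul (le_abs_self C) (Real.exp_le_exp.2 ?_) (Real.exp_pos _).le (abs_nonneg _)
    exact mul_le_mul_of_nonneg_right (neg_le_neg (min_le_left _ _)) (b.sqNorm_nonneg _)
  · refine mul_le_mul (le_abs_self D) (Real.exp_le_exp.2 ?_) (Real.exp_pos _).le (abs_nonneg _)
    exact mul_le_mul_of_nonneg_right (neg_le_neg (min_le_right _ _)) (b.sqNorm_nonneg _)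

theorem gaussBound_zero : b.GaussBound fun _ => (0 : ℂ) :=
  ⟨0, 1, one_pos, fun _ => by simp⟩

theorem GaussBound.sum {α : Type*} (s : Finset α) {f : α → W → ℂ}
    (hf : ∀ a ∈ s, b.GaussBound (f a)) : b.GaussBound fun x => ∑ a ∈ s, f a x := by
  classical
  induction s using Finset.induction_on with
  | empty => simpa using gaussBound_zero
  | insert a s ha ih =>
    simp only [Finset.sum_insert ha]
    exact (hf a (Finset.mem_insert_self _ _)).add
      (ih fun c hc => hf c (Finset.mem_insert_of_mem hc))

end Module.Basis

namespace Grass.Frame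

variable {W : Type*} [AddCommGroup W] [Module ℝ W] [FiniteDimensional ℝ W]
  {B : LinearMap.BilinForm ℝ W} {v : Grass B} {ι : Type} [Fintype ι] (E : v.Frame ι)

theorem thetaTerm_evalPoly_eq_hermiteFun (P : MvPolynomial ι ℂ) (τ : ℍ) :
    v.thetaTerm (E.evalPoly P) τ
      = fun x => ∑ d ∈ P.support, P.coeff d * E.hermiteFun d (E.point τ) x :=
  funext fun x => E.thetaTerm_evalPoly P τ x

theorem gaussBound_thetaTerm {p : W → ℂ} (hp : p ∈ realPolyFunctions W) (τ : ℍ) :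
    E.basis.GaussBound (v.thetaTerm p τ) := by
  obtain ⟨P, rfl⟩ := E.exists_evalPoly hp
  rw [thetaTerm_evalPoly_eq_hermiteFun]
  exact Module.Basis.GaussBound.sum _ fun d _ => (E.gaussBound_hermiteFun _ _).const_mul _

theorem negConj_S_smul (τ : ℍ) :
    (ModularGroup.S • τ).negConj = ModularGroup.S • τ.negConj := by
  ext
  rw [UpperHalfPlane.modular_S_smul, UpperHalfPlane.modular_S_smul]
  simp [UpperHalfPlane.negConj, inv_neg, map_inv₀]

theorem point_S_smul (τ : ℍ) :
    E.point (ModularGroup.S • τ) = fun i => ModularGroup.S • E.point τ i := by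
  funext i
  simp only [point]
  split_ifs
  · rfl
  · exact negConj_S_smul τ

/-- The constant depends on d only through its total degrees in positive and negative coordinates,
which homogeneity fixes. Hence one factor serves the whole polynomial. -/
theorem hermiteConst_point {mp mn : ℕ} {P : MvPolynomial ι ℂ}
    (hP : v.IsHomogeneous (E.evalPoly P) mp mn) {d : ι →₀ ℕ} (hd : d ∈ P.support) (τ : ℍ) :
    E.hermiteConst d (E.point τ)
      = (((-Complex.I * τ) ^ (1 / 2 : ℂ)) ^ (sigPos (LinearMap.BilinMap.toQuadraticMap B)))⁻¹ *
        ((starRingEnd ℂ ((-Complex.I * τ) ^ (1 / 2 : ℂ))) ^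
          (sigNeg (LinearMap.BilinMap.toQuadraticMap B)))⁻¹ *
        ((τ : ℂ) ^ mp)⁻¹ * ((starRingEnd ℂ (τ : ℂ)) ^ mn)⁻¹ := by
  obtain ⟨h1, h2⟩ := E.degree_of_isHomogeneous hP hd
  -- The real part of -iτ is Im τ > 0, so the principal root is taken off the cut and commutes with
  -- conjugation; this gives the root at -τ̄.
  have harg : (-Complex.I * τ : ℂ).arg ≠ Real.pi := by
    intro h
    have := (Complex.arg_eq_pi_iff.1 h).1
    have h3 : (-Complex.I * τ : ℂ).re = τ.im := by simp
    rw [h3] at this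
    exact lt_asymm this τ.im_pos
  have hconj : (-Complex.I * (τ.negConj : ℍ) : ℂ) ^ (1 / 2 : ℂ)
      = starRingEnd ℂ ((-Complex.I * τ) ^ (1 / 2 : ℂ)) := by
    have := Complex.conj_cpow (-Complex.I * τ : ℂ) (1 / 2 : ℂ) harg
    have h4 : starRingEnd ℂ (1 / 2 : ℂ) = 1 / 2 := by
      rw [map_div₀, map_one, map_ofNat]
    rw [h4] at this
    rw [← this]
    congr 1
    simp [UpperHalfPlane.negConj]
  set s := (-Complex.I * τ : ℂ) ^ (1 / 2 : ℂ)
  have hterm : ∀ i, ((-Complex.I * E.point τ i : ℂ) ^ (1 / 2 : ℂ))⁻¹ *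
      ((E.sign i * E.point τ i : ℂ) ^ d i)⁻¹
      = ((if E.sgn i = true then s else 1) * (if E.sgn i = false then starRingEnd ℂ s else 1) *
        (τ : ℂ) ^ (if E.sgn i then d i else 0) *
        (starRingEnd ℂ (τ : ℂ)) ^ (if E.sgn i then 0 else d i))⁻¹ := by
    intro i
    rw [point, sign]
    cases hi : E.sgn i with
    | true =>
      simp only [if_true, Bool.true_eq_false, if_false, pow_zero, mul_one, mul_inv]
      simp [s]
    | false =>
      simp only [if_true, Bool.false_eq_true, if_false, pow_zero, mul_one, mul_inv, one_mul,
        hconj]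
      simp [UpperHalfPlane.negConj]
  rw [hermiteConst, Finset.prod_congr rfl fun i _ => hterm i, Finset.prod_inv_distrib,
    Finset.prod_mul_distrib, Finset.prod_mul_distrib, Finset.prod_mul_distrib,
    Finset.prod_pow_eq_pow_sum, Finset.prod_pow_eq_pow_sum, h1, h2, E.sigPos_eq, E.sigNeg_eq,
    ← Finset.prod_filter, ← Finset.prod_filter, Finset.prod_const, Finset.prod_const]
  simp only [mul_inv]

end Grass.Frame

/-! ### The automorphy factor of S -/

theorem cpow_half_eq (τ : ℍ) : (τ : ℂ) ^ (1 / 2 : ℂ)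
    = (-Complex.I * τ) ^ (1 / 2 : ℂ) * expTwoPiI (1 / 8) := by
  have h0 : (-Complex.I * τ : ℂ) ≠ 0 := by simp [UpperHalfPlane.ne_zero]
  have hre : 0 < (-Complex.I * τ : ℂ).re := by simpa using τ.im_pos
  have harg := Complex.abs_arg_lt_pi_div_two_iff.2 (Or.inl hre)
  rw [abs_lt] at harg
  -- The arguments of -iτ and i add without crossing the cut; log i contributes the eighth root of
  -- unity.
  have hlog : Complex.log τ = Complex.log (-Complex.I * τ) + Complex.log Complex.I := by
    rw [← (Complex.log_mul_eq_add_log_iff h0 Complex.I_ne_zero).2]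
    · congr 1
      linear_combination (τ : ℂ) * Complex.I_sq
    · rw [Complex.arg_I]
      constructor <;> linarith [harg.1, harg.2, Real.pi_pos]
  rw [Complex.cpow_def_of_ne_zero h0, Complex.cpow_def_of_ne_zero τ.ne_zero, hlog, expTwoPiI,
    ← Complex.exp_add, Complex.log_I]
  congr 1
  ring

theorem cpow_half_mul_conj (τ : ℍ) : (-Complex.I * τ : ℂ) ^ (1 / 2 : ℂ) *
    starRingEnd ℂ ((-Complex.I * τ : ℂ) ^ (1 / 2 : ℂ)) = (‖(τ : ℂ)‖ : ℝ) := by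
  have h : ((-Complex.I * τ : ℂ) ^ (1 / 2 : ℂ)) ^ 2 = -Complex.I * τ := by
    rw [← Complex.cpow_nat_mul]; simp
  rw [Complex.mul_conj, Complex.normSq_eq_norm_sq, ← norm_pow, h]
  simp

/-- Since Im(-1/τ) = y/|τ|² and |τ|² = τ τ̄, the power of y turns antiholomorphic factors of
automorphy into holomorphic ones of the opposite weight. The eighth root of unity in √τ = √(-iτ)
e(1/8) produces the phase of the Weil representation. -/
theorem theta_scalar_identity (τ : ℍ) (a b p q : ℕ) :
    ((τ : ℂ) ^ (1 / 2 : ℂ)) ^ ((b : ℤ) - a + 2 * ((q : ℤ) - p)) *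
        (((ModularGroup.S • τ).im ^ ((b : ℝ) / 2 + q) : ℝ) : ℂ)
      = ((τ.im ^ ((b : ℝ) / 2 + q) : ℝ) : ℂ) * expTwoPiI (((b : ℂ) - a) / 8) *
        ((((-Complex.I * τ) ^ (1 / 2 : ℂ)) ^ a)⁻¹ *
        ((starRingEnd ℂ ((-Complex.I * τ) ^ (1 / 2 : ℂ))) ^ b)⁻¹ *
        ((τ : ℂ) ^ p)⁻¹ * ((starRingEnd ℂ (τ : ℂ)) ^ q)⁻¹) := by
  have him : (ModularGroup.S • τ).im = τ.im / ‖(τ : ℂ)‖ ^ 2 := by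
    rw [UpperHalfPlane.modular_S_smul, ← Complex.normSq_eq_norm_sq, ← UpperHalfPlane.coe_im]
    simp [Complex.inv_im, neg_div]
  have hN : 0 < ‖(τ : ℂ)‖ := norm_pos_iff.2 τ.ne_zero
  have hpow : ((ModularGroup.S • τ).im ^ ((b : ℝ) / 2 + q) : ℝ)
      = τ.im ^ ((b : ℝ) / 2 + q) / (‖(τ : ℂ)‖ ^ b * (‖(τ : ℂ)‖ ^ 2) ^ q) := by
    rw [him, Real.div_rpow τ.im_pos.le (by positivity)]
    congr 1
    rw [← Real.rpow_natCast _ 2, ← Real.rpow_mul hN.le, ← Real.rpow_natCast, ← Real.rpow_natCast,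
      ← Real.rpow_mul hN.le, ← Real.rpow_add hN]
    congr 1
    push_cast
    ring
  have hττ : ((‖(τ : ℂ)‖ : ℝ) : ℂ) ^ 2 = τ * starRingEnd ℂ (τ : ℂ) := by
    rw [Complex.mul_conj, Complex.normSq_eq_norm_sq]; push_cast; rfl
  have hw : expTwoPiI (((b : ℂ) - a) / 8) = expTwoPiI (1 / 8) ^ b * (expTwoPiI (1 / 8) ^ a)⁻¹ := by
    rw [expTwoPiI, expTwoPiI, ← Complex.exp_nat_mul, ← Complex.exp_nat_mul, ← Complex.exp_neg,
      ← Complex.exp_add]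
    congr 1
    ring
  have hρ2 : ((τ : ℂ) ^ (1 / 2 : ℂ)) ^ 2 = τ := by
    rw [← Complex.cpow_nat_mul]; simp
  have hρ0 : (τ : ℂ) ^ (1 / 2 : ℂ) ≠ 0 := by
    intro h; rw [h] at hρ2; exact τ.ne_zero (by rw [← hρ2]; simp)
  have hρ : ((τ : ℂ) ^ (1 / 2 : ℂ)) ^ ((b : ℤ) - a + 2 * ((q : ℤ) - p))
      = ((τ : ℂ) ^ (1 / 2 : ℂ)) ^ b * (((τ : ℂ) ^ (1 / 2 : ℂ)) ^ a)⁻¹ * (τ : ℂ) ^ q *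
        ((τ : ℂ) ^ p)⁻¹ := by
    have : (b : ℤ) - a + 2 * ((q : ℤ) - p) = b + -a + ((2 * q : ℕ) : ℤ) + -((2 * p : ℕ) : ℤ) := by
      push_cast; ring
    rw [this, zpow_add₀ hρ0, zpow_add₀ hρ0, zpow_add₀ hρ0, zpow_neg, zpow_neg, zpow_natCast,
      zpow_natCast, zpow_natCast, zpow_natCast, pow_mul, pow_mul, hρ2]
  have hs := cpow_half_mul_conj τ
  rw [hρ, cpow_half_eq τ, hpow, hw]
  push_cast
  rw [hττ, ← hs]
  rw [cpow_half_eq] at hρ0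
  have hs0 := left_ne_zero_of_mul hρ0
  have hc0 : starRingEnd ℂ ((-Complex.I * τ : ℂ) ^ (1 / 2 : ℂ)) ≠ 0 := by
    simpa using hs0
  have ht0 : (starRingEnd ℂ (τ : ℂ)) ≠ 0 := by simpa using τ.ne_zero
  have he0 := expTwoPiI_ne_zero (1 / 8)
  have hτ0 := τ.ne_zero
  generalize (-Complex.I * τ : ℂ) ^ (1 / 2 : ℂ) = s at *
  field_simp
  ring

/-! ### The transformation law on generators -/

namespace EvenLattice

variable {V : Type*} [AddCommGroup V] [Module ℝ V] (L : EvenLattice V)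

/-- The transformation law for `ρ_L^*` follows from the laws for the two generators. -/
theorem dual_law_of_generators {κ : ℤ} {G : ℍ → L.Disc → ℂ}
    (hT : ∀ τ : ℍ, L.weilMatrixT.transpose.mulVec (G (ModularGroup.T • τ)) = G τ)
    (hS : ∀ τ : ℍ, L.weilMatrixS.transpose.mulVec (G (ModularGroup.S • τ))
      = ((τ : ℂ) ^ (1 / 2 : ℂ)) ^ κ • G τ)
    (g : Mp2Z) (A : GL L.Disc ℂ) (h : (g, A) ∈ L.weilGraph) (τ : ℍ) :
    G (g.mat • τ) = g.root τ ^ κ • (Matrix.transpose (A⁻¹ : GL L.Disc ℂ).val).mulVec (G τ) := by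
  -- Stated with Aᵀ in place of its inverse, the law is stable under products and inverses in the
  -- graph; that the graph is single-valued is not needed.
  suffices h' : ∀ x ∈ L.weilGraph, ∀ τ : ℍ,
      (Matrix.transpose x.2.val).mulVec (G (x.1.mat • τ)) = x.1.root τ ^ κ • G τ by
    have h1 := congrArg (Matrix.mulVec (Matrix.transpose (A⁻¹ : GL L.Disc ℂ).val)) (h' _ h τ)
    rw [Matrix.mulVec_mulVec, ← Matrix.transpose_mul, ← Units.val_mul, mul_inv_cancel,
      Units.val_one, Matrix.transpose_one, Matrix.one_mulVec, Matrix.mulVec_smul] at h1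
    exact h1
  intro x hx
  induction hx using Subgroup.closure_induction with
  | mem x hx =>
    rcases hx with rfl | rfl
    · intro τ
      change L.weilMatrixT.transpose.mulVec (G (ModularGroup.T • τ)) = (1 : ℂ) ^ κ • G τ
      rw [hT, one_zpow, one_smul]
    · exact hS
  | one => intro τ; simp
  | mul x y _ _ hx hy =>
    intro τ
    rw [Prod.snd_mul, Prod.fst_mul, Units.val_mul, Matrix.transpose_mul, ← Matrix.mulVec_mulVec,
      Mp2Z.mul_mat, mul_smul, hx, Matrix.mulVec_smul, hy, smul_smul, Mp2Z.mul_root, mul_zpow]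
  | inv x _ hx =>
    intro τ
    have h1 := hx (x.1.mat⁻¹ • τ)
    rw [smul_inv_smul] at h1
    rw [Prod.snd_inv, Prod.fst_inv, Mp2Z.inv_mat, Mp2Z.inv_root, inv_zpow]
    have h2 : x.1.root (x.1.mat⁻¹ • τ) ^ κ ≠ 0 := zpow_ne_zero _ (x.1.root_ne_zero _)
    rw [eq_inv_smul_iff₀ h2, ← Matrix.mulVec_smul, ← h1, Matrix.mulVec_mulVec,
      ← Matrix.transpose_mul, ← Units.val_mul, mul_inv_cancel, Units.val_one,
      Matrix.transpose_one, Matrix.one_mulVec]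

variable {L}

theorem IsDualModularForm.transpose_mulVec {κ : ℤ} {F : ℍ → L.Disc → ℂ}
    (hF : L.IsDualModularForm κ F) {g : Mp2Z} {A : GL L.Disc ℂ} (h : (g, A) ∈ L.weilGraph)
    (τ : ℍ) : (Matrix.transpose A.val).mulVec (F (g.mat • τ)) = g.root τ ^ κ • F τ := by
  rw [hF.2 g A h τ, Matrix.mulVec_smul, Matrix.mulVec_mulVec, ← Matrix.transpose_mul,
    ← Units.val_mul, inv_mul_cancel, Units.val_one, Matrix.transpose_one, Matrix.one_mulVec]

theorem IsDualModularForm.law_T {κ : ℤ} {F : ℍ → L.Disc → ℂ}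
    (hF : L.IsDualModularForm κ F) (τ : ℍ) (γ : L.Disc) :
    F τ γ = L.eNorm γ * F (ModularGroup.T • τ) γ := by
  have h : (Mp2Z.T, L.weilT) ∈ L.weilGraph := Subgroup.subset_closure (by simp)
  have h1 := congrFun (hF.transpose_mulVec h τ) γ
  change L.weilMatrixT.transpose.mulVec (F (ModularGroup.T • τ)) γ = ((1 : ℂ) ^ κ • F τ) γ at h1
  rw [weilMatrixT, Matrix.diagonal_transpose, Matrix.mulVec_diagonal, one_zpow, one_smul] at h1
  exact h1.symm

theorem IsDualModularForm.law_S {κ : ℤ} {F : ℍ → L.Disc → ℂ}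
    (hF : L.IsDualModularForm κ F) (τ : ℍ) (γ : L.Disc) :
    ((τ : ℂ) ^ (1 / 2 : ℂ)) ^ κ * F τ γ
      = L.weilScalar * ∑ δ, (L.ePair γ δ)⁻¹ * F (ModularGroup.S • τ) δ := by
  have h : (Mp2Z.S, L.weilS) ∈ L.weilGraph := Subgroup.subset_closure (by simp)
  have h1 := congrFun (hF.transpose_mulVec h τ) γ
  refine h1.symm.trans ?_
  change ∑ δ, L.weilMatrixS δ γ * F (ModularGroup.S • τ) δ = _
  rw [Finset.mul_sum]
  refine Finset.sum_congr rfl fun δ _ => ?_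
  rw [weilMatrixS, Matrix.of_apply, mul_assoc]

end EvenLattice

/-! ### The transformation of the theta contraction under T and S -/

namespace PrimitiveSublattice

variable {V : Type*} [AddCommGroup V] [Module ℝ V] [FiniteDimensional ℝ V] {L : EvenLattice V}
  (M : PrimitiveSublattice L) {w : M.PerpGr} {κ : Type} [Fintype κ] (E' : w.Frame κ)

theorem isSymm_restrict_perp : (L.form.restrict M.perp).IsSymm := ⟨fun x y => L.symm.eq x y⟩

theorem sigPos_add (w : M.PerpGr) : L.bPos = M.toLattice.bPos +
    sigPos (LinearMap.BilinMap.toQuadraticMap (L.form.restrict M.perp)) := by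
  obtain ⟨u⟩ := M.nonempty_gr
  obtain ⟨n, m, ⟨E⟩⟩ := u.exists_frame M.toLattice.symm
  obtain ⟨n', m', ⟨E'⟩⟩ := w.exists_frame M.isSymm_restrict_perp
  rw [EvenLattice.bPos, (M.directSumFrame E E').sigPos_eq, EvenLattice.bPos, E.sigPos_eq,
    E'.sigPos_eq, Finset.card_filter, Fintype.sum_sum_type, Finset.card_filter,
    Finset.card_filter]
  rfl

theorem sigNeg_add (w : M.PerpGr) : L.bNeg = M.toLattice.bNeg +
    sigNeg (LinearMap.BilinMap.toQuadraticMap (L.form.restrict M.perp)) := by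
  obtain ⟨u⟩ := M.nonempty_gr
  obtain ⟨n, m, ⟨E⟩⟩ := u.exists_frame M.toLattice.symm
  obtain ⟨n', m', ⟨E'⟩⟩ := w.exists_frame M.isSymm_restrict_perp
  rw [EvenLattice.bNeg, (M.directSumFrame E E').sigNeg_eq, EvenLattice.bNeg, E.sigNeg_eq,
    E'.sigNeg_eq, Finset.card_filter, Fintype.sum_sum_type, Finset.card_filter,
    Finset.card_filter]
  rfl

theorem theta_apply {p : M.perp → ℂ} (hp : p ∈ realPolyFunctions M.perp) (w : M.PerpGr) (kn : ℕ)
    (τ : ℍ) (γ : L.Disc) (δ : M.toLattice.Disc) : M.theta w kn p τ (γ, δ)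
      = ((τ.im ^ (((L.bNeg : ℝ) - (M.toLattice.bNeg : ℝ)) / 2 + kn) : ℝ) : ℂ) *
        M.fiberSum (w.thetaTerm p τ) γ δ := by
  obtain ⟨n', m', ⟨E'⟩⟩ := w.exists_frame M.isSymm_restrict_perp
  rw [theta, Pi.smul_apply, smul_eq_mul, tsum_smul_single_apply
    (M.summable_quotToPerp E' (E'.gaussBound_thetaTerm hp τ))
    (fun x => (M.quotToDisc x, M.quotToSubDisc x)) (γ, δ)]
  rfl

theorem summable_fiber {G : M.perp → ℂ} (hG : E'.basis.GaussBound G) (γ : L.Disc)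
    (δ : M.toLattice.Disc) : Summable fun x : L.dual ⧸ M.inDual =>
      if (M.quotToDisc x, M.quotToSubDisc x) = (γ, δ) then G (M.quotToPerp x) else 0 := by
  refine Summable.of_norm_bounded (M.summable_quotToPerp E' hG) fun x => ?_
  split_ifs
  · exact le_rfl
  · simp

theorem fiberSum_finsetSum {α : Type*} (s : Finset α) (c : α → ℂ) {G : α → M.perp → ℂ}
    (hG : ∀ a ∈ s, E'.basis.GaussBound (G a)) (γ : L.Disc) (δ : M.toLattice.Disc) :
    M.fiberSum (fun x => ∑ a ∈ s, c a * G a x) γ δ = ∑ a ∈ s, c a * M.fiberSum (G a) γ δ := by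
  simp only [fiberSum, ← tsum_mul_left]
  rw [← Summable.tsum_finsetSum fun a ha => (M.summable_fiber E' (hG a ha) γ δ).mul_left _]
  refine tsum_congr fun x => ?_
  split_ifs
  · rfl
  · simp

/-- `fiberSum_hermiteFun` summed over the monomials of p; by `hermiteConst_point` the constant comes
out of the sum. -/
theorem fiberSum_thetaTerm_S {p : M.perp → ℂ} {kp kn : ℕ} (hp : w.IsHomogeneous p kp kn) (τ : ℍ)
    (γ : L.Disc) (δ : M.toLattice.Disc) : M.fiberSum (w.thetaTerm p τ) γ δ
      = (((Real.sqrt (Fintype.card L.Disc))⁻¹ : ℝ) : ℂ) *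
          (((Real.sqrt (Fintype.card M.toLattice.Disc))⁻¹ : ℝ) : ℂ) *
        ((((-Complex.I * τ) ^ (1 / 2 : ℂ)) ^
            sigPos (LinearMap.BilinMap.toQuadraticMap (L.form.restrict M.perp)))⁻¹ *
          ((starRingEnd ℂ ((-Complex.I * τ) ^ (1 / 2 : ℂ))) ^
            sigNeg (LinearMap.BilinMap.toQuadraticMap (L.form.restrict M.perp)))⁻¹ *
          ((τ : ℂ) ^ kp)⁻¹ * ((starRingEnd ℂ (τ : ℂ)) ^ kn)⁻¹) *
        ∑ γ', ∑ δ', L.ePair γ γ' * (M.toLattice.ePair δ δ')⁻¹ *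
          M.fiberSum (w.thetaTerm p (ModularGroup.S • τ)) γ' δ' := by
  obtain ⟨n', m', ⟨E'⟩⟩ := w.exists_frame M.isSymm_restrict_perp
  obtain ⟨P, rfl⟩ := E'.exists_evalPoly hp.1
  have hG : ∀ τ : ℍ, ∀ d ∈ P.support, E'.basis.GaussBound (E'.hermiteFun d (E'.point τ)) :=
    fun τ d _ => E'.gaussBound_hermiteFun _ _
  simp only [E'.thetaTerm_evalPoly_eq_hermiteFun]
  rw [M.fiberSum_finsetSum E' _ _ (hG τ)]
  simp only [M.fiberSum_finsetSum E' _ _ (hG (ModularGroup.S • τ))]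
  rw [Finset.sum_congr rfl fun d hd => by
    rw [M.fiberSum_hermiteFun E' d, E'.hermiteConst_point hp hd τ, ← E'.point_S_smul]]
  simp only [Finset.mul_sum]
  rw [Finset.sum_comm]
  refine Finset.sum_congr rfl fun γ' _ => ?_
  rw [Finset.sum_comm]
  refine Finset.sum_congr rfl fun δ' _ => Finset.sum_congr rfl fun d _ => ?_
  ring

theorem thetaTerm_T (w : M.PerpGr) (p : M.perp → ℂ) (τ : ℍ) (x : M.perp) :
    w.thetaTerm p (ModularGroup.T • τ) x
      = w.thetaTerm p τ x * expTwoPiI (((L.form x x : ℝ) : ℂ) / 2) := by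
  obtain ⟨n', m', ⟨E'⟩⟩ := w.exists_frame M.isSymm_restrict_perp
  have h : (ModularGroup.T • τ : ℍ) = (1 : ℝ) +ᵥ τ := UpperHalfPlane.modular_T_smul τ
  have him : (ModularGroup.T • τ).im = τ.im := by rw [h]; simp
  have hco : ((ModularGroup.T • τ : ℍ) : ℂ) = τ + 1 := by rw [h]; simp [add_comm]
  have hf : (L.form x x : ℝ) = L.form.restrict M.perp (w.projPos x) (w.projPos x) +
      L.form.restrict M.perp (w.projNeg x) (w.projNeg x) := by
    rw [E'.form_projPos, E'.form_projNeg, ← Finset.sum_add_distrib]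
    refine (E'.form_eq x x).trans (Finset.sum_congr rfl fun i _ => ?_)
    rw [Grass.Frame.sign]
    split_ifs <;> ring
  rw [Grass.thetaTerm, Grass.thetaTerm, him, hco, mul_assoc (w.expLaplacian _ _ _),
    ← expTwoPiI_add, hf, map_add, map_one]
  congr 2
  push_cast
  ring

/-- The norm of the M_ℝ^⊥-component is the difference of the norms of l and of its projection to
M^*, whose phases depend only on their classes. -/
theorem expTwoPiI_quotToPerp (x : L.dual ⧸ M.inDual) :
    expTwoPiI (((L.form (M.quotToPerp x) (M.quotToPerp x) : ℝ) : ℂ) / 2)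
      = L.eNorm (M.quotToDisc x) * (M.toLattice.eNorm (M.quotToSubDisc x))⁻¹ := by
  obtain ⟨l, rfl⟩ := Submodule.mkQ_surjective _ x
  rw [M.quotToDisc_mk, M.quotToSubDisc_mk, M.quotToPerp_mk, L.eNorm_toDisc,
    M.toLattice.eNorm_toDisc, eq_mul_inv_iff_mul_eq₀ (expTwoPiI_ne_zero _), ← expTwoPiI_add]
  have h := M.form_add_add (M.projReal (l : V)) (M.projPerp l)
  rw [M.projReal_add_projPerp] at h
  rw [h]
  congr 1
  change _ + ((L.form (M.projReal (l : V)) (M.projReal (l : V)) : ℝ) : ℂ) / 2 = _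
  push_cast
  ring

theorem fiberSum_thetaTerm_T (w : M.PerpGr) (p : M.perp → ℂ) (τ : ℍ)
    (γ : L.Disc) (δ : M.toLattice.Disc) : M.fiberSum (w.thetaTerm p (ModularGroup.T • τ)) γ δ
      = L.eNorm γ * (M.toLattice.eNorm δ)⁻¹ * M.fiberSum (w.thetaTerm p τ) γ δ := by
  simp only [fiberSum, ← tsum_mul_left]
  refine tsum_congr fun x => ?_
  split_ifs with h
  · rw [M.thetaTerm_T, M.expTwoPiI_quotToPerp, (Prod.mk.inj h).1, (Prod.mk.inj h).2, mul_comm]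
  · rw [mul_zero]

variable {F : ℍ → L.Disc → ℂ} {p : M.perp → ℂ}

theorem thetaContraction_apply (hp : p ∈ realPolyFunctions M.perp) (w : M.PerpGr) (kn : ℕ) (τ : ℍ)
    (δ : M.toLattice.Disc) : M.thetaContraction w kn p F τ δ
      = ((τ.im ^ ((sigNeg (LinearMap.BilinMap.toQuadraticMap (L.form.restrict M.perp)) : ℝ) / 2 +
          kn) : ℝ) : ℂ) * ∑ γ, M.fiberSum (w.thetaTerm p τ) γ δ * F τ γ := by
  have hr : ((L.bNeg : ℝ) - (M.toLattice.bNeg : ℝ)) / 2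
      = (sigNeg (LinearMap.BilinMap.toQuadraticMap (L.form.restrict M.perp)) : ℝ) / 2 := by
    rw [M.sigNeg_add w]; push_cast; ring
  rw [thetaContraction, EvenLattice.pairing, Finset.mul_sum]
  refine Finset.sum_congr rfl fun γ _ => ?_
  rw [M.theta_apply hp, hr, mul_assoc]

theorem thetaContraction_T {k : ℤ} (hF : L.IsDualModularForm k F)
    (hp : p ∈ realPolyFunctions M.perp) (w : M.PerpGr) (kn : ℕ) (τ : ℍ) :
    M.toLattice.weilMatrixT.transpose.mulVec
      (M.thetaContraction w kn p F (ModularGroup.T • τ)) = M.thetaContraction w kn p F τ := by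
  funext δ
  have him : (ModularGroup.T • τ).im = τ.im := by
    rw [UpperHalfPlane.modular_T_smul]; simp
  rw [EvenLattice.weilMatrixT, Matrix.diagonal_transpose, Matrix.mulVec_diagonal,
    M.thetaContraction_apply hp, M.thetaContraction_apply hp, him, mul_left_comm, Finset.mul_sum]
  congr 1
  refine Finset.sum_congr rfl fun γ _ => ?_
  have h0 : M.toLattice.eNorm δ ≠ 0 := expTwoPiI_ne_zero _
  rw [M.fiberSum_thetaTerm_T, hF.law_T τ γ]
  field_simp

/-- The S-laws of Θ_{L,M} and of F bring in inverse characters of D_L, so the sum over γ forces the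
two dual classes to agree and contributes |D_L|. What remains is the finite Fourier transform on D_M
in ρ_M^*, up to scalars. -/
theorem thetaContraction_S {k : ℤ} (hF : L.IsDualModularForm k F) {kp kn : ℕ}
    (hp : w.IsHomogeneous p kp kn) {k' : ℤ}
    (hk : k = k' + ((sigNeg (LinearMap.BilinMap.toQuadraticMap (L.form.restrict M.perp)) : ℤ) -
      sigPos (LinearMap.BilinMap.toQuadraticMap (L.form.restrict M.perp)) +
        2 * ((kn : ℤ) - kp))) (τ : ℍ) :
    M.toLattice.weilMatrixS.transpose.mulVec
      (M.thetaContraction w kn p F (ModularGroup.S • τ))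
      = ((τ : ℂ) ^ (1 / 2 : ℂ)) ^ k' • M.thetaContraction w kn p F τ := by
  set b := sigNeg (LinearMap.BilinMap.toQuadraticMap (L.form.restrict M.perp)) with hb
  set a := sigPos (LinearMap.BilinMap.toQuadraticMap (L.form.restrict M.perp)) with ha
  have hid := theta_scalar_identity τ a b kp kn
  funext δ
  have hρ0 : (τ : ℂ) ^ (1 / 2 : ℂ) ≠ 0 := Mp2Z.S.root_ne_zero τ
  rw [Pi.smul_apply, smul_eq_mul, M.thetaContraction_apply hp.1]
  have hL : ∀ δ, (M.toLattice.weilMatrixS.transpose.mulVec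
      (M.thetaContraction w kn p F (ModularGroup.S • τ))) δ
      = M.toLattice.weilScalar * ∑ δ', (M.toLattice.ePair δ δ')⁻¹ *
        M.thetaContraction w kn p F (ModularGroup.S • τ) δ' := by
    intro δ
    change ∑ δ', M.toLattice.weilMatrixS δ' δ * _ = _
    rw [Finset.mul_sum]
    refine Finset.sum_congr rfl fun δ' _ => ?_
    rw [EvenLattice.weilMatrixS, Matrix.of_apply, mul_assoc]
  rw [hL]
  simp only [M.thetaContraction_apply hp.1, ← hb]
  set ρ := (τ : ℂ) ^ (1 / 2 : ℂ)
  set fS : L.Disc → M.toLattice.Disc → ℂ := M.fiberSum (w.thetaTerm p (ModularGroup.S • τ))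
  have hcard : (0 : ℝ) < Fintype.card L.Disc := by exact_mod_cast Fintype.card_pos
  have hortho : ∀ γ' γ'' : L.Disc, ∑ γ, L.ePair γ γ' * (L.ePair γ γ'')⁻¹
      = if γ'' = γ' then (Fintype.card L.Disc : ℂ) else 0 := by
    intro γ' γ''
    have h := L.sum_ePair_mul_ePair γ' (-γ'')
    refine Eq.trans (Finset.sum_congr rfl fun γ _ => ?_)
      (h.trans (if_congr (add_neg_eq_zero.trans eq_comm) rfl rfl))
    rw [L.ePair_comm γ γ', L.ePair_comm γ (-γ''), L.ePair_neg_left, L.ePair_comm γ'']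
  have hexp : ρ ^ k * ∑ γ, M.fiberSum (w.thetaTerm p τ) γ δ * F τ γ
      = (((Real.sqrt (Fintype.card L.Disc))⁻¹ : ℝ) : ℂ) *
          (((Real.sqrt (Fintype.card M.toLattice.Disc))⁻¹ : ℝ) : ℂ) *
        ((((-Complex.I * τ) ^ (1 / 2 : ℂ)) ^ a)⁻¹ *
          ((starRingEnd ℂ ((-Complex.I * τ) ^ (1 / 2 : ℂ))) ^ b)⁻¹ *
          ((τ : ℂ) ^ kp)⁻¹ * ((starRingEnd ℂ (τ : ℂ)) ^ kn)⁻¹) * L.weilScalar *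
        Fintype.card L.Disc *
        ∑ δ', (M.toLattice.ePair δ δ')⁻¹ * ∑ γ, fS γ δ' * F (ModularGroup.S • τ) γ := by
    set K := (((-Complex.I * τ) ^ (1 / 2 : ℂ)) ^ a)⁻¹ *
          ((starRingEnd ℂ ((-Complex.I * τ) ^ (1 / 2 : ℂ))) ^ b)⁻¹ *
          ((τ : ℂ) ^ kp)⁻¹ * ((starRingEnd ℂ (τ : ℂ)) ^ kn)⁻¹
    set cL := (((Real.sqrt (Fintype.card L.Disc))⁻¹ : ℝ) : ℂ)
    set cM := (((Real.sqrt (Fintype.card M.toLattice.Disc))⁻¹ : ℝ) : ℂ)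
    have h1 : ∀ γ, ρ ^ k * (M.fiberSum (w.thetaTerm p τ) γ δ * F τ γ)
        = cL * cM * K * L.weilScalar * ∑ γ', ∑ δ', ∑ γ'',
          (L.ePair γ γ' * (L.ePair γ γ'')⁻¹) *
            ((M.toLattice.ePair δ δ')⁻¹ * fS γ' δ' * F (ModularGroup.S • τ) γ'') := by
      intro γ
      rw [mul_left_comm, hF.law_S τ γ, M.fiberSum_thetaTerm_S hp τ γ δ]
      simp only [Finset.mul_sum, Finset.sum_mul]
      rw [Finset.sum_comm]
      refine Finset.sum_congr rfl fun γ' _ => ?_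
      rw [Finset.sum_comm]
      refine Finset.sum_congr rfl fun δ' _ => Finset.sum_congr rfl fun γ'' _ => ?_
      ring
    rw [Finset.mul_sum, Finset.sum_congr rfl fun γ _ => h1 γ, ← Finset.mul_sum,
      mul_assoc (cL * cM * K * L.weilScalar)]
    congr 1
    rw [Finset.sum_comm, Finset.mul_sum]
    simp only [Finset.mul_sum]
    rw [Finset.sum_comm (s := Finset.univ (α := M.toLattice.Disc))]
    refine Finset.sum_congr rfl fun γ' _ => ?_
    rw [Finset.sum_comm]
    refine Finset.sum_congr rfl fun δ' _ => ?_
    rw [Finset.sum_comm]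
    simp only [← Finset.sum_mul, hortho]
    rw [Finset.sum_eq_single γ']
    · rw [if_pos rfl]; ring
    · intro γ'' _ h
      rw [if_neg h, zero_mul]
    · simp
  -- The factors |D_L|^{±1/2} cancel, and additivity of the signature splits the phase into those of
  -- M and of M^⊥.
  have hcomb : L.weilScalar * (((Real.sqrt (Fintype.card L.Disc))⁻¹ : ℝ) : ℂ) *
      (((Real.sqrt (Fintype.card M.toLattice.Disc))⁻¹ : ℝ) : ℂ) * Fintype.card L.Disc
      = M.toLattice.weilScalar * expTwoPiI (((b : ℂ) - a) / 8) := by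
    have hs : ((Real.sqrt (Fintype.card L.Disc) : ℝ) : ℂ) ^ 2 = Fintype.card L.Disc := by
      exact_mod_cast Real.sq_sqrt hcard.le
    have hs0 : ((Real.sqrt (Fintype.card L.Disc) : ℝ) : ℂ) ≠ 0 := by
      exact_mod_cast (Real.sqrt_pos.2 hcard).ne'
    have he : expTwoPiI (((L.bNeg : ℂ) - (L.bPos : ℂ)) / 8)
        = expTwoPiI (((M.toLattice.bNeg : ℂ) - (M.toLattice.bPos : ℂ)) / 8) *
          expTwoPiI (((b : ℂ) - a) / 8) := by
      rw [← expTwoPiI_add, M.sigNeg_add w, M.sigPos_add w]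
      congr 1
      push_cast
      ring
    rw [EvenLattice.weilScalar, EvenLattice.weilScalar, he, ← hs]
    push_cast
    field_simp
  have hkk : ρ ^ k = ρ ^ k' * ρ ^ ((b : ℤ) - a + 2 * ((kn : ℤ) - kp)) := by
    rw [hk, zpow_add₀ hρ0]
  -- The weight of F is the weight of the contraction plus the contribution of M^⊥; the latter is
  -- cancelled against `theta_scalar_identity`.
  have hz0 : ρ ^ ((b : ℤ) - a + 2 * ((kn : ℤ) - kp)) ≠ 0 := zpow_ne_zero _ hρ0
  apply mul_left_cancel₀ hz0
  set X := ∑ δ', (M.toLattice.ePair δ δ')⁻¹ * ∑ γ, fS γ δ' * F (ModularGroup.S • τ) γ with hX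
  have hl : ∑ δ', (M.toLattice.ePair δ δ')⁻¹ *
      ((((ModularGroup.S • τ).im ^ ((b : ℝ) / 2 + kn) : ℝ) : ℂ) *
        ∑ γ, fS γ δ' * F (ModularGroup.S • τ) γ)
      = (((ModularGroup.S • τ).im ^ ((b : ℝ) / 2 + kn) : ℝ) : ℂ) * X := by
    rw [hX, Finset.mul_sum]
    exact Finset.sum_congr rfl fun δ' _ => by ring
  rw [hl]
  calc _ = M.toLattice.weilScalar * (ρ ^ ((b : ℤ) - a + 2 * ((kn : ℤ) - kp)) *
        (((ModularGroup.S • τ).im ^ ((b : ℝ) / 2 + kn) : ℝ) : ℂ)) * X := by ring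
    _ = ((τ.im ^ ((b : ℝ) / 2 + kn) : ℝ) : ℂ) *
        (ρ ^ k * ∑ γ, M.fiberSum (w.thetaTerm p τ) γ δ * F τ γ) := by
      rw [hid, hexp]
      linear_combination (-((τ.im ^ ((b : ℝ) / 2 + kn) : ℝ) : ℂ) *
        ((((-Complex.I * τ) ^ (1 / 2 : ℂ)) ^ a)⁻¹ *
          ((starRingEnd ℂ ((-Complex.I * τ) ^ (1 / 2 : ℂ))) ^ b)⁻¹ *
          ((τ : ℂ) ^ kp)⁻¹ * ((starRingEnd ℂ (τ : ℂ)) ^ kn)⁻¹) * X) * hcomb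
    _ = _ := by rw [hkk]; ring

end PrimitiveSublattice

/-! ### The splitting of theta functions and lifts along M -/

theorem MvPolynomial.constr_basisMonomials_monomial {σ : Type*} (h : (σ →₀ ℕ) → ℂ) (d : σ →₀ ℕ)
    (c : ℂ) : (MvPolynomial.basisMonomials σ ℂ).constr ℂ h (MvPolynomial.monomial d c) = c * h d := by
  have h1 : MvPolynomial.monomial d c = c • MvPolynomial.basisMonomials σ ℂ d := by
    rw [MvPolynomial.coe_basisMonomials, MvPolynomial.smul_monomial, smul_eq_mul, mul_one]
  rw [h1, map_smul, Module.Basis.constr_basis, smul_eq_mul]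

theorem MvPolynomial.constr_basisMonomials {σ : Type*} (h : (σ →₀ ℕ) → ℂ) (P : MvPolynomial σ ℂ) :
    (MvPolynomial.basisMonomials σ ℂ).constr ℂ h P = ∑ d ∈ P.support, P.coeff d * h d := by
  conv_lhs => rw [P.as_sum, map_sum]
  exact Finset.sum_congr rfl fun d _ => constr_basisMonomials_monomial h d _

namespace PrimitiveSublattice

variable {V : Type*} [AddCommGroup V] [Module ℝ V] [FiniteDimensional ℝ V] {L : EvenLattice V}
  (M : PrimitiveSublattice L) {u : M.toLattice.Gr} {w : M.PerpGr} {ι κ : Type} [Fintype ι]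
  [Fintype κ] (E : u.Frame ι) (E' : w.Frame κ)

theorem evalPoly_directSumFrame (P : MvPolynomial ι ℂ) (Q : MvPolynomial κ ℂ) (x : V) :
    (M.directSumFrame E E').evalPoly
        (MvPolynomial.rename Sum.inl P * MvPolynomial.rename Sum.inr Q) x
      = E.evalPoly P (M.projReal x) * E'.evalPoly Q (M.projPerp x) := by
  simp only [Grass.Frame.evalPoly, map_mul, MvPolynomial.eval_rename]
  refine congrArg₂ _ (congrArg (fun f => MvPolynomial.eval f P) (funext fun i => ?_))
    (congrArg (fun f => MvPolynomial.eval f Q) (funext fun i => ?_))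
  · simp only [Function.comp_apply, directSumFrame_repr_inl]
  · simp only [Function.comp_apply, directSumFrame_repr_inr]

theorem point_directSumFrame (τ : ℍ) :
    (M.directSumFrame E E').point τ = Sum.elim (E.point τ) (E'.point τ) := by
  funext i
  rcases i with i | i <;> rfl

/-- In the union of two frames the polynomial is a product in disjoint sets of variables, and the
Hermite functions of its monomials factor accordingly. No computation with the Laplacian of the sum
is needed. -/
theorem thetaTerm_directSum {p : V → ℂ} {pM : M.real → ℂ} {pPerp : M.perp → ℂ}
    (hM : pM ∈ realPolyFunctions M.real) (hPerp : pPerp ∈ realPolyFunctions M.perp)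
    (hp : ∀ x, p x = pM (M.projReal x) * pPerp (M.projPerp x)) (u : M.toLattice.Gr) (w : M.PerpGr)
    (τ : ℍ) (x : V) : (M.directSum u w).thetaTerm p τ x
      = u.thetaTerm pM τ (M.projReal x) * w.thetaTerm pPerp τ (M.projPerp x) := by
  obtain ⟨n, m, ⟨E⟩⟩ := u.exists_frame M.toLattice.symm
  obtain ⟨n', m', ⟨E'⟩⟩ := w.exists_frame M.isSymm_restrict_perp
  obtain ⟨P, rfl⟩ := E.exists_evalPoly hM
  obtain ⟨Q, rfl⟩ := E'.exists_evalPoly hPerp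
  have hp' : p = (M.directSumFrame E E').evalPoly
      (MvPolynomial.rename Sum.inl P * MvPolynomial.rename Sum.inr Q) :=
    funext fun x => (hp x).trans (M.evalPoly_directSumFrame E E' P Q x).symm
  rw [hp']
  simp only [Grass.Frame.thetaTerm_evalPoly_eq_hermiteFun]
  -- Viewed as a linear functional of the polynomial, the sum can be expanded over pairs of
  -- monomials of P and Q, regardless of the support of the product.
  rw [← MvPolynomial.constr_basisMonomials fun d =>
    (M.directSumFrame E E').hermiteFun d ((M.directSumFrame E E').point τ) x]
  rw [P.as_sum, Q.as_sum]
  simp only [map_sum, MvPolynomial.rename_monomial]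
  rw [Finset.sum_mul_sum]
  simp only [MvPolynomial.monomial_mul, map_sum]
  rw [← P.as_sum, ← Q.as_sum, Finset.sum_mul_sum]
  refine Finset.sum_congr rfl fun d _ => Finset.sum_congr rfl fun e _ => ?_
  rw [MvPolynomial.constr_basisMonomials_monomial, point_directSumFrame]
  have hde : ⇑(Finsupp.mapDomain Sum.inl d + Finsupp.mapDomain Sum.inr e :
      (Fin n ⊕ Fin m) ⊕ (Fin n' ⊕ Fin m') →₀ ℕ)
      = (Sum.elim d e : (Fin n ⊕ Fin m) ⊕ (Fin n' ⊕ Fin m') → ℕ) := by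
    funext i
    rcases i with i | i
    · rw [Finsupp.add_apply, Finsupp.mapDomain_apply Sum.inl_injective,
        Finsupp.mapDomain_of_notMem_range _ _ (by simp), add_zero, Sum.elim_inl]
    · rw [Finsupp.add_apply, Finsupp.mapDomain_apply Sum.inr_injective,
        Finsupp.mapDomain_of_notMem_range _ _ (by simp), zero_add, Sum.elim_inr]
  rw [hde, hermiteFun_directSumFrame]
  ring

theorem _root_.EvenLattice.theta_apply {L : EvenLattice V} {v : L.Gr} (E : v.Frame ι)
    {p : V → ℂ} (mn : ℕ) (τ : ℍ) (hp : E.basis.GaussBound (v.thetaTerm p τ)) (γ : L.Disc) : L.theta v mn p τ γ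
      = ((τ.im ^ ((L.bNeg : ℝ) / 2 + mn) : ℝ) : ℂ) * L.cosetSum (v.thetaTerm p τ) γ := by
  rw [EvenLattice.theta, Pi.smul_apply, smul_eq_mul, tsum_smul_single_apply
    (L.summable_of_gaussBound hp) (fun x => L.toDisc x) γ]
  rfl

/-- `cosetSum_tensor` applied to the factored summand; the powers of y of the two theta functions
multiply to that of Θ_L. -/
theorem theta_directSum {p : V → ℂ} {pM : M.real → ℂ} {pPerp : M.perp → ℂ}
    (hM : pM ∈ realPolyFunctions M.real) (hPerp : pPerp ∈ realPolyFunctions M.perp)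
    (hp : ∀ x, p x = pM (M.projReal x) * pPerp (M.projPerp x)) (u : M.toLattice.Gr) (w : M.PerpGr)
    (kn ln : ℕ) (τ : ℍ) (γ : L.Disc) : L.theta (M.directSum u w) (kn + ln) p τ γ
      = ∑ δ, M.theta w kn pPerp τ (γ, δ) * M.toLattice.theta u ln pM τ δ := by
  obtain ⟨n, m, ⟨E⟩⟩ := u.exists_frame M.toLattice.symm
  obtain ⟨n', m', ⟨E'⟩⟩ := w.exists_frame M.isSymm_restrict_perp
  have hE := E.gaussBound_thetaTerm hM τ
  have hE' := E'.gaussBound_thetaTerm hPerp τ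
  have ht : (M.directSum u w).thetaTerm p τ
      = fun x => u.thetaTerm pM τ (M.projReal x) * w.thetaTerm pPerp τ (M.projPerp x) :=
    funext fun x => M.thetaTerm_directSum hM hPerp hp u w τ x
  rw [EvenLattice.theta_apply (M.directSumFrame E E') _ τ
    (by rw [ht]; exact M.gaussBound_tensor E E' hE hE'), ht, M.cosetSum_tensor E E' hE hE',
    Finset.mul_sum]
  refine Finset.sum_congr rfl fun δ _ => ?_
  have hy : τ.im ^ ((L.bNeg : ℝ) / 2 + (kn + ln : ℕ))
      = τ.im ^ (((L.bNeg : ℝ) - (M.toLattice.bNeg : ℝ)) / 2 + kn) *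
        τ.im ^ ((M.toLattice.bNeg : ℝ) / 2 + ln) := by
    rw [← Real.rpow_add τ.im_pos]
    congr 1
    push_cast
    ring
  rw [M.theta_apply hPerp, EvenLattice.theta_apply E _ τ hE, hy]
  push_cast
  ring

/-- The integrands agree at every τ, so no integrability enters. -/
theorem truncatedLift_directSum {p : V → ℂ} {pM : M.real → ℂ} {pPerp : M.perp → ℂ}
    (hM : pM ∈ realPolyFunctions M.real) (hPerp : pPerp ∈ realPolyFunctions M.perp)
    (hp : ∀ x, p x = pM (M.projReal x) * pPerp (M.projPerp x)) (u : M.toLattice.Gr) (w : M.PerpGr)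
    (kn ln : ℕ) (F : ℍ → L.Disc → ℂ) : L.truncatedLift (M.directSum u w) (kn + ln) p F
      = M.toLattice.truncatedLift u ln pM (M.thetaContraction w kn pPerp F) := by
  funext s Y
  rw [EvenLattice.truncatedLift, EvenLattice.truncatedLift]
  have h : ∀ τ : ℍ, L.pairing (L.theta (M.directSum u w) (kn + ln) p τ) (F τ)
      = M.toLattice.pairing (M.toLattice.theta u ln pM τ)
        (M.thetaContraction w kn pPerp F τ) := by
    intro τ
    simp only [EvenLattice.pairing, thetaContraction, M.theta_directSum hM hPerp hp,
      Finset.sum_mul, Finset.mul_sum]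
    rw [Finset.sum_comm]
    exact Finset.sum_congr rfl fun δ _ => Finset.sum_congr rfl fun γ _ => by ring
  simp only [h]

theorem hasThetaLift_directSum {p : V → ℂ} {pM : M.real → ℂ} {pPerp : M.perp → ℂ}
    (hM : pM ∈ realPolyFunctions M.real) (hPerp : pPerp ∈ realPolyFunctions M.perp)
    (hp : ∀ x, p x = pM (M.projReal x) * pPerp (M.projPerp x)) (u : M.toLattice.Gr) (w : M.PerpGr)
    (kn ln : ℕ) (F : ℍ → L.Disc → ℂ) : L.HasThetaLift (M.directSum u w) (kn + ln) p F
      = M.toLattice.HasThetaLift u ln pM (M.thetaContraction w kn pPerp F) := by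
  funext c
  rw [EvenLattice.HasThetaLift, EvenLattice.HasThetaLift,
    M.truncatedLift_directSum hM hPerp hp u w kn ln F]

theorem thetaLift_directSum {p : V → ℂ} {pM : M.real → ℂ} {pPerp : M.perp → ℂ}
    (hM : pM ∈ realPolyFunctions M.real) (hPerp : pPerp ∈ realPolyFunctions M.perp)
    (hp : ∀ x, p x = pM (M.projReal x) * pPerp (M.projPerp x)) (u : M.toLattice.Gr) (w : M.PerpGr)
    (kn ln : ℕ) (F : ℍ → L.Disc → ℂ) : L.thetaLift (M.directSum u w) (kn + ln) p F
      = M.toLattice.thetaLift u ln pM (M.thetaContraction w kn pPerp F) := by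
  classical
  rw [EvenLattice.thetaLift, EvenLattice.thetaLift]
  -- Equal predicates make equal choices, so uniqueness of the constant term is not required; the
  -- default value 0 also agrees.
  exact congrArg (fun Q : ℂ → Prop => if h : ∃ c, Q c then h.choose else 0)
    (M.hasThetaLift_directSum hM hPerp hp u w kn ln F)

end PrimitiveSublattice

/-! ### Smoothness of Gaussian series -/

section GaussSeries

variable {X : Type*} {a b : X → ℝ} {c : X → ℂ}

/-- The series `∑ c(x) e(z a(x) / 2 + z̄ b(x) / 2)`. -/
def gaussSeries (a b : X → ℝ) (c : X → ℂ) (z : ℂ) : ℂ :=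
  ∑' x, c x * expTwoPiI (z * ((a x : ℝ) : ℂ) / 2 + (starRingEnd ℂ) z * ((b x : ℝ) : ℂ) / 2)

/-- The family `c` is summable against all Gaussians `exp (-η (a - b))`. -/
def GaussSummable (a b : X → ℝ) (c : X → ℂ) : Prop :=
  ∀ η : ℝ, 0 < η → Summable fun x => ‖c x‖ * Real.exp (-η * (a x - b x))

theorem norm_gaussSeries_term (x : X) (z : ℂ) :
    ‖c x * expTwoPiI (z * ((a x : ℝ) : ℂ) / 2 + (starRingEnd ℂ) z * ((b x : ℝ) : ℂ) / 2)‖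
      = ‖c x‖ * Real.exp (-(Real.pi * z.im) * (a x - b x)) := by
  rw [norm_mul, norm_expTwoPiI]
  congr 2
  simp
  ring

/-- Each derivative brings down a factor a(x) or b(x), which is absorbed by half of the Gaussian at
the cost of a constant 2/η. -/
theorem GaussSummable.mul_of_abs_le (hc : GaussSummable a b c) {d : X → ℝ}
    (hd : ∀ x, |d x| ≤ a x - b x) : GaussSummable a b fun x => c x * d x := by
  intro η hη
  refine Summable.of_nonneg_of_le (fun x => by positivity) (fun x => ?_)
    ((hc (η / 2) (half_pos hη)).mul_left (2 / η))
  have h1 : a x - b x ≤ 2 / η * Real.exp (η / 2 * (a x - b x)) := by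
    rw [div_mul_eq_mul_div, le_div_iff₀ hη]
    linarith [Real.add_one_le_exp (η / 2 * (a x - b x))]
  have h2 : Real.exp (η / 2 * (a x - b x)) * Real.exp (-η * (a x - b x))
      = Real.exp (-(η / 2) * (a x - b x)) := by
    rw [← Real.exp_add]; congr 1; ring
  rw [norm_mul, Complex.norm_real, Real.norm_eq_abs]
  calc ‖c x‖ * |d x| * Real.exp (-η * (a x - b x))
      ≤ ‖c x‖ * (2 / η * Real.exp (η / 2 * (a x - b x))) * Real.exp (-η * (a x - b x)) := by
        gcongr
        exact (hd x).trans h1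
    _ = 2 / η * (‖c x‖ * (Real.exp (η / 2 * (a x - b x)) * Real.exp (-η * (a x - b x)))) := by ring
    _ = _ := by rw [h2]

theorem GaussSummable.summable (hc : GaussSummable a b c) {z : ℂ} (hz : 0 < z.im) :
    Summable fun x => c x *
      expTwoPiI (z * ((a x : ℝ) : ℂ) / 2 + (starRingEnd ℂ) z * ((b x : ℝ) : ℂ) / 2) := by
  refine Summable.of_norm ((hc (Real.pi * z.im) (by positivity)).congr fun x => ?_)
  rw [norm_gaussSeries_term]

theorem hasFDerivAt_gaussSeries (ha : ∀ x, 0 ≤ a x) (hb : ∀ x, b x ≤ 0)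
    (hc : GaussSummable a b c) {z : ℂ} (hz : 0 < z.im) :
    HasFDerivAt (gaussSeries a b c)
      ((Real.pi * Complex.I * gaussSeries a b (fun x => c x * a x) z) •
          (ContinuousLinearMap.id ℝ ℂ) +
        (Real.pi * Complex.I * gaussSeries a b (fun x => c x * b x) z) •
          (Complex.conjCLE : ℂ →L[ℝ] ℂ)) z := by
  have hca : GaussSummable a b fun x => c x * a x := hc.mul_of_abs_le fun x => by
    rw [abs_of_nonneg (ha x)]; linarith [hb x]
  have hcb : GaussSummable a b fun x => c x * b x := hc.mul_of_abs_le fun x => by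
    rw [abs_of_nonpos (hb x)]; linarith [ha x]
  let e : X → ℂ → ℂ := fun x z =>
    expTwoPiI (z * ((a x : ℝ) : ℂ) / 2 + (starRingEnd ℂ) z * ((b x : ℝ) : ℂ) / 2)
  let f' : X → ℂ → ℂ →L[ℝ] ℂ := fun x z =>
    (Real.pi * Complex.I * (c x * a x * e x z)) • (ContinuousLinearMap.id ℝ ℂ) +
      (Real.pi * Complex.I * (c x * b x * e x z)) • (Complex.conjCLE : ℂ →L[ℝ] ℂ)
  have hy : 0 < z.im / 2 := half_pos hz
  -- On this half-plane a single Gaussian, taken at height Im z / 2, dominates all the derivatives.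
  let s : Set ℂ := {z' | z.im / 2 < z'.im}
  have hs : IsOpen s := isOpen_lt continuous_const Complex.continuous_im
  have hs' : IsPreconnected s := (convex_halfSpace_im_gt _).isPreconnected
  have hzs : z ∈ s := half_lt_self hz
  have hderiv : ∀ x, ∀ z' ∈ s, HasFDerivAt (fun z => c x * e x z) (f' x z') z' := by
    intro x z' _
    have h1 : HasFDerivAt (fun z : ℂ => 2 * Real.pi * Complex.I *
        (z * ((a x : ℝ) : ℂ) / 2 + (starRingEnd ℂ) z * ((b x : ℝ) : ℂ) / 2))
        ((Real.pi * Complex.I * a x) • (ContinuousLinearMap.id ℝ ℂ) +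
          (Real.pi * Complex.I * b x) • (Complex.conjCLE : ℂ →L[ℝ] ℂ)) z' := by
      have h2 := ((ContinuousLinearMap.id ℝ ℂ).hasFDerivAt (x := z')).const_mul
        (Real.pi * Complex.I * a x)
      have h3 := ((Complex.conjCLE : ℂ →L[ℝ] ℂ).hasFDerivAt (x := z')).const_mul
        (Real.pi * Complex.I * b x)
      refine (h2.add h3).congr_of_eventuallyEq (Eventually.of_forall fun z => ?_)
      simp
      ring
    have h4 := (h1.cexp).const_mul (c x)
    refine h4.congr_fderiv ?_
    ext1
    simp [f', e, expTwoPiI]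
    ring
  have hbound : ∀ x, ∀ z' ∈ s, ‖f' x z'‖ ≤
      Real.pi * (‖c x * a x‖ * Real.exp (-(Real.pi * (z.im / 2)) * (a x - b x))) +
      Real.pi * (‖c x * b x‖ * Real.exp (-(Real.pi * (z.im / 2)) * (a x - b x))) := by
    intro x z' hz'
    have hexp : Real.exp (-(Real.pi * z'.im) * (a x - b x))
        ≤ Real.exp (-(Real.pi * (z.im / 2)) * (a x - b x)) := by
      refine Real.exp_le_exp.2 (mul_le_mul_of_nonneg_right (neg_le_neg ?_) ?_)
      · exact mul_le_mul_of_nonneg_left (le_of_lt hz') Real.pi_pos.le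
      · linarith [ha x, hb x]
    have hn : ∀ d : ℂ, ‖(Real.pi * Complex.I * (d * e x z') : ℂ)‖
        ≤ Real.pi * (‖d‖ * Real.exp (-(Real.pi * (z.im / 2)) * (a x - b x))) := by
      intro d
      have h5 := norm_gaussSeries_term (a := a) (b := b) (c := fun _ => d) x z'
      rw [norm_mul, norm_mul, Complex.norm_I, mul_one, Complex.norm_real, Real.norm_eq_abs,
        abs_of_pos Real.pi_pos]
      refine mul_le_mul_of_nonneg_left (h5.le.trans ?_) Real.pi_pos.le
      exact mul_le_mul_of_nonneg_left hexp (norm_nonneg _)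
    refine (norm_add_le _ _).trans (add_le_add ?_ ?_)
    · rw [norm_smul]
      refine (mul_le_of_le_one_right (norm_nonneg _) ContinuousLinearMap.norm_id_le).trans (hn _)
    · rw [norm_smul]
      refine (mul_le_of_le_one_right (norm_nonneg _) ?_).trans (hn _)
      exact Complex.conjCLE_norm.le
  have hη : 0 < Real.pi * (z.im / 2) := by positivity
  have hmain := hasFDerivAt_tsum_of_isPreconnected
    (((hca _ hη).mul_left Real.pi).add ((hcb _ hη).mul_left Real.pi)) hs hs' hderiv hbound hzs
    (hc.summable hz) hzs
  refine hmain.congr_fderiv ?_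
  have hsa := ((hca.summable hz).mul_left (Real.pi * Complex.I : ℂ)).smul_const
    (ContinuousLinearMap.id ℝ ℂ)
  have hsb := ((hcb.summable hz).mul_left (Real.pi * Complex.I : ℂ)).smul_const
    (Complex.conjCLE : ℂ →L[ℝ] ℂ)
  have h6 := hsa.tsum_add hsb
  rw [((hca.summable hz).mul_left (Real.pi * Complex.I : ℂ)).tsum_smul_const,
    ((hcb.summable hz).mul_left (Real.pi * Complex.I : ℂ)).tsum_smul_const, tsum_mul_left,
    tsum_mul_left] at h6
  exact h6

/-- The derivative is built from series of the same kind, with coefficients c a along dz and c b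
along dz̄, so the induction on the order applies to all coefficient families at once. -/
theorem contDiffOn_gaussSeries (ha : ∀ x, 0 ≤ a x) (hb : ∀ x, b x ≤ 0)
    (hc : GaussSummable a b c) : ContDiffOn ℝ ∞ (gaussSeries a b c) {z | 0 < z.im} := by
  have ho : IsOpen {z : ℂ | 0 < z.im} := isOpen_lt continuous_const Complex.continuous_im
  rw [contDiffOn_infty]
  intro n
  induction n generalizing c with
  | zero =>
    refine contDiffOn_zero.2 fun z hz => ?_
    exact (hasFDerivAt_gaussSeries ha hb hc hz).continuousAt.continuousWithinAt
  | succ n ih =>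
    have hca : GaussSummable a b fun x => c x * a x := hc.mul_of_abs_le fun x => by
      rw [abs_of_nonneg (ha x)]; linarith [hb x]
    have hcb : GaussSummable a b fun x => c x * b x := hc.mul_of_abs_le fun x => by
      rw [abs_of_nonpos (hb x)]; linarith [ha x]
    push_cast
    refine (contDiffOn_succ_iff_fderiv_of_isOpen ho).2 ⟨fun z hz =>
      (hasFDerivAt_gaussSeries ha hb hc hz).differentiableAt.differentiableWithinAt,
      fun h => absurd h (by simp), ?_⟩
    refine ContDiffOn.congr (f := fun z =>
      (Real.pi * Complex.I * gaussSeries a b (fun x => c x * a x) z) •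
          (ContinuousLinearMap.id ℝ ℂ) +
        (Real.pi * Complex.I * gaussSeries a b (fun x => c x * b x) z) •
          (Complex.conjCLE : ℂ →L[ℝ] ℂ)) ?_ fun z hz => (hasFDerivAt_gaussSeries ha hb hc hz).fderiv
    exact ((contDiffOn_const.mul (ih hca)).smul contDiffOn_const).add
      ((contDiffOn_const.mul (ih hcb)).smul contDiffOn_const)

end GaussSeries

namespace Grass

variable {W : Type*} [AddCommGroup W] [Module ℝ W] {B : LinearMap.BilinForm ℝ W} (v : Grass B)

theorem form_projPos_nonneg (x : W) : 0 ≤ B (v.projPos x) (v.projPos x) := by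
  by_cases h : v.projPos x = 0
  · simp [h]
  · exact (v.pos_def _ (Submodule.projection_apply_mem v.isCompl x) h).le

theorem form_projNeg_nonpos (x : W) : B (v.projNeg x) (v.projNeg x) ≤ 0 := by
  by_cases h : v.projNeg x = 0
  · simp [h]
  · exact (v.neg_def _ (Submodule.projection_apply_mem v.isCompl.symm x) h).le

end Grass

namespace Grass.Frame

variable {W : Type*} [AddCommGroup W] [Module ℝ W] [FiniteDimensional ℝ W]
  {B : LinearMap.BilinForm ℝ W} {v : Grass B} {ι : Type} [Fintype ι] (E : v.Frame ι)

theorem subexpGrowth_evalPoly (P : MvPolynomial ι ℂ) :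
    SubexpGrowth E.basis.sqNorm (E.evalPoly P) := by
  induction P using MvPolynomial.induction_on with
  | C a =>
    have h : E.evalPoly (MvPolynomial.C a) = fun _ => a := by funext x; simp [evalPoly]
    rw [h]
    exact SubexpGrowth.const E.basis.sqNorm_nonneg a
  | add P Q hP hQ =>
    have h : E.evalPoly (P + Q) = fun x => E.evalPoly P x + E.evalPoly Q x := by
      funext x; simp [evalPoly]
    rw [h]
    exact hP.add hQ
  | mul_X P i hP =>
    have hX : SubexpGrowth E.basis.sqNorm fun x => ((E.basis.repr x i : ℝ) : ℂ) := by
      refine SubexpGrowth.of_norm_le_mul E.basis.sqNorm_nonneg (K := 1) fun x => ?_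
      rw [Complex.norm_real, Real.norm_eq_abs, one_mul]
      have h : E.basis.repr x i ^ 2 ≤ E.basis.sqNorm x :=
        Finset.single_le_sum (f := fun i => E.basis.repr x i ^ 2) (fun _ _ => sq_nonneg _)
          (Finset.mem_univ i)
      nlinarith [sq_abs (E.basis.repr x i), sq_nonneg (|E.basis.repr x i| - 1)]
    have h : E.evalPoly (P * MvPolynomial.X i)
        = fun x => E.evalPoly P x * ((E.basis.repr x i : ℝ) : ℂ) := by
      funext x; simp [evalPoly]
    rw [h]
    exact hP.mul hX

theorem gaussBound_evalPoly_mul_exp (P : MvPolynomial ι ℂ) {η : ℝ} (hη : 0 < η) :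
    E.basis.GaussBound fun x => E.evalPoly P x * (Real.exp (-η * E.basis.sqNorm x) : ℝ) := by
  obtain ⟨C, hC⟩ := E.subexpGrowth_evalPoly P (η / 2) (half_pos hη)
  refine ⟨C, η / 2, half_pos hη, fun x => ?_⟩
  rw [norm_mul, Complex.norm_real, Real.norm_eq_abs, Real.abs_exp]
  refine (mul_le_mul_of_nonneg_right (hC x) (Real.exp_pos _).le).trans (le_of_eq ?_)
  rw [mul_assoc, ← Real.exp_add]
  congr 2
  ring

theorem form_projPos_sub_form_projNeg (x : W) :
    B (v.projPos x) (v.projPos x) - B (v.projNeg x) (v.projNeg x) = E.basis.sqNorm x := by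
  rw [E.form_projPos, E.form_projNeg, ← Finset.sum_sub_distrib, Module.Basis.sqNorm]
  exact Finset.sum_congr rfl fun i _ => by split_ifs <;> ring

end Grass.Frame

/-! ### Smoothness and modularity of the theta contraction -/

namespace PrimitiveSublattice

variable {V : Type*} [AddCommGroup V] [Module ℝ V] [FiniteDimensional ℝ V] {L : EvenLattice V}
  (M : PrimitiveSublattice L) {p : M.perp → ℂ}

/-- The heat operator is a finite sum in powers of 1/y, so the function is a finite combination of
these powers with Gaussian series; polynomial coefficients are summable against every Gaussian. -/
theorem contDiffOn_fiberSum (hp : p ∈ realPolyFunctions M.perp) (w : M.PerpGr) (γ : L.Disc)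
    (δ : M.toLattice.Disc) :
    ContDiffOn ℝ ∞ (fun z : ℂ => M.fiberSum (w.thetaTerm p (ofComplex z)) γ δ) {z | 0 < z.im} := by
  obtain ⟨n', m', ⟨E'⟩⟩ := w.exists_frame M.isSymm_restrict_perp
  obtain ⟨P, rfl⟩ := E'.exists_evalPoly hp
  obtain ⟨N, hN⟩ := E'.exists_expLaplacian_eq_sum P
  set B := L.form.restrict M.perp
  let a : (L.dual ⧸ M.inDual) → ℝ := fun x =>
    B (w.projPos (M.quotToPerp x)) (w.projPos (M.quotToPerp x))
  let b : (L.dual ⧸ M.inDual) → ℝ := fun x =>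
    B (w.projNeg (M.quotToPerp x)) (w.projNeg (M.quotToPerp x))
  let c : ℕ → (L.dual ⧸ M.inDual) → ℂ := fun j x =>
    if (M.quotToDisc x, M.quotToSubDisc x) = (γ, δ) then
      E'.evalPoly (MvPolynomial.lap^[j] P) (M.quotToPerp x) else 0
  have hc : ∀ j, GaussSummable a b (c j) := by
    intro j η hη
    refine Summable.of_nonneg_of_le (fun x => by positivity) (fun x => ?_)
      (M.summable_quotToPerp E' (E'.gaussBound_evalPoly_mul_exp (MvPolynomial.lap^[j] P) hη))
    have hab : a x - b x = E'.basis.sqNorm (M.quotToPerp x) :=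
      E'.form_projPos_sub_form_projNeg _
    rw [hab, norm_mul, Complex.norm_real, Real.norm_eq_abs, Real.abs_exp]
    refine mul_le_mul_of_nonneg_right ?_ (Real.exp_pos _).le
    simp only [c]
    split_ifs
    · exact le_rfl
    · simp
  have hsmooth : ContDiffOn ℝ ∞ (fun z : ℂ => ∑ j ∈ Finset.range N,
      ((((-1 / (8 * Real.pi * z.im)) ^ j / j.factorial : ℝ) : ℝ) : ℂ) * gaussSeries a b (c j) z)
      {z | 0 < z.im} := by
    refine ContDiffOn.sum fun j _ => ContDiffOn.mul ?_
      (contDiffOn_gaussSeries (fun x => w.form_projPos_nonneg _)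
        (fun x => w.form_projNeg_nonpos _) (hc j))
    refine Complex.ofRealCLM.contDiff.comp_contDiffOn ?_
    refine ContDiffOn.div_const (ContDiffOn.pow (ContDiffOn.div contDiffOn_const
      (contDiffOn_const.mul Complex.imCLM.contDiff.contDiffOn) fun z hz => ?_) _) _
    have hz' : 0 < z.im := hz
    exact mul_ne_zero (by positivity) hz'.ne'
  refine hsmooth.congr fun z hz => ?_
  have hz' : 0 < z.im := hz
  have him : (ofComplex z).im = z.im := by rw [ofComplex_apply_of_im_pos hz']; rfl
  have hco : ((ofComplex z : ℍ) : ℂ) = z := by rw [ofComplex_apply_of_im_pos hz']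
  simp only [gaussSeries, ← tsum_mul_left]
  rw [← Summable.tsum_finsetSum fun j _ => ((hc j).summable hz').mul_left _, fiberSum]
  refine tsum_congr fun x => ?_
  simp only [c]
  split_ifs
  · rw [Grass.thetaTerm, hN, him, hco, Finset.sum_mul]
    exact Finset.sum_congr rfl fun j _ => mul_assoc _ _ _
  · simp

theorem contDiffOn_thetaContraction {k : ℤ} {F : ℍ → L.Disc → ℂ} (hF : L.IsDualModularForm k F)
    (hp : p ∈ realPolyFunctions M.perp) (w : M.PerpGr) (kn : ℕ) :
    ContDiffOn ℝ ∞ (fun z : ℂ => M.thetaContraction w kn p F (ofComplex z)) {z | 0 < z.im} := by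
  refine contDiffOn_pi.2 fun δ => ?_
  simp only [M.thetaContraction_apply hp]
  refine ContDiffOn.mul (Complex.ofRealCLM.contDiff.comp_contDiffOn ?_)
    (ContDiffOn.sum fun γ _ => (M.contDiffOn_fiberSum hp w γ δ).mul (contDiffOn_pi.1 hF.1 γ))
  have him : ContDiffOn ℝ ∞ (fun z : ℂ => (ofComplex z).im) {z | 0 < z.im} := by
    refine Complex.imCLM.contDiff.contDiffOn.congr fun z hz => ?_
    rw [ofComplex_apply_of_im_pos hz]
    rfl
  exact him.rpow_const_of_ne fun z _ => (ofComplex z).im_pos.ne'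

theorem isDualModularForm_thetaContraction {k : ℤ} {F : ℍ → L.Disc → ℂ}
    (hF : L.IsDualModularForm k F) {w : M.PerpGr} {kp kn : ℕ} (hp : w.IsHomogeneous p kp kn) {k' : ℤ}
    (hk : k - ((L.bNeg : ℤ) - L.bPos)
      = k' - ((M.toLattice.bNeg : ℤ) - M.toLattice.bPos) + 2 * ((kn : ℤ) - kp)) :
    M.toLattice.IsDualModularForm k' (M.thetaContraction w kn p F) := by
  refine ⟨M.contDiffOn_thetaContraction hF hp.1 w kn, M.toLattice.dual_law_of_generators
    (M.thetaContraction_T hF hp.1 w kn) (M.thetaContraction_S hF hp ?_)⟩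
  -- Additivity of the signature leaves only the contribution of M_ℝ^⊥ to the weight.
  rw [M.sigPos_add w, M.sigNeg_add w] at hk
  push_cast at hk
  linarith

end PrimitiveSublattice

end

theorem mainTheorem1 {V : Type*} [AddCommGroup V] [Module ℝ V] [FiniteDimensional ℝ V]
    (L : EvenLattice V) (M : PrimitiveSublattice L) (uPerp : M.PerpGr)
    (mp mn np nn : ℕ) (hnp : np ≤ mp) (hnn : nn ≤ mn)
    (pL : L.Gr → V → ℂ) (pM : M.toLattice.Gr → M.real → ℂ) (pPerp : M.perp → ℂ)
    (hpM : ∀ u : M.toLattice.Gr, u.IsHomogeneous (pM u) np nn)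
    (hpPerp : uPerp.IsHomogeneous pPerp (mp - np) (mn - nn))
    (hpL : ∀ (u : M.toLattice.Gr) (x : V),
      pL (M.directSum u uPerp) x = pM u (M.projReal x) * pPerp (M.projPerp x))
    (F : ℍ → L.Disc → ℂ)
    (hF : L.IsDualModularForm
      ((L.bNeg : ℤ) - (L.bPos : ℤ) + 2 * ((mn : ℤ) - (mp : ℤ))) F) :
    M.toLattice.IsDualModularForm
        ((M.toLattice.bNeg : ℤ) - (M.toLattice.bPos : ℤ) + 2 * ((nn : ℤ) - (np : ℤ)))
        (M.thetaContraction uPerp (mn - nn) pPerp F) ∧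
      ∀ u : M.toLattice.Gr,
        (∀ c : ℂ, L.HasThetaLift (M.directSum u uPerp) mn (pL (M.directSum u uPerp)) F c ↔
          M.toLattice.HasThetaLift u nn (pM u)
            (M.thetaContraction uPerp (mn - nn) pPerp F) c) ∧
        L.thetaLift (M.directSum u uPerp) mn (pL (M.directSum u uPerp)) F =
          M.toLattice.thetaLift u nn (pM u)
            (M.thetaContraction uPerp (mn - nn) pPerp F) := by
  refine ⟨M.isDualModularForm_thetaContraction hF hpPerp ?_, fun u => ?_⟩
  -- The degrees of `pPerp` are truncated differences; the bounds `hnp` and `hnn` make them true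
  -- differences in the weight.
  · rw [Nat.cast_sub hnp, Nat.cast_sub hnn]
    ring
  · have h := M.hasThetaLift_directSum (hpM u).1 hpPerp.1 (hpL u) u uPerp (mn - nn) nn F
    have h' := M.thetaLift_directSum (hpM u).1 hpPerp.1 (hpL u) u uPerp (mn - nn) nn F
    rw [Nat.sub_add_cancel hnn] at h h'
    exact ⟨fun c => iff_of_eq (congrFun h c), h'⟩
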